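/- **Setting.** Let $d\ge 2$, let $\Omega\subset\mathbb R^d$ be a bounded polyhedral open set with a conforming simplicial triangulation $\mathcal T_h$ into open simplices $K$ (a finite simplicial complex whose closed $d$-simplices have union $\overline\Omega$, with every $K\subset\Omega$). Let $\mathcal E_h$ be the set of its $(d-1)$-dimensional faces, $\partial K$ the set of faces of $K$, and $\boldsymbol n$ the outward unit normal on $\partial K$. Let $\epsilon>0$, $f\in L^2(\Omega)$, $g\in L^2(\partial\Omega)$ (for instance $g\in H^{1/2}(\partial\Omega)$), and let $\boldsymbol\beta\in W^{1,\infty}(\Omega;\mathbb R^d)$ (represented by a function continuous on $\overline\Omega$) with $-\nabla\cdot\boldsymbol\beta\ge 0$ almost everywhere in $\Omega$. Let $\tau\ge 0$ be constant on each face of each element (it may take different values on the two sides of an interior face), with $\inf_{x\in F}\bigl(\tau-\tfrac12\boldsymbol\beta(x)\cdot\boldsymbol n\bigr)\ge 0$ for all $F\in\partial K$, $K\in\mathcal T_h$, the inequality being strict on at least one face of each element. For $k\ge 0$ let $\boldsymbol V_h,W_h$ be the spaces of vector- and scalar-valued functions on $\Omega$ that are polynomials of total degree at most $k$ on each $K\in\mathcal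 T_h$; let $M_h$ be the space of $\mu\in L^2(\mathcal E_h)$ (single-valued on each face) that are polynomials of degree at most $k$ on each face, and $M_h(g)=\{\mu\in M_h:\langle\mu,\xi\rangle_{\partial\Omega}=\langle g,\xi\rangle_{\partial\Omega}\ \forall\xi\in M_h\}$, where $\langle\xi,\eta\rangle_{\partial\Omega}=\sum_{F\subset\partial\Omega}\int_F\xi\eta\,ds$. Write $(\eta,\zeta)_{\mathcal T_h}=\sum_{K}\int_K\eta\zeta\,dx$ and $\langle\eta,\zeta\rangle_{\partial\mathcal T_h}=\sum_K\int_{\partial K}\eta\zeta\,ds$; the subscript $\partial\mathcal T_h\setminus\partial\Omega$ means that the faces $F\subset\partial\Omega$ are left out of the last sum. *HDG method.* Find $(\boldsymbol q_h,u_h,\widehat u_h)\in\boldsymbol V_h\times W_h\times M_h$ such that, for all $(\boldsymbol r,w,\mu)\in\boldsymbol V_h\times W_h\times M_h$, $$\begin{aligned} (\epsilon^{-1}\boldsymbol q_h,\boldsymbol r)_{\mathcal T_h}-(u_h,\nabla\cdot\boldsymbol r)_{\mathcal T_h}+\langle\widehat u_h,\boldsymbol r\cdot\boldsymbol n\rangle_{\partial\mathcal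 T_h}&=0,\\ -(\boldsymbol q_h+\boldsymbol\beta u_h,\nabla w)_{\mathcal T_h}-((\nabla\cdot\boldsymbol\beta)u_h,w)_{\mathcal T_h}+\langle \sigma_h,w\rangle_{\partial\mathcal T_h}&=(f,w)_{\mathcal T_h},\\ \langle\widehat u_h,\mu\rangle_{\partial\Omega}&=\langle g,\mu\rangle_{\partial\Omega},\\ \langle\sigma_h,\mu\rangle_{\partial\mathcal T_h\setminus\partial\Omega}&=0, \end{aligned}$$ where $\sigma_h=\boldsymbol q_h\cdot\boldsymbol n+\boldsymbol\beta\cdot\boldsymbol n\,\widehat u_h+\tau(u_h-\widehat u_h)$. *Local solvers.* Given $\lambda\in L^2(\mathcal E_h)$ and $f\in L^2(\Omega)$, the local problem on $K\in\mathcal T_h$ is to find $(\boldsymbol q,u)\in P_k(K;\mathbb R^d)\times P_k(K)$ such that, for all $(\boldsymbol r,w)\in P_k(K;\mathbb R^d)\times P_k(K)$, $$\begin{aligned} (\epsilon^{-1}\boldsymbol q,\boldsymbol r)_K-(u,\nabla\cdot\boldsymbol r)_K&=-\langle\lambda,\boldsymbol r\cdot\boldsymbol n\rangle_{\partial K},\\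 (\nabla\cdot\boldsymbol q,w)_K-(u,\nabla\cdot(\boldsymbol\beta w))_K+\langle\tau u,w\rangle_{\partial K}&=\langle(\tau-\boldsymbol\beta\cdot\boldsymbol n)\lambda,w\rangle_{\partial K}+(f,w)_K . \end{aligned}$$ Let $(\boldsymbol q_h^\lambda,u_h^\lambda)$ be its solution (on all elements) when $f=0$, and $(\boldsymbol q_h^f,u_h^f)$ its solution when $\lambda=0$. For $\lambda,\mu\in L^2(\mathcal E_h)$ put $$a_h(\lambda,\mu)=-\langle\boldsymbol q_h^\lambda\cdot\boldsymbol n,\mu\rangle_{\partial\mathcal T_h}-\langle\tau(u_h^\lambda-\lambda),\mu\rangle_{\partial\mathcal T_h},\qquad b_h(\mu)=\langle\boldsymbol q_h^f\cdot\boldsymbol n,\mu\rangle_{\partial\mathcal T_h}+\langle\tau u_h^f,\mu\rangle_{\partial\mathcal T_h}.$$ **Theorem.** Every local problem has exactly one solution, and the HDG method has exactly one solution $(\boldsymbol q_h,u_h,\widehat u_h)$. It satisfies $$(\boldsymbol q_h,u_h)=(\boldsymbol q_h^{\widehat u_h},u_h^{\widehat u_h})+(\boldsymbol q_h^f,u_h^f).$$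 Moreover $\widehat u_h\in M_h(g)$, and $\widehat u_h$ is the unique $\lambda\in M_h(g)$ such that $$a_h(\lambda,\mu)=b_h(\mu)\qquad\forall\mu\in M_h(0).$$ Finally, for all $\lambda,\mu\in L^2(\mathcal E_h)$, $$\begin{aligned} a_h(\lambda,\mu)&=(\epsilon^{-1}\boldsymbol q_h^\lambda,\boldsymbol q_h^\mu)_{\mathcal T_h}-(u_h^\lambda,\nabla\cdot(\boldsymbol\beta u_h^\mu))_{\mathcal T_h}+\langle\boldsymbol\beta\cdot\boldsymbol n\,\lambda,u_h^\mu\rangle_{\partial\mathcal T_h}+\langle\tau(u_h^\lambda-\lambda),u_h^\mu-\mu\rangle_{\partial\mathcal T_h},\\ b_h(\mu)&=(f,u_h^\mu)_{\mathcal T_h}+\langle\boldsymbol\beta\cdot\boldsymbol n\,u_h^f,\mu\rangle_{\partial\mathcal T_h}+(u_h^f,\boldsymbol\beta\cdot\nabla u_h^\mu)_{\mathcal T_h}-(\nabla u_h^f,\boldsymbol\beta u_h^\mu)_{\mathcal T_h}. \end{aligned}$$ -/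

import Mathlib

open MeasureTheory Set
open scoped NNReal

noncomputable section

namespace HDG

/-- The Euclidean space `ℝᵈ`. -/
abbrev Euc (d : ℕ) : Type := EuclideanSpace ℝ (Fin d)

/-- The divergence `∇ · v = ∑ᵢ ∂ᵢ vᵢ` of a vector field. -/
def divergence {d : ℕ} (v : Euc d → Euc d) (x : Euc d) : ℝ :=
  ∑ i : Fin d, (fderiv ℝ v x (EuclideanSpace.single i 1)) i

/-- `β ∈ W^{1,∞}(Ω; ℝᵈ)` for a bounded open set `Ω`, through its continuous representative on the
closure of `Ω`: with a uniform constant, `β` is Lipschitz along the segments contained in `Ω`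
(so its gradient exists almost everywhere in `Ω`, is the weak gradient, and is bounded).
The values of `β` outside the closure of `Ω` play no role. -/
def IsW1Infty {d : ℕ} (Ω : Set (Euc d)) (β : Euc d → Euc d) : Prop :=
  ContinuousOn β (closure Ω) ∧
    ∃ L : ℝ, ∀ x y : Euc d, segment ℝ x y ⊆ Ω → ‖β x - β y‖ ≤ L * ‖x - y‖

/-- A conforming simplicial triangulation of `Ω ⊆ ℝᵈ`: a finite geometric simplicial complex
(any two simplices meet in the simplex of their common vertices, or not at all), all of
whose simplices are faces of `d`-dimensional ones, whose union is the closure of `Ω`, and whose open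
`d`-dimensional simplices lie in `Ω`. A simplex is given by the finite set of its vertices. -/
structure Triangulation {d : ℕ} (Ω : Set (Euc d)) extends Geometry.SimplicialComplex ℝ (Euc d) where
  finite_faces : faces.Finite
  pure : ∀ s ∈ faces, ∃ K ∈ faces, s ⊆ K ∧ K.card = d + 1
  space_eq : (⋃ s ∈ faces, convexHull ℝ (s : Set (Euc d))) = closure Ω
  open_subset : ∀ K ∈ faces, K.card = d + 1 → interior (convexHull ℝ (K : Set (Euc d))) ⊆ Ω

/-- The surface (`(d-1)`-dimensional Euclidean Hausdorff) measure on `ℝᵈ`. -/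
def surface (d : ℕ) : Measure (Euc d) := Measure.euclideanHausdorffMeasure (d - 1)

/-- The surface measure on the simplex with vertex set `F`. -/
def faceMeasure {d : ℕ} (F : Finset (Euc d)) : Measure (Euc d) :=
  (surface d).restrict (convexHull ℝ (F : Set (Euc d)))

/-- The barycentre of a finite set of points. -/
def barycentre {d : ℕ} (s : Finset (Euc d)) : Euc d := (s.card : ℝ)⁻¹ • ∑ v ∈ s, v

/-- The unit normal, outward with respect to the simplex `K`, on its facet `F`: the normalization
of the component orthogonal to `F` of the vector from the barycentre of `K` to that of `F`. -/
def normal {d : ℕ} (K F : Finset (Euc d)) : Euc d :=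
  NormedSpace.normalize
    ((vectorSpan ℝ (F : Set (Euc d)))ᗮ.starProjection (barycentre F - barycentre K))

/-- `P_k(ℝᵈ)`: polynomial functions of total degree at most `k`. -/
def Poly (d k : ℕ) : Submodule ℝ (Euc d → ℝ) where
  carrier := {f | ∃ p : MvPolynomial (Fin d) ℝ,
    p.totalDegree ≤ k ∧ ∀ x, f x = MvPolynomial.eval (fun i => x i) p}
  zero_mem' := ⟨0, by simp, by simp⟩
  add_mem' := by
    rintro f g ⟨p, hp, hf⟩ ⟨q, hq, hg⟩
    exact ⟨p + q, (MvPolynomial.totalDegree_add p q).trans (max_le hp hq),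
      fun x => by simp [hf, hg]⟩
  smul_mem' := by
    rintro c f ⟨p, hp, hf⟩
    exact ⟨c • p, (MvPolynomial.totalDegree_smul_le c p).trans hp, fun x => by simp [hf]⟩

/-- `P_k(ℝᵈ; ℝᵈ)`: vector fields all of whose components belong to `P_k(ℝᵈ)`. -/
def VPoly (d k : ℕ) : Submodule ℝ (Euc d → Euc d) where
  carrier := {v | ∀ i, (fun x => v x i) ∈ Poly d k}
  zero_mem' := fun _ => (Poly d k).zero_mem
  add_mem' := fun hv hw i => (Poly d k).add_mem (hv i) (hw i)
  smul_mem' := fun c _ hv i => (Poly d k).smul_mem c (hv i)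

namespace Triangulation

variable {d : ℕ} {Ω : Set (Euc d)} (T : Triangulation Ω)

/-- The elements of the triangulation, i.e. the set `𝒯_h`. -/
def Elem : Type := {K : Finset (Euc d) // K ∈ T.faces ∧ K.card = d + 1}

/-- The `(d-1)`-dimensional faces of the triangulation, i.e. the set `ℰ_h`. -/
def Face : Type := {F : Finset (Euc d) // F ∈ T.faces ∧ F.card = d}

instance : Fintype T.Elem :=
  (T.finite_faces.subset (t := {K | K ∈ T.faces ∧ K.card = d + 1}) fun _ h => h.1).fintype

instance : Fintype T.Face :=
  (T.finite_faces.subset (t := {F | F ∈ T.faces ∧ F.card = d}) fun _ h => h.1).fintype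

variable {T} in
/-- An element as an open subset of `ℝᵈ`. -/
def Elem.dom (K : T.Elem) : Set (Euc d) := interior (convexHull ℝ (K.1 : Set (Euc d)))

variable {T} in
/-- A face as a (closed) subset of `ℝᵈ`. -/
def Face.set (F : T.Face) : Set (Euc d) := convexHull ℝ (F.1 : Set (Euc d))

open Classical in
variable {T} in
/-- `∂K`: the set of faces of the element `K`. -/
def Elem.bd (K : T.Elem) : Finset T.Face := Finset.univ.filter fun F => F.1 ⊆ K.1

variable {T} in
/-- `F` is a boundary face, `F ⊆ ∂Ω`. -/
def Face.IsBoundary (F : T.Face) : Prop := F.set ⊆ frontier Ω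

/-- `L²(ℰ_h)`: the (single-valued) square integrable functions on the faces. -/
abbrev Skel : Type := (F : T.Face) → Lp ℝ 2 (faceMeasure F.1)

/-- `W_h`: piecewise polynomials. Since elements have nonempty interior, a
polynomial on an element is the same as a polynomial on `ℝᵈ`. -/
abbrev WSpace (k : ℕ) : Type := T.Elem → Poly d k

/-- `V_h`: piecewise polynomial vector fields. -/
abbrev VSpace (k : ℕ) : Type := T.Elem → VPoly d k

/-- `M_h`: the functions in `L²(ℰ_h)` whose restriction to every face `F` belongs to `P_k(F)`. -/
def MSpace (k : ℕ) : Set T.Skel :=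
  {μ | ∀ F : T.Face, ∃ p ∈ Poly d k, ⇑(μ F) =ᵐ[faceMeasure F.1] p}

/-- `(η, ζ)_{𝒯_h} = ∑_K ∫_K η ζ dx`, for the product `η ζ` given elementwise. -/
def vol (φ : T.Elem → Euc d → ℝ) : ℝ := ∑ K : T.Elem, ∫ x in K.dom, φ K x

/-- `∫_{∂K} φ ds`. -/
def bdInt (K : T.Elem) (φ : T.Face → Euc d → ℝ) : ℝ :=
  ∑ F ∈ K.bd, ∫ x, φ F x ∂(faceMeasure F.1)

/-- `⟨η, ζ⟩_{∂𝒯_h} = ∑_K ∫_{∂K} η ζ ds`, for the product `η ζ` given on each element boundary. -/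
def bds (φ : T.Elem → T.Face → Euc d → ℝ) : ℝ := ∑ K : T.Elem, T.bdInt K (φ K)

open Classical in
/-- `⟨η, ζ⟩_{∂𝒯_h∖∂Ω}`: as `bds`, without the faces on `∂Ω`. -/
def bdsInterior (φ : T.Elem → T.Face → Euc d → ℝ) : ℝ :=
  ∑ K : T.Elem, ∑ F ∈ K.bd with ¬ F.IsBoundary, ∫ x, φ K F x ∂(faceMeasure F.1)

open Classical in
/-- `⟨η, ζ⟩_{∂Ω} = ∑_{F ⊆ ∂Ω} ∫_F η ζ ds`. -/
def bdOmega (φ : T.Face → Euc d → ℝ) : ℝ :=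
  ∑ F : T.Face with F.IsBoundary, ∫ x, φ F x ∂(faceMeasure F.1)

/-- `L²(Ω)`. -/
abbrev _root_.HDG.L2 {d : ℕ} (Ω : Set (Euc d)) : Type := Lp ℝ 2 (volume.restrict Ω)

/-- `L²(∂Ω)`. -/
abbrev _root_.HDG.L2Bd {d : ℕ} (Ω : Set (Euc d)) : Type := Lp ℝ 2 ((surface d).restrict (frontier Ω))

/-- `M_h(g) = {μ ∈ M_h : ⟨μ, ξ⟩_{∂Ω} = ⟨g, ξ⟩_{∂Ω} for all ξ ∈ M_h}`. -/
def MSpaceBC (k : ℕ) (g : L2Bd Ω) : Set T.Skel :=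
  {μ | μ ∈ T.MSpace k ∧ ∀ ξ ∈ T.MSpace k,
    T.bdOmega (fun F x => μ F x * ξ F x) = T.bdOmega (fun F x => g x * ξ F x)}

/-- The condition on the stabilization function `τ` (constant on each face of each element):
`τ ≥ 0`, `inf_F (τ - β·n/2) ≥ 0` for every face of every element, with strict inequality on at least
one face of each element. The infimum is a minimum, as `β` is continuous on the compact face. -/
def IsAdmissible (β : Euc d → Euc d) (τ : T.Elem → T.Face → ℝ) : Prop :=
  ∀ K : T.Elem,
    (∀ F ∈ K.bd, 0 ≤ τ K F ∧
      ∀ x ∈ F.set, 0 ≤ τ K F - (1 / 2) * inner ℝ (β x) (normal K.1 F.1)) ∧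
    ∃ F ∈ K.bd, ∀ x ∈ F.set, 0 < τ K F - (1 / 2) * inner ℝ (β x) (normal K.1 F.1)

/-- `(q, u, û) ∈ V_h × W_h × M_h` solves the HDG equations, with the numerical trace
`q·n + (β·n) û + τ (u - û)`. -/
structure IsHDGSolution (k : ℕ) (ε : ℝ) (β : Euc d → Euc d) (τ : T.Elem → T.Face → ℝ)
    (f : L2 Ω) (g : L2Bd Ω) (q : T.VSpace k) (u : T.WSpace k) (uhat : T.Skel) : Prop where
  mem : uhat ∈ T.MSpace k
  eq_flux : ∀ r : T.VSpace k,
    T.vol (fun K x => ε⁻¹ * inner ℝ ((q K).1 x) ((r K).1 x))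
      - T.vol (fun K x => (u K).1 x * divergence (r K).1 x)
      + T.bds (fun K F x => uhat F x * inner ℝ ((r K).1 x) (normal K.1 F.1)) = 0
  eq_scalar : ∀ w : T.WSpace k,
    - T.vol (fun K x => inner ℝ ((q K).1 x + (u K).1 x • β x) (gradient (w K).1 x))
      - T.vol (fun K x => divergence β x * (u K).1 x * (w K).1 x)
      + T.bds (fun K F x =>
          (inner ℝ ((q K).1 x) (normal K.1 F.1) + inner ℝ (β x) (normal K.1 F.1) * uhat F x
            + τ K F * ((u K).1 x - uhat F x)) * (w K).1 x)
      = T.vol (fun K x => f x * (w K).1 x)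
  eq_boundary : ∀ μ ∈ T.MSpace k,
    T.bdOmega (fun F x => uhat F x * μ F x) = T.bdOmega (fun F x => g x * μ F x)
  eq_transmission : ∀ μ ∈ T.MSpace k,
    T.bdsInterior (fun K F x =>
      (inner ℝ ((q K).1 x) (normal K.1 F.1) + inner ℝ (β x) (normal K.1 F.1) * uhat F x
        + τ K F * ((u K).1 x - uhat F x)) * μ F x) = 0

/-- `(q, u) ∈ V(K) × W(K)` solves the local problem on the element `K` with data `lam`, `f`. -/
def IsLocalSolution (k : ℕ) (ε : ℝ) (β : Euc d → Euc d) (τ : T.Elem → T.Face → ℝ)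
    (lam : T.Skel) (f : L2 Ω) (K : T.Elem) (s : VPoly d k × Poly d k) : Prop :=
  (∀ r : VPoly d k,
    (∫ x in K.dom, ε⁻¹ * inner ℝ (s.1.1 x) (r.1 x)) - (∫ x in K.dom, s.2.1 x * divergence r.1 x)
      = - T.bdInt K (fun F x => lam F x * inner ℝ (r.1 x) (normal K.1 F.1))) ∧
  (∀ w : Poly d k,
    (∫ x in K.dom, divergence s.1.1 x * w.1 x)
      - (∫ x in K.dom, s.2.1 x * divergence (fun y => w.1 y • β y) x)
      + T.bdInt K (fun F x => τ K F * s.2.1 x * w.1 x)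
      = T.bdInt K (fun F x => (τ K F - inner ℝ (β x) (normal K.1 F.1)) * lam F x * w.1 x)
        + ∫ x in K.dom, f x * w.1 x)

/-- The local solver: on every element, the solution of the local problem with data `lam`, `f`.
(It is meaningful where that problem has exactly one solution.) -/
def solver (k : ℕ) (ε : ℝ) (β : Euc d → Euc d) (τ : T.Elem → T.Face → ℝ)
    (lam : T.Skel) (f : L2 Ω) : T.VSpace k × T.WSpace k :=
  (fun K => (Classical.epsilon (T.IsLocalSolution k ε β τ lam f K)).1,
   fun K => (Classical.epsilon (T.IsLocalSolution k ε β τ lam f K)).2)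

section forms

variable (k : ℕ) (ε : ℝ) (β : Euc d → Euc d) (τ : T.Elem → T.Face → ℝ)

/-- `q_h^λ`: the flux part of the local solution for `f = 0`. -/
def qLam (lam : T.Skel) : T.VSpace k := (T.solver k ε β τ lam 0).1

/-- `u_h^λ`: the scalar part of the local solution for `f = 0`. -/
def uLam (lam : T.Skel) : T.WSpace k := (T.solver k ε β τ lam 0).2

/-- `q_h^f`: the flux part of the local solution for `λ = 0`. -/
def qSrc (f : L2 Ω) : T.VSpace k := (T.solver k ε β τ 0 f).1

/-- `u_h^f`: the scalar part of the local solution for `λ = 0`. -/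
def uSrc (f : L2 Ω) : T.WSpace k := (T.solver k ε β τ 0 f).2

/-- `a_h(λ, μ) = -⟨q_h^λ·n, μ⟩_{∂𝒯_h} - ⟨τ (u_h^λ - λ), μ⟩_{∂𝒯_h}`. -/
def aForm (lam μ : T.Skel) : ℝ :=
  - T.bds (fun K F x => inner ℝ ((T.qLam k ε β τ lam K).1 x) (normal K.1 F.1) * μ F x)
    - T.bds (fun K F x => τ K F * ((T.uLam k ε β τ lam K).1 x - lam F x) * μ F x)

/-- `b_h(μ) = ⟨q_h^f·n, μ⟩_{∂𝒯_h} + ⟨τ u_h^f, μ⟩_{∂𝒯_h}`. -/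
def bForm (f : L2 Ω) (μ : T.Skel) : ℝ :=
  T.bds (fun K F x => inner ℝ ((T.qSrc k ε β τ f K).1 x) (normal K.1 F.1) * μ F x)
    + T.bds (fun K F x => τ K F * (T.uSrc k ε β τ f K).1 x * μ F x)

end forms

end Triangulation

end HDG

end

noncomputable section

namespace HDG

open Module
open scoped ENNReal

/-! ### The surface measure on hyperplanes -/

/-! Both the local problems and the problem for the trace are square linear systems in finite
dimension, so only injectivity has to be proved, and it comes from one energy identity.

On an element `K`, the local equations for `λ` tested with their own solution give the element's
share of `a_h(λ, λ)`. The divergence theorem for `u²β` turns the convective terms into squares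
(`elem_energy`): what remains is `ε⁻¹|q|²`, `-½ (∇·β) u²` and `(τ - ½ β·n)(u - λ)²`, all
nonnegative, plus the boundary term `½ β·n λ²`. If the first three vanish, then `q = 0`, and `u = λ`
on the one face where `τ - ½ β·n > 0`. The flux equation then carries this information to the whole
element (`const_and_trace_eq`): testing it with fields parallel to an edge shows that `u` is
constant, and that `λ = u` on every face where `λ` is a polynomial. For `λ = 0` this gives `u = 0`,
hence unique solvability of the local problems (`existsUnique_isLocalSolution`).

For the global problem, take `λ ∈ M_h(0)`. The terms `½ β·n λ²` cancel across interior faces and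
vanish on `∂Ω`, so `a_h(λ, λ)` is a sum of element energies (`aForm_self_eq`). If it is zero, `λ`
equals a constant `c_K` on each `∂K`. The flux of the single-valued field `λ² x` also cancels,
whereas by the divergence theorem it equals `∑ c_K² d |K|`; hence every `c_K` is zero. This shows
that `a_h` is definite on `M_h(0)` without any appeal to connectedness.

The HDG equations decouple element by element: the first two are exactly the local problems with
data `û` and `f`, so linearity gives the splitting, and the transmission condition becomes `a_h(û,
μ) = b_h(μ)` (`isHDGSolution_iff`). The two formulas for the forms follow by testing local problems
against each other.

Two geometric facts support all this. The divergence theorem for Lipschitz fields on a simplex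
(`setIntegral_divergence_simplexSet`) is obtained by integrating along edges and sliding one facet
onto another. The cancellation of normals (`Face.sum_normal_eq_zero`) is derived from the
intersection property of a simplicial complex and the fact that the elements cover the closure of
`Ω`. -/

/-- The affine hyperplane `{x | ⟨a, x⟩ = c}`. -/
def hyperplane {d : ℕ} (a : Euc d) (c : ℝ) : Set (Euc d) := {x | inner ℝ a x = c}

lemma isClosed_hyperplane {d : ℕ} (a : Euc d) (c : ℝ) : IsClosed (hyperplane a c) :=
  isClosed_eq (by fun_prop) continuous_const

lemma finrank_orthogonal_span_singleton' {d : ℕ} {a : Euc d} (ha : a ≠ 0) :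
    finrank ℝ (ℝ ∙ a)ᗮ = d - 1 := by
  have h1 := (ℝ ∙ a).finrank_add_finrank_orthogonal
  rw [finrank_span_singleton ha, finrank_euclideanSpace_fin] at h1
  omega

/-- The surface measure on a hyperplane is the Lebesgue measure of its direction. -/
lemma surface_restrict_hyperplane {d : ℕ} {a : Euc d} (ha : a ≠ 0) {c : ℝ} {p : Euc d}
    (hp : inner ℝ a p = c) :
    (surface d).restrict (hyperplane a c) =
      (volume : Measure (ℝ ∙ a)ᗮ).map (fun y : (ℝ ∙ a)ᗮ => (y : Euc d) + p) := by
  have hiso : Isometry (fun y : (ℝ ∙ a)ᗮ => (y : Euc d) + p) :=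
    (IsometryEquiv.addRight p).isometry.comp isometry_subtype_coe
  have hrange : range (fun y : (ℝ ∙ a)ᗮ => (y : Euc d) + p) = hyperplane a c := by
    ext x
    constructor
    · rintro ⟨y, rfl⟩
      have := Submodule.mem_orthogonal_singleton_iff_inner_right.1 y.2
      simp [hyperplane, inner_add_right, this, hp]
    · intro hx
      refine ⟨⟨x - p, Submodule.mem_orthogonal_singleton_iff_inner_right.2 ?_⟩, by simp⟩
      simp [inner_sub_right, hp, show inner ℝ a x = c from hx]
  rw [← InnerProductSpace.euclideanHausdorffMeasure_eq_volume,
    hiso.map_euclideanHausdorffMeasure, hrange, surface, finrank_orthogonal_span_singleton' ha]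

lemma sfinite_surface_hyperplane {d : ℕ} {a : Euc d} (ha : a ≠ 0) (c : ℝ) :
    SFinite ((surface d).restrict (hyperplane a c)) := by
  have hn : (inner ℝ a a : ℝ) ≠ 0 := inner_self_ne_zero.2 ha
  rw [surface_restrict_hyperplane ha (p := (c / inner ℝ a a) • a)
    (by rw [inner_smul_right]; field_simp)]
  infer_instance

/-- Integration along the lines in a direction transversal to a hyperplane. -/
theorem map_hyperplane_prod {d : ℕ} {a e : Euc d} (ha : a ≠ 0) (hae : inner ℝ a e = 1) (c : ℝ) :
    (((surface d).restrict (hyperplane a c)).prod (volume : Measure ℝ)).map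
      (fun z => z.1 + z.2 • e) = ‖a‖ₑ • (volume : Measure (Euc d)) := by
  have := sfinite_surface_hyperplane ha c
  have hn : (inner ℝ a a : ℝ) ≠ 0 := inner_self_ne_zero.2 ha
  set p : Euc d := c • e with hpdef
  have hp : inner ℝ a p = c := by rw [hpdef, inner_smul_right, hae, mul_one]
  -- The vector `v` is normal to the hyperplane and has the same height as `e`, namely `⟨a, v⟩ = 1`.
  -- Passing from `e` to `v` is a shear, and `‖v‖ = ‖a‖⁻¹` is the source of the factor `‖a‖`.
  set v : Euc d := (inner ℝ a a : ℝ)⁻¹ • a with hv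
  have hav : inner ℝ a v = 1 := by rw [hv, inner_smul_right, inv_mul_cancel₀ hn]
  have hv0 : v ≠ 0 := by rintro h; simp [h] at hav
  have hnorm : ‖a‖ₑ * ‖v‖ₑ = 1 := by
    rw [hv, enorm_smul, real_inner_self_eq_norm_sq, Real.enorm_eq_ofReal (by positivity),
      ← ofReal_norm, ← ENNReal.ofReal_mul (by positivity),
      ← ENNReal.ofReal_mul (by positivity)]
    have : ‖a‖ ≠ 0 := norm_ne_zero_iff.2 ha
    rw [show ‖a‖ * ((‖a‖ ^ 2)⁻¹ * ‖a‖) = 1 by field_simp, ENNReal.ofReal_one]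
  ext s hs
  have hm : Measurable (fun z : Euc d × ℝ => z.1 + z.2 • e) := by fun_prop
  rw [Measure.map_apply hm hs, Measure.prod_apply (hm hs),
    surface_restrict_hyperplane ha hp, lintegral_map (measurable_measure_prodMk_left (hm hs))
      (by fun_prop)]
  -- the left-hand side as an integral over `ℝ` of slices parallel to the hyperplane
  have hm2 : Measurable (fun z : (ℝ ∙ a)ᗮ × ℝ => (z.1 : Euc d) + p + z.2 • e) := by fun_prop
  have h1 : ∫⁻ y : (ℝ ∙ a)ᗮ, volume (Prod.mk ((y : Euc d) + p) ⁻¹'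
      ((fun z : Euc d × ℝ => z.1 + z.2 • e) ⁻¹' s)) =
      ∫⁻ t : ℝ, (volume : Measure (ℝ ∙ a)ᗮ) {y | (y : Euc d) + p + t • e ∈ s} := by
    have h2 := Measure.prod_apply (μ := (volume : Measure (ℝ ∙ a)ᗮ)) (ν := (volume : Measure ℝ))
      (hm2 hs)
    rw [Measure.prod_apply_symm (hm2 hs)] at h2
    exact h2.symm
  rw [h1]
  -- Since `e - v` is parallel to the hyperplane, replacing `e` by `v` translates each slice within
  -- itself.
  have h3 : ∀ t : ℝ, (volume : Measure (ℝ ∙ a)ᗮ) {y | (y : Euc d) + p + t • e ∈ s} =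
      (volume : Measure (ℝ ∙ a)ᗮ) {y | (y : Euc d) + t • v + p ∈ s} := by
    intro t
    have hmem : t • (e - v) ∈ (ℝ ∙ a)ᗮ := by
      rw [Submodule.mem_orthogonal_singleton_iff_inner_right, inner_smul_right, inner_sub_right,
        hae, hav]; simp
    have h4 := measure_preimage_add_right (volume : Measure (ℝ ∙ a)ᗮ) ⟨t • (e - v), hmem⟩
      {y | (y : Euc d) + t • v + p ∈ s}
    rw [← h4]
    congr 1
    ext y
    simp only [mem_ofPred_eq, mem_preimage, Submodule.coe_add]
    rw [show (y : Euc d) + t • (e - v) + t • v + p = (y : Euc d) + p + t • e by module]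
  simp_rw [h3]
  -- the volume of `s` through the orthogonal decomposition
  have h5 := ((ℝ ∙ a)ᗮ.measurePreserving_measurableEquivProd p).symm.measure_preimage_equiv s
  rw [InnerProductSpace.euclideanHausdorffMeasure_eq_volume] at h5
  have hm3 : MeasurableSet (((ℝ ∙ a)ᗮ.measurableEquivProd p).symm ⁻¹' s) :=
    ((ℝ ∙ a)ᗮ.measurableEquivProd p).symm.measurable hs
  rw [Measure.volume_eq_prod, Measure.prod_apply_symm hm3] at h5
  have hrank : finrank ℝ ((ℝ ∙ a)ᗮ)ᗮ = 1 := by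
    rw [Submodule.orthogonal_orthogonal, finrank_span_singleton ha]
  have hvmem : v ∈ ((ℝ ∙ a)ᗮ)ᗮ := by
    rw [Submodule.orthogonal_orthogonal]
    exact Submodule.smul_mem _ _ (Submodule.mem_span_singleton_self a)
  -- On the normal line, length is `‖v‖` times the Lebesgue measure of the parameter `t`; `hnorm`
  -- cancels this factor against `‖a‖`.
  have hvol := volume_eq_of_finrank_eq_one hrank (v := (⟨v, hvmem⟩ : ((ℝ ∙ a)ᗮ)ᗮ))
    (by simpa using hv0)
  rw [hvol, lintegral_smul_measure, lintegral_map (measurable_measure_prodMk_right hm3)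
    (by fun_prop)] at h5
  rw [Measure.smul_apply, ← h5, smul_eq_mul, smul_eq_mul, ← mul_assoc]
  simp only [Submodule.coe_norm, enorm, nnnorm] at hnorm ⊢
  erw [hnorm]
  rw [one_mul]
  simp
  rfl

end HDG

namespace HDG

open Module
open scoped ENNReal

/-! ### Projections between hyperplanes -/

/-- Projecting a hyperplane onto another one along a common transversal direction rescales the
surface measure by the ratio of the lengths of the normalized normals. -/
theorem map_hyperplane_projection {d : ℕ} {a a' e : Euc d} (ha : inner ℝ a e = 1)
    (ha' : inner ℝ a' e = -1) (c c' : ℝ) :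
    ‖a'‖ₑ • ((surface d).restrict (hyperplane a c)).map (fun x => x + (inner ℝ a' x - c') • e) =
      ‖a‖ₑ • (surface d).restrict (hyperplane a' c') := by
  have hane : a ≠ 0 := by rintro rfl; simp at ha
  have hane' : a' ≠ 0 := by rintro rfl; simp at ha'
  have hsf := sfinite_surface_hyperplane hane c
  have hsf' := sfinite_surface_hyperplane hane' c'
  have hρ : Measurable (fun x : Euc d => x + (inner ℝ a' x - c') • e) := by fun_prop
  ext A hA
  -- The volume of this piece of a slab is computed twice, with fibres along `e` over the first
  -- hyperplane and along `-e` over the second. All nonempty fibres are intervals of length one, so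
  -- both computations return a surface measure, up to the norm of the respective normal.
  set S : Set (Euc d) := (fun x : Euc d => x + (inner ℝ a' x - c') • e) ⁻¹' A ∩
    {x | inner ℝ a x - c ∈ Icc (0 : ℝ) 1} with hSdef
  have hS : MeasurableSet S := by
    refine (hρ hA).inter ?_
    exact measurableSet_Icc.preimage (by fun_prop : Measurable fun x : Euc d => inner ℝ a x - c)
  have h1 : ‖a‖ₑ * volume S = (surface d).restrict (hyperplane a c)
      ((fun x : Euc d => x + (inner ℝ a' x - c') • e) ⁻¹' A) := by
    have h := congrArg (fun m : Measure (Euc d) => m S) (map_hyperplane_prod hane ha c)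
    have hm : Measurable (fun z : Euc d × ℝ => z.1 + z.2 • e) := by fun_prop
    simp only [Measure.smul_apply, smul_eq_mul] at h
    rw [← h, Measure.map_apply hm hS, Measure.prod_apply (hm hS),
      ← lintegral_indicator_one (hρ hA)]
    refine setLIntegral_congr_fun (isClosed_hyperplane a c).measurableSet fun z hz => ?_
    have hz : inner ℝ a z = c := hz
    have key : Prod.mk z ⁻¹' ((fun z : Euc d × ℝ => z.1 + z.2 • e) ⁻¹' S) =
        {t | z ∈ (fun x : Euc d => x + (inner ℝ a' x - c') • e) ⁻¹' A ∧ t ∈ Icc (0 : ℝ) 1} := by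
      ext t
      simp only [hSdef, mem_preimage, mem_inter_iff, mem_ofPred_eq, inner_add_right,
        inner_smul_right, ha, ha', hz]
      rw [show z + t • e + (inner ℝ a' z + t * -1 - c') • e = z + (inner ℝ a' z - c') • e by module]
      simp
    simp only [key]
    by_cases hzA : z ∈ (fun x : Euc d => x + (inner ℝ a' x - c') • e) ⁻¹' A
    · rw [indicator_of_mem hzA]
      simp only [hzA, true_and]
      rw [show {t : ℝ | t ∈ Icc (0 : ℝ) 1} = Icc 0 1 from rfl]
      simp
    · rw [indicator_of_notMem hzA]
      simp [hzA]
  have h2 : ‖a'‖ₑ * volume S = (surface d).restrict (hyperplane a' c') A := by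
    have h := congrArg (fun m : Measure (Euc d) => m S)
      (map_hyperplane_prod hane' (e := -e) (by simp [ha']) c')
    have hm : Measurable (fun z : Euc d × ℝ => z.1 + z.2 • (-e)) := by fun_prop
    simp only [Measure.smul_apply, smul_eq_mul] at h
    rw [← h, Measure.map_apply hm hS, Measure.prod_apply (hm hS),
      ← lintegral_indicator_one hA]
    refine setLIntegral_congr_fun (isClosed_hyperplane a' c').measurableSet fun z hz => ?_
    have hz : inner ℝ a' z = c' := hz
    have key : Prod.mk z ⁻¹' ((fun z : Euc d × ℝ => z.1 + z.2 • (-e)) ⁻¹' S) =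
        {t | z ∈ A ∧ t ∈ Icc (inner ℝ a z - c - 1) (inner ℝ a z - c)} := by
      ext t
      simp only [hSdef, mem_preimage, mem_inter_iff, mem_ofPred_eq, inner_add_right,
        inner_smul_right, inner_neg_right, ha, ha', hz]
      rw [show z + t • -e + (c' + t * - -1 - c') • e = z by module]
      simp only [mem_Icc]
      refine and_congr_right fun _ => ⟨fun h => ⟨by linarith [h.2], by linarith [h.1]⟩,
        fun h => ⟨by linarith [h.2], by linarith [h.1]⟩⟩
    simp only [key]
    by_cases hzA : z ∈ A
    · rw [indicator_of_mem hzA]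
      simp only [hzA, true_and]
      rw [show {t : ℝ | t ∈ Icc (inner ℝ a z - c - 1) (inner ℝ a z - c)} = Icc _ _ from rfl]
      simp
    · rw [indicator_of_notMem hzA]
      simp [hzA]
  rw [Measure.smul_apply, Measure.smul_apply, Measure.map_apply hρ hA, smul_eq_mul, smul_eq_mul,
    ← h1, ← h2, mul_left_comm]

/-- The fundamental theorem of calculus along a segment. -/
lemma integral_fderiv_segment {d : ℕ} {S : Set (Euc d)} {φ : Euc d → ℝ} {C : ℝ≥0}
    (hφ : LipschitzOnWith C φ S) {z e : Euc d} {l : ℝ} (hl : 0 ≤ l)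
    (hS : ∀ t ∈ Icc 0 l, z + t • e ∈ S)
    (hdiff : ∀ᵐ t : ℝ, z + t • e ∈ S → DifferentiableAt ℝ φ (z + t • e)) :
    ∫ t in Icc 0 l, fderiv ℝ φ (z + t • e) e = φ (z + l • e) - φ z := by
  have hline : LipschitzWith ‖e‖₊ (fun t : ℝ => z + t • e) := by
    refine LipschitzWith.of_dist_le_mul fun s t => ?_
    rw [dist_add_left, dist_eq_norm, ← sub_smul, norm_smul, dist_eq_norm, mul_comm]
    rfl
  have hlip : LipschitzOnWith (C * ‖e‖₊) (fun t : ℝ => φ (z + t • e)) (uIcc 0 l) := by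
    rw [uIcc_of_le hl]
    exact hφ.comp hline.lipschitzOnWith hS
  -- Lipschitz functions of one variable are absolutely continuous, so a derivative known almost
  -- everywhere on the segment is enough.
  have hac := hlip.absolutelyContinuousOnInterval.integral_deriv_eq_sub
  simp only [zero_smul, add_zero] at hac
  rw [← hac, intervalIntegral.integral_of_le hl, ← integral_Icc_eq_integral_Ioc]
  refine setIntegral_congr_ae measurableSet_Icc ?_
  filter_upwards [hdiff] with t ht htl
  have h1 := (ht (hS t htl)).hasFDerivAt
  have h2 : HasDerivAt (fun t : ℝ => z + t • e) e t := by
    simpa using ((hasDerivAt_id t).smul_const e).const_add z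
  exact (h1.comp_hasDerivAt t h2).deriv.symm

end HDG

namespace HDG

open Module
open scoped ENNReal

/-! ### Barycentric coordinates and simplices -/

section barycentric

variable {d : ℕ} {ι : Type*} (b : AffineBasis ι ℝ (Euc d))

/-- The gradient of a barycentric coordinate. -/
def baryGrad (i : ι) : Euc d :=
  (InnerProductSpace.toDual ℝ (Euc d)).symm (LinearMap.toContinuousLinearMap (b.coord i).linear)

lemma inner_baryGrad (i : ι) (x : Euc d) : inner ℝ (baryGrad b i) x = (b.coord i).linear x := by
  simp [baryGrad]

lemma inner_baryGrad_sub (i : ι) (x y : Euc d) :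
    inner ℝ (baryGrad b i) (x - y) = b.coord i x - b.coord i y := by
  rw [inner_baryGrad, ← vsub_eq_sub, AffineMap.linearMap_vsub, vsub_eq_sub]

lemma coord_eq_inner (i : ι) (x : Euc d) :
    b.coord i x = inner ℝ (baryGrad b i) x + b.coord i 0 := by
  have := inner_baryGrad_sub b i x 0
  rw [sub_zero] at this
  linarith

lemma coord_add_smul (i : ι) (x e : Euc d) (t : ℝ) :
    b.coord i (x + t • e) = b.coord i x + t * inner ℝ (baryGrad b i) e := by
  rw [coord_eq_inner, coord_eq_inner b i x, inner_add_right, inner_smul_right]; ring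

lemma inner_baryGrad_edge_left {i j : ι} (h : i ≠ j) :
    inner ℝ (baryGrad b i) (b i - b j) = 1 := by
  rw [inner_baryGrad_sub, b.coord_apply_eq, b.coord_apply_ne h, sub_zero]

lemma inner_baryGrad_edge_right {i j : ι} (h : i ≠ j) :
    inner ℝ (baryGrad b j) (b i - b j) = -1 := by
  rw [inner_baryGrad_sub, b.coord_apply_eq, b.coord_apply_ne h.symm, zero_sub]

lemma inner_baryGrad_edge_of_ne {i j k : ι} (hi : k ≠ i) (hj : k ≠ j) :
    inner ℝ (baryGrad b k) (b i - b j) = 0 := by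
  rw [inner_baryGrad_sub, b.coord_apply_ne hi, b.coord_apply_ne hj, sub_zero]

lemma baryGrad_ne_zero [Nontrivial ι] (i : ι) : baryGrad b i ≠ 0 := by
  obtain ⟨j, hj⟩ := exists_ne i
  intro h
  have := inner_baryGrad_edge_left b hj.symm
  simp [h] at this

lemma sum_baryGrad [Fintype ι] : ∑ i, baryGrad b i = 0 := by
  refine ext_inner_right ℝ fun x => ?_
  have h : ∀ i, inner ℝ (baryGrad b i) x = b.coord i x - b.coord i 0 := fun i => by
    rw [← inner_baryGrad_sub, sub_zero]
  rw [sum_inner, Finset.sum_congr rfl fun i _ => h i, Finset.sum_sub_distrib,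
    b.sum_coord_apply_eq_one, b.sum_coord_apply_eq_one]
  simp

/-- The difference of the barycentric expansions of `x` and of `0`. The vertices and the gradients
thus play the role of a pair of dual bases, so that linear maps can be handled through edges instead
of coordinate vectors. -/
lemma sum_inner_baryGrad_smul [Fintype ι] (x : Euc d) :
    ∑ i, (inner ℝ (baryGrad b i) x : ℝ) • b i = x := by
  have h : ∀ i, inner ℝ (baryGrad b i) x = b.coord i x - b.coord i 0 := fun i => by
    rw [← inner_baryGrad_sub, sub_zero]
  simp only [h, sub_smul, Finset.sum_sub_distrib, b.linear_combination_coord_eq_self, sub_zero]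

/-- The trace of a linear map in terms of the vertices and the barycentric gradients. -/
lemma trace_eq_sum_inner_baryGrad [Fintype ι] (L : Euc d →L[ℝ] Euc d) (p : Euc d) :
    ∑ k : Fin d, (L (EuclideanSpace.single k 1)) k = ∑ i, inner ℝ (baryGrad b i) (L (b i - p)) := by
  -- The gradients sum to zero, so the base point `p` is free. It will be taken to be a vertex,
  -- which makes every argument of `L` an edge.
  have h1 : ∑ i, inner ℝ (baryGrad b i) (L (b i - p)) = ∑ i, inner ℝ (baryGrad b i) (L (b i)) := by
    simp only [map_sub, inner_sub_right, Finset.sum_sub_distrib]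
    rw [← sum_inner, sum_baryGrad, inner_zero_left, sub_zero]
  rw [h1]
  have h2 : ∀ k : Fin d, (L (EuclideanSpace.single k 1)) k =
      ∑ i, (baryGrad b i) k * (L (b i)) k := by
    intro k
    conv_lhs => rw [← sum_inner_baryGrad_smul b (EuclideanSpace.single k (1 : ℝ))]
    simp only [map_sum, map_smul, WithLp.ofLp_sum, WithLp.ofLp_smul, Finset.sum_apply,
      Pi.smul_apply, smul_eq_mul]
    refine Finset.sum_congr rfl fun i _ => ?_
    rw [EuclideanSpace.inner_single_right]
    simp
  simp only [h2]
  rw [Finset.sum_comm]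
  refine Finset.sum_congr rfl fun i _ => ?_
  simp [PiLp.inner_apply, mul_comm]

/-- The closed simplex spanned by an affine basis. -/
def simplexSet : Set (Euc d) := {x | ∀ i, 0 ≤ b.coord i x}

/-- The facet of that simplex opposite to a vertex. -/
def simplexFacet (i : ι) : Set (Euc d) := {x | (∀ j, 0 ≤ b.coord j x) ∧ b.coord i x = 0}

lemma simplexFacet_eq (i : ι) : simplexFacet b i =
    simplexSet b ∩ hyperplane (baryGrad b i) (-b.coord i 0) := by
  ext x
  simp only [simplexFacet, simplexSet, hyperplane, mem_inter_iff, mem_ofPred_eq]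
  rw [coord_eq_inner b i x]
  exact and_congr_right fun _ => ⟨fun h => by linarith, fun h => by linarith⟩

variable [Fintype ι]

omit [Fintype ι] in
lemma convexHull_eq_simplexSet : convexHull ℝ (range b) = simplexSet b :=
  b.convexHull_eq_nonneg_coord

omit [Fintype ι] in
lemma isClosed_simplexSet : IsClosed (simplexSet b) := by
  simp only [simplexSet, ofPred_forall]
  exact isClosed_iInter fun i => isClosed_le continuous_const (continuous_barycentric_coord b i)

omit [Fintype ι] in
lemma convex_simplexSet : Convex ℝ (simplexSet b) := by
  rw [← convexHull_eq_simplexSet]; exact convex_convexHull ℝ _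

lemma isCompact_simplexSet : IsCompact (simplexSet b) := by
  rw [← convexHull_eq_simplexSet]; exact (finite_range b).isCompact_convexHull ℝ

lemma isCompact_simplexFacet (i : ι) : IsCompact (simplexFacet b i) := by
  rw [simplexFacet_eq]
  exact (isCompact_simplexSet b).inter_right (isClosed_hyperplane _ _)

lemma interior_simplexSet : interior (simplexSet b) = {x | ∀ i, 0 < b.coord i x} := by
  rw [← convexHull_eq_simplexSet, b.interior_convexHull]

/-- This links the two descriptions of a facet: by its vertices, as in a simplicial complex, and by
the vanishing of one barycentric coordinate, as needed for integration. -/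
lemma convexHull_image_compl (i : ι) : convexHull ℝ (b '' {i}ᶜ) = simplexFacet b i := by
  classical
  apply Subset.antisymm
  · refine convexHull_min ?_ ?_
    · rintro _ ⟨j, hj, rfl⟩
      refine ⟨fun k => ?_, b.coord_apply_ne (Ne.symm hj)⟩
      rw [b.coord_apply]; split_ifs <;> norm_num
    · rw [simplexFacet_eq]
      refine (convex_simplexSet b).inter ?_
      exact convex_hyperplane (f := fun x => inner ℝ (baryGrad b i) x)
        ⟨fun x y => inner_add_right _ _ _, fun c x => inner_smul_right _ _ _⟩ _
  · rintro x ⟨hx, hi⟩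
    have hsum := b.sum_coord_apply_eq_one x
    rw [← Finset.sum_erase Finset.univ (f := fun j => b.coord j x) hi] at hsum
    have hlin := b.linear_combination_coord_eq_self x
    rw [← Finset.sum_erase Finset.univ (a := i) (by rw [hi, zero_smul])] at hlin
    rw [← hlin]
    refine (convex_convexHull ℝ (b '' {i}ᶜ)).sum_mem (fun j _ => hx j) hsum fun j hj => ?_
    exact subset_convexHull ℝ _ ⟨j, Finset.ne_of_mem_erase hj, rfl⟩

end barycentric

end HDG

namespace HDG

open Module
open scoped ENNReal

/-! ### Integration along the edges of a simplex -/

section divergenceTheorem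

variable {d : ℕ} {ι : Type*} (b : AffineBasis ι ℝ (Euc d)) [Fintype ι]

-- The frontier of a convex set is Lebesgue null. Differentiability is available in the open
-- simplex, Lipschitz bounds and compactness on the closed one.
omit [Fintype ι] in
lemma restrict_interior_simplexSet :
    (volume : Measure (Euc d)).restrict (interior (simplexSet b)) =
      volume.restrict (simplexSet b) := by
  refine Measure.restrict_congr_set ?_
  refine (LE.le.eventuallyLE interior_subset).antisymm ?_
  have h := (convex_simplexSet b).addHaar_frontier volume
  rw [(isClosed_simplexSet b).frontier_eq] at h
  rw [ae_le_set]
  exact h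

-- Rademacher's theorem, applied in the interior, where differentiability within the set is
-- differentiability.
omit [Fintype ι] in
lemma ae_differentiableAt_of_lipschitzOnWith_simplexSet {F : Type*} [NormedAddCommGroup F]
    [NormedSpace ℝ F] [FiniteDimensional ℝ F] {φ : Euc d → F} {C : ℝ≥0}
    (hφ : LipschitzOnWith C φ (simplexSet b)) :
    ∀ᵐ x : Euc d, x ∈ simplexSet b → DifferentiableAt ℝ φ x := by
  rw [← ae_restrict_iff' (isClosed_simplexSet b).measurableSet, ← restrict_interior_simplexSet,
    ae_restrict_iff' isOpen_interior.measurableSet]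
  filter_upwards [(hφ.mono interior_subset).ae_differentiableWithinAt_of_mem (μ := volume)]
    with x hx hxi
  exact (hx hxi).differentiableAt (isOpen_interior.mem_nhds hxi)

omit [Fintype ι] in
lemma ae_norm_fderiv_le_of_lipschitzOnWith_simplexSet {F : Type*} [NormedAddCommGroup F]
    [NormedSpace ℝ F] {φ : Euc d → F} {C : ℝ≥0} (hφ : LipschitzOnWith C φ (simplexSet b)) :
    ∀ᵐ x ∂(volume.restrict (simplexSet b)), ‖fderiv ℝ φ x‖ ≤ C := by
  rw [← restrict_interior_simplexSet, ae_restrict_iff' isOpen_interior.measurableSet]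
  refine Filter.Eventually.of_forall fun x hx => ?_
  exact norm_fderiv_le_of_lipschitzOn ℝ (mem_interior_iff_mem_nhds.1 hx) hφ

lemma isFiniteMeasure_restrict_simplexSet :
    IsFiniteMeasure ((volume : Measure (Euc d)).restrict (simplexSet b)) :=
  ⟨by simpa using (isCompact_simplexSet b).measure_lt_top⟩

lemma integrableOn_fderiv_simplexSet {φ : Euc d → ℝ} {C : ℝ≥0}
    (hφ : LipschitzOnWith C φ (simplexSet b)) (e : Euc d) :
    IntegrableOn (fun x => fderiv ℝ φ x e) (simplexSet b) := by
  have := isFiniteMeasure_restrict_simplexSet b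
  refine Integrable.of_bound (C := C * ‖e‖)
    (measurable_fderiv_apply_const ℝ φ e).aestronglyMeasurable ?_
  filter_upwards [ae_norm_fderiv_le_of_lipschitzOnWith_simplexSet b hφ] with x hx
  exact (ContinuousLinearMap.le_opNorm _ _).trans (by gcongr)

/-- Sweeping the facet along an edge transversal to it produces a compact set, whose finite volume
dominates the area of the facet by `map_hyperplane_prod`. -/
lemma surface_simplexFacet_lt_top [Nontrivial ι] (i : ι) :
    surface d (simplexFacet b i) < ∞ := by
  obtain ⟨j, hj⟩ := exists_ne i
  set e := b i - b j with he
  set a := baryGrad b i with ha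
  have hae : inner ℝ a e = 1 := inner_baryGrad_edge_left b hj.symm
  have hane := baryGrad_ne_zero b i
  set c := -b.coord i 0
  have := sfinite_surface_hyperplane hane c
  have h := map_hyperplane_prod hane hae c
  have hm : Measurable (fun z : Euc d × ℝ => z.1 + z.2 • e) := by fun_prop
  set B : Set (Euc d) := (fun z : Euc d × ℝ => z.1 + z.2 • e) '' (simplexFacet b i ×ˢ Icc 0 1)
  have hB : IsCompact B :=
    ((isCompact_simplexFacet b i).prod isCompact_Icc).image (by fun_prop)
  have h1 := congrArg (fun m : Measure (Euc d) => m B) h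
  simp only [Measure.smul_apply, smul_eq_mul] at h1
  rw [Measure.map_apply hm hB.measurableSet] at h1
  have h2 : (surface d).restrict (hyperplane a c) (simplexFacet b i) * 1 ≤ ‖a‖ₑ * volume B := by
    rw [← h1, ← (by simp : volume (Icc (0 : ℝ) 1) = 1), ← Measure.prod_prod]
    exact measure_mono fun z hz => mem_image_of_mem _ hz
  rw [mul_one, Measure.restrict_apply (isCompact_simplexFacet b i).measurableSet,
    inter_eq_left.2 ((simplexFacet_eq b i).trans_subset inter_subset_right)] at h2
  exact h2.trans_lt (ENNReal.mul_lt_top enorm_lt_top hB.measure_lt_top)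

lemma surface_restrict_simplexFacet (i : ι) : (surface d).restrict (simplexFacet b i) =
    ((surface d).restrict (hyperplane (baryGrad b i) (-b.coord i 0))).restrict
      (simplexFacet b i) := by
  rw [Measure.restrict_restrict (isCompact_simplexFacet b i).measurableSet,
    inter_eq_left.2 ((simplexFacet_eq b i).trans_subset inter_subset_right)]

/-- Integration of the derivative along an edge `b i - b j` over the simplex. -/
theorem setIntegral_fderiv_edge {φ : Euc d → ℝ} {C : ℝ≥0}
    (hφ : LipschitzOnWith C φ (simplexSet b)) {i j : ι} (hij : i ≠ j) :
    ∫ x in simplexSet b, fderiv ℝ φ x (b i - b j) =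
      ‖baryGrad b j‖⁻¹ * (∫ x in simplexFacet b j, φ x ∂(surface d)) -
        ‖baryGrad b i‖⁻¹ * ∫ x in simplexFacet b i, φ x ∂(surface d) := by
  have : Nontrivial ι := ⟨i, j, hij⟩
  set e := b i - b j with he
  set a := baryGrad b i with ha
  set a' := baryGrad b j with ha'
  have hae : inner ℝ a e = 1 := inner_baryGrad_edge_left b hij
  have hae' : inner ℝ a' e = -1 := inner_baryGrad_edge_right b hij
  have hane : a ≠ 0 := baryGrad_ne_zero b i
  have hane' : a' ≠ 0 := baryGrad_ne_zero b j
  set c := -b.coord i 0 with hc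
  set c' := -b.coord j 0 with hc'
  have := sfinite_surface_hyperplane hane c
  have hvol := map_hyperplane_prod hane hae c
  have hm : Measurable (fun z : Euc d × ℝ => z.1 + z.2 • e) := by fun_prop
  set G : Euc d → ℝ := (simplexSet b).indicator fun x => fderiv ℝ φ x e with hG
  have hGint : Integrable G := (integrable_indicator_iff
    (isClosed_simplexSet b).measurableSet).2 (integrableOn_fderiv_simplexSet b hφ e)
  have hGint' : Integrable G
      ((((surface d).restrict (hyperplane a c)).prod (volume : Measure ℝ)).map
        (fun z => z.1 + z.2 • e)) := by
    rw [hvol]; exact hGint.smul_measure enorm_ne_top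
  have hnorm : (‖a‖ₑ).toReal = ‖a‖ := by simp
  have hna : ‖a‖ ≠ 0 := norm_ne_zero_iff.2 hane
  have hna' : ‖a'‖ ≠ 0 := norm_ne_zero_iff.2 hane'
  -- Fubini
  have hfub : ∫ x, G x = ‖a‖⁻¹ * ∫ z in hyperplane a c, (∫ t : ℝ, G (z + t • e)) ∂(surface d) := by
    have h1 : ∫ x, G x ∂((((surface d).restrict (hyperplane a c)).prod (volume : Measure ℝ)).map
        (fun z => z.1 + z.2 • e)) = ‖a‖ * ∫ x, G x := by
      rw [hvol, integral_smul_measure, hnorm, smul_eq_mul]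
    rw [integral_map hm.aemeasurable hGint'.aestronglyMeasurable,
      integral_prod (fun z : Euc d × ℝ => G (z.1 + z.2 • e)) ((integrable_map_measure hGint'.aestronglyMeasurable hm.aemeasurable).1
        hGint')] at h1
    rw [h1]; field_simp
  have hdiff : ∀ᵐ z ∂((surface d).restrict (hyperplane a c)), ∀ᵐ t : ℝ,
      z + t • e ∈ simplexSet b → DifferentiableAt ℝ φ (z + t • e) := by
    refine Measure.ae_ae_of_ae_prod (p := fun z : Euc d × ℝ => z.1 + z.2 • e ∈ simplexSet b →
      DifferentiableAt ℝ φ (z.1 + z.2 • e)) ?_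
    refine ae_of_ae_map hm.aemeasurable (p := fun x => x ∈ simplexSet b →
      DifferentiableAt ℝ φ x) ?_
    rw [hvol]
    exact Measure.ae_smul_measure (ae_differentiableAt_of_lipschitzOnWith_simplexSet b hφ) _
  -- Along `e = b i - b j` the coordinate `i` grows at unit rate, the coordinate `j` decreases at
  -- unit rate and the others stay fixed. Hence `ρ` slides a point of the hyperplane of facet `i`
  -- for the time `b.coord j`, until it reaches the hyperplane of facet `j`.
  set ρ : Euc d → Euc d := fun x => x + (inner ℝ a' x - c') • e with hρ
  have hρm : Measurable ρ := by fun_prop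
  have hcoordj : ∀ z, inner ℝ a' z - c' = b.coord j z := fun z => by
    rw [coord_eq_inner b j z, hc']; ring
  have hcoord : ∀ k z, k ≠ i → k ≠ j → ∀ t : ℝ, b.coord k (z + t • e) = b.coord k z :=
    fun k z hi hj t => by
      rw [coord_add_smul, inner_baryGrad_edge_of_ne b hi hj, mul_zero, add_zero]
  have hci : ∀ z (t : ℝ), b.coord i (z + t • e) = b.coord i z + t := fun z t => by
    rw [coord_add_smul, hae, mul_one]
  have hcj : ∀ z (t : ℝ), b.coord j (z + t • e) = b.coord j z - t := fun z t => by
    rw [coord_add_smul, hae']; ring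
  -- The line through `z` in direction `e` meets the simplex exactly in the segment from `z` to `ρ
  -- z` if `z` lies on the facet, and misses it otherwise.
  have hinner : ∀ᵐ z ∂((surface d).restrict (hyperplane a c)), ∫ t : ℝ, G (z + t • e) =
      (simplexFacet b i).indicator (fun z => φ (ρ z) - φ z) z := by
    filter_upwards [hdiff, ae_restrict_mem (isClosed_hyperplane a c).measurableSet] with z hz hzc
    have hzi : b.coord i z = 0 := by
      rw [coord_eq_inner, show inner ℝ (baryGrad b i) z = c from hzc, hc]; ring
    by_cases hzF : z ∈ simplexFacet b i
    · have hset : ∀ t : ℝ, z + t • e ∈ simplexSet b ↔ t ∈ Icc 0 (b.coord j z) := by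
        intro t
        constructor
        · intro h
          have h1 := h i; have h2 := h j
          rw [hci, hzi] at h1; rw [hcj] at h2
          exact ⟨by linarith, by linarith⟩
        · rintro ⟨h1, h2⟩ k
          by_cases hki : k = i
          · rw [hki, hci, hzi]; linarith
          · by_cases hkj : k = j
            · rw [hkj, hcj]; linarith
            · rw [hcoord k z hki hkj]; exact hzF.1 k
      have hGz : (fun t : ℝ => G (z + t • e)) =
          (Icc 0 (b.coord j z)).indicator fun t => fderiv ℝ φ (z + t • e) e := by
        ext t
        by_cases ht : t ∈ Icc 0 (b.coord j z)
        · rw [indicator_of_mem ht, hG, indicator_of_mem ((hset t).2 ht)]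
        · rw [indicator_of_notMem ht, hG, indicator_of_notMem (fun h => ht ((hset t).1 h))]
      rw [hGz, integral_indicator measurableSet_Icc, indicator_of_mem hzF,
        integral_fderiv_segment hφ (hzF.1 j) (fun t ht => (hset t).2 ht) hz]
      simp only [hρ, hcoordj]
    · rw [indicator_of_notMem hzF]
      have hset : ∀ t : ℝ, z + t • e ∉ simplexSet b := by
        intro t h
        refine hzF ⟨fun k => ?_, hzi⟩
        by_cases hki : k = i
        · rw [hki, hzi]
        · by_cases hkj : k = j
          · have h1 := h i; have h2 := h j
            rw [hci, hzi] at h1; rw [hcj] at h2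
            rw [hkj]; linarith
          · have := h k
            rwa [hcoord k z hki hkj] at this
      simp [hG, indicator_of_notMem (hset _)]
  -- the projection maps the facet opposite to `b i` to the one opposite to `b j`
  have hρF : ∀ z ∈ hyperplane a c, ρ z ∈ simplexFacet b j ↔ z ∈ simplexFacet b i := by
    intro z hzc
    have hzi : b.coord i z = 0 := by
      rw [coord_eq_inner, show inner ℝ (baryGrad b i) z = c from hzc, hc]; ring
    simp only [hρ, hcoordj]
    constructor
    · rintro ⟨h1, -⟩
      refine ⟨fun k => ?_, hzi⟩
      by_cases hki : k = i
      · rw [hki, hzi]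
      · by_cases hkj : k = j
        · have := h1 i
          rw [hci, hzi] at this
          rw [hkj]; linarith
        · have := h1 k
          rwa [hcoord k z hki hkj] at this
    · rintro ⟨h1, -⟩
      refine ⟨fun k => ?_, by rw [hcj]; ring⟩
      by_cases hki : k = i
      · rw [hki, hci, hzi]; linarith [h1 j]
      · by_cases hkj : k = j
        · rw [hkj, hcj]; linarith
        · rw [hcoord k z hki hkj]; exact h1 k
  have hFi := (isCompact_simplexFacet b i).measurableSet
  have hFj := (isCompact_simplexFacet b j).measurableSet
  have hcont : ∀ k, ContinuousOn φ (simplexFacet b k) := fun k =>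
    hφ.continuousOn.mono fun x hx => hx.1
  have hintk : ∀ k, IntegrableOn φ (simplexFacet b k) (surface d) := fun k =>
    (hcont k).integrableOn_of_subset_isCompact (isCompact_simplexFacet b k)
      (isCompact_simplexFacet b k).measurableSet Subset.rfl (surface_simplexFacet_lt_top b k).ne
  have hmap := map_hyperplane_projection hae hae' c c'
  set ψ := (simplexFacet b j).indicator φ with hψ
  have hψint : Integrable ψ ((surface d).restrict (hyperplane a' c')) := by
    rw [hψ, integrable_indicator_iff hFj, IntegrableOn, ← surface_restrict_simplexFacet]
    exact hintk j
  have hψint' : Integrable ψ (((surface d).restrict (hyperplane a c)).map ρ) := by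
    have h1 : Integrable ψ (‖a'‖ₑ • ((surface d).restrict (hyperplane a c)).map ρ) := by
      rw [hmap]; exact hψint.smul_measure enorm_ne_top
    exact (integrable_smul_measure (by simpa using hane') enorm_ne_top).1 h1
  have hind : (fun z => ψ (ρ z)) =ᵐ[(surface d).restrict (hyperplane a c)]
      (simplexFacet b i).indicator fun z => φ (ρ z) := by
    filter_upwards [ae_restrict_mem (isClosed_hyperplane a c).measurableSet] with z hz
    by_cases h : z ∈ simplexFacet b i
    · rw [indicator_of_mem h, hψ, indicator_of_mem ((hρF z hz).2 h)]
    · rw [indicator_of_notMem h, hψ, indicator_of_notMem fun h' => h ((hρF z hz).1 h')]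
  have hψρ : Integrable (fun z => ψ (ρ z)) ((surface d).restrict (hyperplane a c)) :=
    (integrable_map_measure hψint'.aestronglyMeasurable hρm.aemeasurable).1 hψint'
  -- The Jacobian of the slide is the ratio of the norms of the two gradients; it converts the
  -- weight `‖a‖⁻¹` produced by Fubini into the weight `‖a'‖⁻¹` belonging to facet `j`.
  have hproj : ‖a'‖ * ∫ z in hyperplane a c, ψ (ρ z) ∂(surface d) =
      ‖a‖ * ∫ x in simplexFacet b j, φ x ∂(surface d) := by
    rw [← integral_map hρm.aemeasurable hψint'.aestronglyMeasurable]
    have h1 := congrArg (fun m : Measure (Euc d) => ∫ x, ψ x ∂m) hmap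
    simp only [integral_smul_measure, toReal_enorm, smul_eq_mul] at h1
    rw [h1, hψ, integral_indicator hFj, ← surface_restrict_simplexFacet]
  have hφi : Integrable ((simplexFacet b i).indicator φ)
      ((surface d).restrict (hyperplane a c)) := by
    rw [integrable_indicator_iff hFi, IntegrableOn, ← surface_restrict_simplexFacet]
    exact hintk i
  rw [← integral_indicator (isClosed_simplexSet b).measurableSet, hfub, integral_congr_ae hinner]
  have hsplit : (simplexFacet b i).indicator (fun z => φ (ρ z) - φ z)
      =ᵐ[(surface d).restrict (hyperplane a c)]
        fun z => ψ (ρ z) - (simplexFacet b i).indicator φ z := by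
    filter_upwards [hind] with z hz
    rw [hz]
    by_cases h : z ∈ simplexFacet b i <;> simp [h]
  rw [integral_congr_ae hsplit, integral_sub hψρ hφi, integral_indicator hFi,
    ← surface_restrict_simplexFacet]
  have : ∫ z in hyperplane a c, ψ (ρ z) ∂(surface d) =
      ‖a'‖⁻¹ * (‖a‖ * ∫ x in simplexFacet b j, φ x ∂(surface d)) := by
    rw [← hproj]; field_simp
  rw [this]
  field_simp

end divergenceTheorem

end HDG

namespace HDG

open Module
open scoped ENNReal

/-! ### The divergence theorem on a simplex -/

section divergenceTheorem

variable {d : ℕ} {ι : Type*} (b : AffineBasis ι ℝ (Euc d)) [Fintype ι]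

lemma LipschitzOnWith.inner_left {S : Set (Euc d)} {v : Euc d → Euc d} {C : ℝ≥0}
    (hv : LipschitzOnWith C v S) (a : Euc d) :
    LipschitzOnWith (‖a‖₊ * C) (fun x => inner ℝ a (v x)) S := by
  have h := (innerSL ℝ a).lipschitz.comp_lipschitzOnWith hv
  rw [show ‖innerSL ℝ a‖₊ = ‖a‖₊ from NNReal.eq (innerSL_apply_norm ℝ a)] at h
  exact h

/-- The divergence theorem on a simplex for a Lipschitz vector field. -/
theorem setIntegral_divergence_simplexSet [Nontrivial ι] {v : Euc d → Euc d} {C : ℝ≥0}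
    (hv : LipschitzOnWith C v (simplexSet b)) :
    ∫ x in simplexSet b, divergence v x =
      ∑ i, ∫ x in simplexFacet b i, inner ℝ (v x) (-‖baryGrad b i‖⁻¹ • baryGrad b i)
        ∂(surface d) := by
  classical
  obtain ⟨i₀, -⟩ := exists_pair_ne ι
  have hlip := fun i => LipschitzOnWith.inner_left hv (baryGrad b i)
  -- With the vertex `b i₀` as base point, the trace formula writes the divergence as a sum of
  -- derivatives along edges, each of which is integrated by `setIntegral_fderiv_edge`.
  have hdiv : ∀ᵐ x ∂(volume.restrict (simplexSet b)), divergence v x =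
      ∑ i, fderiv ℝ (fun x => inner ℝ (baryGrad b i) (v x)) x (b i - b i₀) := by
    rw [ae_restrict_iff' (isClosed_simplexSet b).measurableSet]
    filter_upwards [ae_differentiableAt_of_lipschitzOnWith_simplexSet b hv] with x hx hxS
    rw [divergence, trace_eq_sum_inner_baryGrad b (fderiv ℝ v x) (b i₀)]
    refine Finset.sum_congr rfl fun i _ => ?_
    have h := ((innerSL ℝ (baryGrad b i)).hasFDerivAt.comp x (hx hxS).hasFDerivAt).fderiv
    rw [show (fun x => inner ℝ (baryGrad b i) (v x)) = innerSL ℝ (baryGrad b i) ∘ v from rfl, h]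
    rfl
  have hint : ∀ i j, IntegrableOn (fun x => inner ℝ (baryGrad b i) (v x)) (simplexFacet b j)
      (surface d) := fun i j =>
    ((hlip i).continuousOn.mono fun x hx => hx.1).integrableOn_of_subset_isCompact
      (isCompact_simplexFacet b j) (isCompact_simplexFacet b j).measurableSet Subset.rfl
      (surface_simplexFacet_lt_top b j).ne
  rw [integral_congr_ae hdiv, integral_finsetSum _
    fun i _ => integrableOn_fderiv_simplexSet b (hlip i) _]
  have hterm : ∀ i, ∫ x in simplexSet b,
      fderiv ℝ (fun x => inner ℝ (baryGrad b i) (v x)) x (b i - b i₀) =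
        ‖baryGrad b i₀‖⁻¹ * (∫ x in simplexFacet b i₀, inner ℝ (baryGrad b i) (v x) ∂(surface d)) -
        ‖baryGrad b i‖⁻¹ * ∫ x in simplexFacet b i, inner ℝ (baryGrad b i) (v x) ∂(surface d) := by
    intro i
    by_cases h : i = i₀
    · subst h; simp
    · exact setIntegral_fderiv_edge b (hlip i) h
  -- The index `i₀` contributes two equal terms that cancel, so it may be kept. The terms on facet
  -- `i₀` coming from the edges then involve the sum of all gradients and disappear, and the
  -- distinguished vertex leaves no trace in the result.
  rw [Finset.sum_congr rfl fun i _ => hterm i, Finset.sum_sub_distrib, ← Finset.mul_sum,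
    ← integral_finsetSum _ fun i _ => hint i i₀]
  simp only [← sum_inner, sum_baryGrad, inner_zero_left, integral_zero, mul_zero, zero_sub]
  rw [← Finset.sum_neg_distrib]
  refine Finset.sum_congr rfl fun i _ => ?_
  rw [← integral_const_mul, ← integral_neg]
  simp only [neg_smul, inner_neg_right, inner_smul_right, real_inner_comm]

omit [Fintype ι] in
lemma volume_simplexSet_pos : 0 < volume (simplexSet b) := by
  have h : (interior (simplexSet b)).Nonempty := by
    rw [← convexHull_eq_simplexSet]
    exact interior_convexHull_nonempty_iff_affineSpan_eq_top.2 b.tot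
  exact (isOpen_interior.measure_pos volume h).trans_le (measure_mono interior_subset)

-- If the facet were null, almost every line parallel to an edge leaving it would miss the simplex,
-- and by Fubini the simplex would have volume zero.
omit [Fintype ι] in
lemma surface_simplexFacet_pos [Nontrivial ι] (i : ι) : 0 < surface d (simplexFacet b i) := by
  obtain ⟨j, hj⟩ := exists_ne i
  have hij := hj.symm
  refine pos_iff_ne_zero.2 fun h0 => (volume_simplexSet_pos b).ne' ?_
  set a := baryGrad b i with ha
  have hae : inner ℝ a (b i - b j) = 1 := inner_baryGrad_edge_left b hij
  have hane : a ≠ 0 := baryGrad_ne_zero b i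
  have := sfinite_surface_hyperplane hane (-b.coord i 0)
  have h := congrArg (fun m : Measure (Euc d) => m (simplexSet b))
    (map_hyperplane_prod hane hae (-b.coord i 0))
  have hm : Measurable (fun z : Euc d × ℝ => z.1 + z.2 • (b i - b j)) := by fun_prop
  have hS := (isClosed_simplexSet b).measurableSet
  simp only [Measure.smul_apply, smul_eq_mul] at h
  rw [Measure.map_apply hm hS, Measure.prod_apply (hm hS)] at h
  suffices h2 : ∫⁻ z in hyperplane a (-b.coord i 0), volume (Prod.mk z ⁻¹'
      ((fun z : Euc d × ℝ => z.1 + z.2 • (b i - b j)) ⁻¹' simplexSet b)) ∂(surface d) = 0 by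
    rw [h2] at h
    exact (mul_eq_zero.1 h.symm).resolve_left (by simpa using hane)
  rw [lintegral_eq_zero_iff (measurable_measure_prodMk_left (hm hS))]
  have hnot : ∀ᵐ z ∂((surface d).restrict (hyperplane a (-b.coord i 0))),
      z ∉ simplexFacet b i := by
    rw [ae_iff]
    simp only [not_not]
    exact le_antisymm ((Measure.restrict_apply_le _ _).trans_eq h0) bot_le
  filter_upwards [hnot, ae_restrict_mem (isClosed_hyperplane a _).measurableSet] with z hz hzc
  have hzi : b.coord i z = 0 := by
    rw [coord_eq_inner, show inner ℝ (baryGrad b i) z = _ from hzc]; ring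
  rw [Pi.zero_apply]
  convert measure_empty (μ := (volume : Measure ℝ))
  rw [eq_empty_iff_forall_notMem]
  intro t ht
  have ht : ∀ k, 0 ≤ b.coord k (z + t • (b i - b j)) := ht
  refine hz ⟨fun k => ?_, hzi⟩
  have h1 := ht i; have h2 := ht j; have h3 := ht k
  simp only [coord_add_smul] at h1 h2 h3
  rw [inner_baryGrad_edge_left b hij, hzi] at h1
  rw [inner_baryGrad_edge_right b hij] at h2
  by_cases hki : k = i
  · rw [hki, hzi]
  · by_cases hkj : k = j
    · rw [hkj]; linarith
    · rwa [inner_baryGrad_edge_of_ne b hki hkj, mul_zero, add_zero] at h3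

end divergenceTheorem

/-! ### Simplices given by their vertex sets, and their normals -/

section vertexSets

variable {d : ℕ} {K : Finset (Euc d)}

/-- The vertices of a nondegenerate simplex as an affine basis. -/
def vertexBasis (hK : AffineIndependent ℝ ((↑) : K → Euc d)) (hc : K.card = d + 1) :
    AffineBasis K ℝ (Euc d) :=
  ⟨(↑), hK, hK.affineSpan_eq_top_iff_card_eq_finrank_add_one.2 (by simp [hc])⟩

variable (hK : AffineIndependent ℝ ((↑) : K → Euc d)) (hc : K.card = d + 1)

@[simp] lemma vertexBasis_apply (v : K) : vertexBasis hK hc v = v := rfl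

lemma convexHull_eq_simplexSet_vertexBasis :
    convexHull ℝ (K : Set (Euc d)) = simplexSet (vertexBasis hK hc) := by
  rw [← convexHull_eq_simplexSet]
  congr 1
  ext x
  simp only [mem_range, Subtype.exists, vertexBasis_apply, exists_prop, exists_eq_right,
    SetLike.mem_coe]

open Classical in
lemma convexHull_erase_eq_simplexFacet (v : K) :
    convexHull ℝ ((K.erase v : Finset (Euc d)) : Set (Euc d)) =
      simplexFacet (vertexBasis hK hc) v := by
  rw [← convexHull_image_compl]
  congr 1
  ext x
  simp only [Finset.coe_erase, Set.mem_sdiff, SetLike.mem_coe, mem_singleton_iff, mem_image,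
    mem_compl_iff, Subtype.exists, vertexBasis_apply]
  constructor
  · rintro ⟨h1, h2⟩
    exact ⟨x, h1, fun h => h2 (congrArg Subtype.val h), rfl⟩
  · rintro ⟨y, h1, h2, rfl⟩
    exact ⟨h1, fun h => h2 (Subtype.ext h)⟩

-- The coordinate of `v` is zero at all other vertices, so its gradient is orthogonal to their
-- differences; a count of dimensions gives equality. This evaluates the projection in the
-- definition of `normal`.
open Classical in
lemma orthogonal_vectorSpan_erase (hd : 0 < d) (v : K) :
    (vectorSpan ℝ ((K.erase v : Finset (Euc d)) : Set (Euc d)))ᗮ =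
      ℝ ∙ baryGrad (vertexBasis hK hc) v := by
  set b := vertexBasis hK hc
  have : Nontrivial K := Fintype.one_lt_card_iff_nontrivial.1 (by simp [hc, hd])
  have hle : vectorSpan ℝ ((K.erase v : Finset (Euc d)) : Set (Euc d)) ≤ (ℝ ∙ baryGrad b v)ᗮ := by
    rw [vectorSpan, Submodule.span_le]
    rintro _ ⟨x, hx, y, hy, rfl⟩
    have hz : ∀ x ∈ K.erase v, b.coord v x = 0 := by
      intro x hx
      have hx' := Finset.mem_erase.1 hx
      have : b ⟨x, hx'.2⟩ = x := rfl
      rw [← this]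
      exact b.coord_apply_ne fun h => hx'.1 (by rw [h])
    change x - y ∈ _
    rw [SetLike.mem_coe, Submodule.mem_orthogonal_singleton_iff_inner_right, inner_baryGrad_sub,
      hz x hx, hz y hy, sub_zero]
  have hind : AffineIndependent ℝ (Subtype.val : {x // x ∈ K.erase (v : Euc d)} → Euc d) :=
    AffineIndependent.mono (s := ((K.erase v : Finset (Euc d)) : Set (Euc d)))
      (t := (K : Set (Euc d))) hK (Finset.coe_subset.2 (Finset.erase_subset _ _))
  have hcard : (K.erase (v : Euc d)).card = d := by
    rw [Finset.card_erase_of_mem v.2, hc]; simp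
  have hfin : finrank ℝ (vectorSpan ℝ ((K.erase v : Finset (Euc d)) : Set (Euc d))) = d - 1 := by
    have := hind.finrank_vectorSpan (n := d - 1) (by simp [hcard]; omega)
    rwa [show range (Subtype.val : {x // x ∈ K.erase (v : Euc d)} → Euc d) =
      ((K.erase v : Finset (Euc d)) : Set (Euc d)) from Subtype.range_coe] at this
  rw [Submodule.eq_of_le_of_finrank_eq hle (by
    rw [hfin, finrank_orthogonal_span_singleton' (baryGrad_ne_zero b v)]),
    Submodule.orthogonal_orthogonal]

open Classical in
/-- The outward normal is the normalization of minus the barycentric gradient. -/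
lemma normal_erase (hd : 0 < d) (v : K) : normal K (K.erase v) =
    -‖baryGrad (vertexBasis hK hc) v‖⁻¹ • baryGrad (vertexBasis hK hc) v := by
  set b := vertexBasis hK hc with hb
  have : Nontrivial K := Fintype.one_lt_card_iff_nontrivial.1 (by simp [hc, hd])
  have hane := baryGrad_ne_zero b v
  have hcard : (K.erase (v : Euc d)).card = d := by
    rw [Finset.card_erase_of_mem v.2, hc]; simp
  have hlin : ∀ x ∈ K, inner ℝ (baryGrad b v) x = (if x = v then 1 else 0) - b.coord v 0 := by
    intro x hx
    have h1 := coord_eq_inner b v x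
    have h2 : b.coord v x = if x = v then 1 else 0 := by
      have : b ⟨x, hx⟩ = x := rfl
      rw [← this, b.coord_apply]
      simp [this, Subtype.ext_iff, eq_comm]
    linarith
  have hd' : (d : ℝ) ≠ 0 := by positivity
  -- The coordinate of `v` is `0` at the barycentre of the facet and `1 / (d + 1)` at that of the
  -- simplex. The sign of the difference is what makes the normal point outward.
  have hinner : inner ℝ (baryGrad b v) (barycentre (K.erase (v : Euc d)) - barycentre K) =
      -((d : ℝ) + 1)⁻¹ := by
    rw [inner_sub_right, barycentre, barycentre, inner_smul_right, inner_smul_right, inner_sum,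
      inner_sum, Finset.sum_congr rfl fun x hx => hlin x (Finset.mem_of_mem_erase hx),
      Finset.sum_congr rfl hlin, Finset.sum_sub_distrib, Finset.sum_sub_distrib, hcard, hc]
    simp only [Finset.sum_ite_eq', Finset.notMem_erase, v.2, if_true, if_false, Finset.sum_const,
      hcard, hc, nsmul_eq_mul]
    push_cast
    field_simp
    ring
  have hproj : ((vectorSpan ℝ ((K.erase v : Finset (Euc d)) : Set (Euc d)))ᗮ).starProjection
      (barycentre (K.erase (v : Euc d)) - barycentre K) =
      (-((d : ℝ) + 1)⁻¹ / ‖baryGrad b v‖ ^ 2) • baryGrad b v := by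
    rw [← hinner]
    have h := Submodule.starProjection_singleton ℝ (v := baryGrad b v)
      (barycentre (K.erase (v : Euc d)) - barycentre K)
    simp only [orthogonal_vectorSpan_erase hK hc hd v]
    simpa using h
  have hneg : -((d : ℝ) + 1)⁻¹ / ‖baryGrad b v‖ ^ 2 < 0 := by
    have : 0 < ‖baryGrad b v‖ := norm_pos_iff.2 hane
    exact div_neg_of_neg_of_pos (neg_neg_of_pos (by positivity)) (by positivity)
  rw [normal, hproj, NormedSpace.normalize_smul_of_neg hneg, NormedSpace.normalize, neg_smul]

end vertexSets

end HDG

namespace HDG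

open Module
open scoped ENNReal

/-! ### Elements and faces of a triangulation -/

namespace Triangulation

variable {d : ℕ} {Ω : Set (Euc d)} {T : Triangulation Ω}

/-- The vertices of an element as an affine basis. -/
def Elem.basis (K : T.Elem) : AffineBasis K.1 ℝ (Euc d) :=
  vertexBasis (T.indep K.2.1) K.2.2

/-- An element as a closed simplex. -/
def Elem.closedDom (K : T.Elem) : Set (Euc d) := simplexSet K.basis

lemma Elem.convexHull_eq (K : T.Elem) : convexHull ℝ (K.1 : Set (Euc d)) = K.closedDom :=
  convexHull_eq_simplexSet_vertexBasis _ _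

lemma Elem.dom_eq (K : T.Elem) : K.dom = interior K.closedDom := by
  rw [Elem.dom, K.convexHull_eq]

lemma Elem.restrict_dom (K : T.Elem) :
    (volume : Measure (Euc d)).restrict K.dom = volume.restrict K.closedDom := by
  rw [K.dom_eq]; exact restrict_interior_simplexSet _

lemma Elem.dom_nonempty (K : T.Elem) : K.dom.Nonempty := by
  rw [Elem.dom]
  refine interior_convexHull_nonempty_iff_affineSpan_eq_top.2 ?_
  have := K.basis.tot
  rwa [show range K.basis = (K.1 : Set (Euc d)) from Subtype.range_coe] at this

lemma Elem.isOpen_dom (K : T.Elem) : IsOpen K.dom := isOpen_interior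

lemma Elem.dom_subset (K : T.Elem) : K.dom ⊆ Ω := T.open_subset K.1 K.2.1 K.2.2

lemma Elem.isCompact_closedDom (K : T.Elem) : IsCompact K.closedDom := isCompact_simplexSet _

lemma Elem.dom_subset_closedDom (K : T.Elem) : K.dom ⊆ K.closedDom := by
  rw [K.dom_eq]; exact interior_subset

lemma Elem.closure_dom (K : T.Elem) : closure K.dom = K.closedDom := by
  have h : (interior K.closedDom).Nonempty := by rw [← K.dom_eq]; exact K.dom_nonempty
  have h2 : Convex ℝ K.closedDom := convex_simplexSet K.basis
  rw [K.dom_eq, h2.closure_interior_eq_closure_of_nonempty_interior h]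
  exact (isClosed_simplexSet K.basis).closure_eq

lemma Elem.closedDom_subset (K : T.Elem) : K.closedDom ⊆ closure Ω := by
  rw [← K.closure_dom]; exact closure_mono K.dom_subset

variable [NeZero d]

instance Elem.nontrivial (K : T.Elem) : Nontrivial K.1 :=
  Fintype.one_lt_card_iff_nontrivial.1 (by simp [K.2.2, Nat.pos_of_ne_zero (NeZero.ne d)])

open Classical in
/-- The face of an element opposite to a vertex. -/
def Elem.face (K : T.Elem) (v : K.1) : T.Face :=
  ⟨K.1.erase v, by
    have hc : (K.1.erase (v : Euc d)).card = d := by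
      rw [Finset.card_erase_of_mem v.2, K.2.2]; simp
    refine ⟨T.down_closed K.2.1 (Finset.erase_subset _ _) ?_, hc⟩
    rw [← Finset.card_pos, hc]
    exact Nat.pos_of_ne_zero (NeZero.ne d)⟩

omit [NeZero d] in
lemma Elem.mem_bd {K : T.Elem} {F : T.Face} : F ∈ K.bd ↔ F.1 ⊆ K.1 := by
  simp [Elem.bd]

lemma Elem.face_mem_bd (K : T.Elem) (v : K.1) : K.face v ∈ K.bd :=
  Elem.mem_bd.2 (Finset.erase_subset _ _)

lemma Elem.face_injective (K : T.Elem) : Function.Injective K.face := by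
  classical
  intro v w h
  have h1 : K.1.erase (v : Euc d) = K.1.erase (w : Euc d) := congrArg Subtype.val h
  by_contra hne
  have : (v : Euc d) ∈ K.1.erase (w : Euc d) :=
    Finset.mem_erase.2 ⟨fun h => hne (Subtype.ext h), v.2⟩
  rw [← h1] at this
  exact Finset.notMem_erase _ _ this

lemma Elem.exists_face_eq {K : T.Elem} {F : T.Face} (hF : F ∈ K.bd) : ∃ v, K.face v = F := by
  classical
  have hsub := Elem.mem_bd.1 hF
  have hcard : (K.1 \ F.1).card = 1 := by
    rw [Finset.card_sdiff_of_subset hsub, K.2.2, F.2.2]; simp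
  obtain ⟨v, hv⟩ := Finset.card_eq_one.1 hcard
  have hv' : v ∈ K.1 \ F.1 := by rw [hv]; simp
  refine ⟨⟨v, (Finset.mem_sdiff.1 hv').1⟩, Subtype.ext ?_⟩
  change K.1.erase v = F.1
  rw [Finset.erase_eq, ← hv, Finset.sdiff_sdiff_eq_self hsub]

lemma Elem.sum_bd (K : T.Elem) {M : Type*} [AddCommMonoid M] (g : T.Face → M) :
    ∑ F ∈ K.bd, g F = ∑ v : K.1, g (K.face v) := by
  symm
  refine Finset.sum_bij (fun v _ => K.face v) (fun v _ => K.face_mem_bd v)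
    (fun v _ w _ h => K.face_injective h) (fun F hF => ?_) (fun _ _ => rfl)
  obtain ⟨v, rfl⟩ := Elem.exists_face_eq hF
  exact ⟨v, Finset.mem_univ _, rfl⟩

lemma Elem.set_face (K : T.Elem) (v : K.1) : (K.face v).set = simplexFacet K.basis v :=
  convexHull_erase_eq_simplexFacet _ _ v

lemma Elem.faceMeasure_face (K : T.Elem) (v : K.1) :
    faceMeasure (K.face v).1 = (surface d).restrict (simplexFacet K.basis v) := by
  rw [← K.set_face]; rfl

lemma Elem.normal_face (K : T.Elem) (v : K.1) :
    normal K.1 (K.face v).1 = -‖baryGrad K.basis v‖⁻¹ • baryGrad K.basis v :=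
  normal_erase _ _ (Nat.pos_of_ne_zero (NeZero.ne d)) v

lemma Elem.norm_normal {K : T.Elem} {F : T.Face} (hF : F ∈ K.bd) : ‖normal K.1 F.1‖ = 1 := by
  obtain ⟨v, rfl⟩ := Elem.exists_face_eq hF
  rw [K.normal_face, norm_smul, norm_neg, norm_inv, norm_norm,
    inv_mul_cancel₀ (norm_ne_zero_iff.2 (baryGrad_ne_zero _ _))]

omit [NeZero d] in
lemma exists_elem_of_mem_faces {s : Finset (Euc d)} (hs : s ∈ T.faces) :
    ∃ K : T.Elem, s ⊆ K.1 := by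
  obtain ⟨K, hK, hsK, hc⟩ := T.pure s hs
  exact ⟨⟨K, hK, hc⟩, hsK⟩

omit [NeZero d] in
lemma Face.exists_elem (F : T.Face) : ∃ K : T.Elem, F ∈ K.bd := by
  obtain ⟨K, hK⟩ := exists_elem_of_mem_faces F.2.1
  exact ⟨K, Elem.mem_bd.2 hK⟩

lemma Elem.set_subset_closedDom {K : T.Elem} {F : T.Face} (hF : F ∈ K.bd) :
    F.set ⊆ K.closedDom := by
  obtain ⟨v, rfl⟩ := Elem.exists_face_eq hF
  rw [K.set_face]
  exact fun x hx => hx.1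

omit [NeZero d] in
lemma Face.isCompact_set (F : T.Face) : IsCompact F.set :=
  F.1.finite_toSet.isCompact_convexHull ℝ

instance Face.isFiniteMeasure (F : T.Face) : IsFiniteMeasure (faceMeasure F.1) := by
  obtain ⟨K, hK⟩ := F.exists_elem
  obtain ⟨v, rfl⟩ := Elem.exists_face_eq hK
  rw [K.faceMeasure_face]
  exact ⟨by simpa using surface_simplexFacet_lt_top K.basis v⟩

lemma Face.faceMeasure_ne_zero (F : T.Face) : faceMeasure F.1 ≠ 0 := by
  obtain ⟨K, hK⟩ := F.exists_elem
  obtain ⟨v, rfl⟩ := Elem.exists_face_eq hK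
  rw [K.faceMeasure_face, Ne, Measure.restrict_eq_zero]
  exact (surface_simplexFacet_pos K.basis v).ne'

instance Elem.isFiniteMeasure (K : T.Elem) :
    IsFiniteMeasure ((volume : Measure (Euc d)).restrict K.dom) := by
  rw [K.restrict_dom]; exact isFiniteMeasure_restrict_simplexSet _

/-- The divergence theorem on an element. -/
theorem Elem.setIntegral_divergence (K : T.Elem) {v : Euc d → Euc d} {C : ℝ≥0}
    (hv : LipschitzOnWith C v K.closedDom) :
    ∫ x in K.dom, divergence v x =
      T.bdInt K (fun F x => inner ℝ (v x) (normal K.1 F.1)) := by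
  rw [K.restrict_dom, Elem.closedDom, setIntegral_divergence_simplexSet K.basis hv, bdInt,
    K.sum_bd]
  simp only [K.faceMeasure_face, K.normal_face]

/-- The barycentric coordinates of the barycentre of a face. -/
lemma Elem.coord_barycentre_face (K : T.Elem) (v : K.1) :
    K.basis.coord v (barycentre (K.face v).1) = 0 ∧
      ∀ j, j ≠ v → 0 < K.basis.coord j (barycentre (K.face v).1) := by
  classical
  have hd : 0 < d := Nat.pos_of_ne_zero (NeZero.ne d)
  have hcard := (K.face v).2.2
  have hcalc : ∀ j : K.1, K.basis.coord j (barycentre (K.face v).1) =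
      (d : ℝ)⁻¹ * ∑ x ∈ (K.face v).1, K.basis.coord j x := by
    intro j
    have h1 : ∀ x, K.basis.coord j x =
        inner ℝ (baryGrad K.basis j) x + K.basis.coord j 0 := coord_eq_inner _ j
    rw [h1, barycentre, inner_smul_right, inner_sum, hcard,
      Finset.sum_congr rfl fun x _ => h1 x, Finset.sum_add_distrib, Finset.sum_const, hcard,
      nsmul_eq_mul, mul_add]
    field_simp
  have hval : ∀ j : K.1, ∀ x ∈ (K.face v).1, K.basis.coord j x = if x = j then 1 else 0 := by
    intro j x hx
    have hx' : x ∈ K.1 := Finset.mem_of_mem_erase hx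
    have : K.basis ⟨x, hx'⟩ = x := rfl
    rw [← this, K.basis.coord_apply]
    simp [this, Subtype.ext_iff, eq_comm]
  refine ⟨?_, fun j hj => ?_⟩
  · rw [hcalc, Finset.sum_congr rfl (hval v), Finset.sum_ite_eq']
    simp [Elem.face]
  · rw [hcalc, Finset.sum_congr rfl (hval j), Finset.sum_ite_eq']
    have : (j : Euc d) ∈ (K.face v).1 :=
      Finset.mem_erase.2 ⟨fun h => hj (Subtype.ext h), j.2⟩
    rw [if_pos this]
    positivity

open Classical in
/-- Two elements that share a face lie on opposite sides of it. -/
lemma Elem.normal_eq_neg_normal {K K' : T.Elem} {F : T.Face} (hF : F ∈ K.bd) (hF' : F ∈ K'.bd)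
    (hne : K ≠ K') : normal K.1 F.1 = - normal K'.1 F.1 := by
  obtain ⟨v, rfl⟩ := Elem.exists_face_eq hF
  obtain ⟨v', hv'⟩ := Elem.exists_face_eq hF'
  have hd : 0 < d := Nat.pos_of_ne_zero (NeZero.ne d)
  set a := baryGrad K.basis v with ha
  set a' := baryGrad K'.basis v' with ha'
  have hane : a ≠ 0 := baryGrad_ne_zero _ _
  have hane' : a' ≠ 0 := baryGrad_ne_zero _ _
  -- Both gradients span the line orthogonal to the common face, so they are proportional; the sign
  -- of the factor tells whether the elements lie on the same side.
  have hspan : ℝ ∙ a = ℝ ∙ a' := by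
    have h1 := orthogonal_vectorSpan_erase (T.indep K.2.1) K.2.2 hd v
    have h2 := orthogonal_vectorSpan_erase (T.indep K'.2.1) K'.2.2 hd v'
    have h3 : K'.1.erase (v' : Euc d) = K.1.erase (v : Euc d) := congrArg Subtype.val hv'
    rw [h3] at h2
    exact h1.symm.trans h2
  obtain ⟨c, hc⟩ : ∃ c : ℝ, c • a = a' :=
    Submodule.mem_span_singleton.1 (hspan ▸ Submodule.mem_span_singleton_self a')
  have hc0 : c ≠ 0 := by rintro rfl; exact hane' (by rw [← hc, zero_smul])
  rcases lt_or_gt_of_ne hc0 with hneg | hpos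
  · have h1 := K'.normal_face v'
    rw [hv'] at h1
    rw [h1, K.normal_face, ← ha, ← ha', ← hc, norm_smul, Real.norm_of_nonpos hneg.le]
    have : ‖a‖ ≠ 0 := norm_ne_zero_iff.2 hane
    rw [smul_smul, ← neg_smul]
    congr 1
    field_simp
  -- With a positive factor, a short move from the barycentre `y` of the face in direction `a`
  -- enters both elements. By the intersection property of the complex the point reached lies in the
  -- hull of the common vertices, that is, on the face, where the coordinate of `v` is zero and not
  -- positive.
  · exfalso
    set y : Euc d := barycentre (K.face v).1 with hy
    have hcoord : ∀ (J : T.Elem) (w : J.1), J.face w = K.face v → J.basis.coord w y = 0 ∧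
        ∀ j, j ≠ w → 0 < J.basis.coord j y := by
      intro J w hJ
      rw [hy, ← hJ]
      exact J.coord_barycentre_face w
    have hev : ∀ (J : T.Elem) (w : J.1), J.face w = K.face v → 0 < inner ℝ (baryGrad J.basis w) a →
        ∀ᶠ t in nhdsWithin (0 : ℝ) (Ioi 0), y + t • a ∈ J.closedDom := by
      intro J w hJ hw
      refine (Filter.eventually_all (ι := J.1)).2 fun j => ?_
      by_cases hj : j = w
      · subst hj
        filter_upwards [self_mem_nhdsWithin] with t ht
        rw [coord_add_smul, (hcoord J j hJ).1, zero_add]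
        exact (mul_pos ht hw).le
      · have hcont : Continuous fun t : ℝ => J.basis.coord j (y + t • a) :=
          (continuous_barycentric_coord J.basis j).comp (by fun_prop)
        have h0 : 0 < J.basis.coord j (y + (0 : ℝ) • a) := by
          rw [zero_smul, add_zero]; exact (hcoord J w hJ).2 j hj
        filter_upwards [nhdsWithin_le_nhds (hcont.continuousAt.eventually (lt_mem_nhds h0))]
          with t ht using ht.le
    have haa : 0 < inner ℝ a a := real_inner_self_pos.2 hane
    have haa' : 0 < inner ℝ a' a := by
      rw [← hc, inner_smul_left]; exact mul_pos hpos haa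
    obtain ⟨t, ⟨h1, h2⟩, ht⟩ := ((hev K v rfl haa).and (hev K' v' hv' haa')).and
      (self_mem_nhdsWithin (a := (0 : ℝ)) (s := Ioi 0)) |>.exists
    rw [← Elem.convexHull_eq] at h1 h2
    have h3 := T.inter_subset_convexHull K.2.1 K'.2.1 ⟨h1, h2⟩
    have hinter : (K.1 : Set (Euc d)) ∩ K'.1 = ((K.face v).1 : Set (Euc d)) := by
      rw [← Finset.coe_inter]
      congr 1
      symm
      refine Finset.eq_of_subset_of_card_le (Finset.subset_inter (Elem.mem_bd.1 hF)
        (Elem.mem_bd.1 hF')) ?_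
      rw [(K.face v).2.2]
      by_contra hlt
      have hle : d + 1 ≤ (K.1 ∩ K'.1).card := by omega
      have e1 := Finset.eq_of_subset_of_card_le (Finset.inter_subset_left (s₁ := K.1) (s₂ := K'.1))
        (by rw [K.2.2]; exact hle)
      have e2 := Finset.eq_of_subset_of_card_le (Finset.inter_subset_right (s₁ := K.1) (s₂ := K'.1))
        (by rw [K'.2.2]; exact hle)
      exact hne (Subtype.ext (e1.symm.trans e2))
    rw [hinter] at h3
    have h4 : y + t • a ∈ simplexFacet K.basis v := by rw [← K.set_face]; exact h3
    have h5 := h4.2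
    rw [coord_add_smul, (hcoord K v rfl).1, zero_add] at h5
    exact (mul_pos ht haa).ne' h5

end Triangulation

end HDG

namespace HDG

open Module Filter Topology
open scoped ENNReal

/-! ### Conformity: cancellation of the normals -/

namespace Triangulation

variable {d : ℕ} {Ω : Set (Euc d)} {T : Triangulation Ω} [NeZero d]

omit [NeZero d] in
lemma exists_elem_of_mem {x : Euc d} (hx : x ∈ closure Ω) : ∃ K : T.Elem, x ∈ K.closedDom := by
  rw [← T.space_eq] at hx
  obtain ⟨s, hs, hxs⟩ := mem_iUnion₂.1 hx
  obtain ⟨K, hK⟩ := exists_elem_of_mem_faces hs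
  refine ⟨K, ?_⟩
  rw [← K.convexHull_eq]
  exact convexHull_mono (Finset.coe_subset.2 hK) hxs

lemma Face.set_subset_closure (F : T.Face) : F.set ⊆ closure Ω := by
  obtain ⟨K, hK⟩ := F.exists_elem
  exact (Elem.set_subset_closedDom hK).trans K.closedDom_subset

/-- A face of only one element lies on the boundary. -/
lemma Elem.exists_ne_of_not_isBoundary {K : T.Elem} {F : T.Face} (hF : F ∈ K.bd)
    (hb : ¬ F.IsBoundary) : ∃ K' : T.Elem, K' ≠ K ∧ F ∈ K'.bd := by
  classical
  obtain ⟨v, rfl⟩ := Elem.exists_face_eq hF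
  obtain ⟨x₀, hx₀, hx₀f⟩ := not_subset.1 hb
  have hint : x₀ ∈ interior Ω := by
    by_contra h
    exact hx₀f ⟨(K.face v).set_subset_closure hx₀, h⟩
  rw [K.set_face] at hx₀
  set y : Euc d := barycentre (K.face v).1 with hy
  obtain ⟨hyv, hyj⟩ := K.coord_barycentre_face v
  set a := baryGrad K.basis v with ha
  have haa : 0 < inner ℝ a a := real_inner_self_pos.2 (baryGrad_ne_zero _ _)
  -- a relatively interior point of the face in the interior of the domain
  obtain ⟨s, hs, hs0⟩ : ∃ s : ℝ, x₀ + s • (y - x₀) ∈ interior Ω ∧ s ∈ Ioo (0 : ℝ) 1 := by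
    have hcont : ContinuousAt (fun s : ℝ => x₀ + s • (y - x₀)) 0 := by fun_prop
    have h1 : ∀ᶠ s in 𝓝[>] (0 : ℝ), x₀ + s • (y - x₀) ∈ interior Ω := by
      refine nhdsWithin_le_nhds (hcont.eventually (isOpen_interior.mem_nhds ?_))
      simpa using hint
    exact (h1.and (Ioo_mem_nhdsGT one_pos)).exists
  set z := x₀ + s • (y - x₀) with hz
  have hzcoord : ∀ j, K.basis.coord j z =
      (1 - s) * K.basis.coord j x₀ + s * K.basis.coord j y := by
    intro j
    rw [hz, coord_add_smul, inner_baryGrad_sub]; ring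
  have hzv : K.basis.coord v z = 0 := by rw [hzcoord, hx₀.2, hyv]; ring
  have hzj : ∀ j, j ≠ v → 0 < K.basis.coord j z := by
    intro j hj
    rw [hzcoord]
    have h1 : 0 ≤ (1 - s) * K.basis.coord j x₀ := mul_nonneg (by linarith [hs0.2]) (hx₀.1 j)
    have h2 := mul_pos hs0.1 (hyj j hj)
    linarith
  have hzK : z ∈ K.closedDom := by
    intro j
    by_cases hj : j = v
    · rw [hj, hzv]
    · exact (hzj j hj).le
  -- the union of the other elements is closed and accumulates at this point
  set R : Set (Euc d) := ⋃ K' ∈ {K' : T.Elem | K' ≠ K}, K'.closedDom with hR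
  have hRc : IsClosed R := (toFinite _).isClosed_biUnion fun K' _ => K'.isCompact_closedDom.isClosed
  -- Leaving `K` through the face in direction `-a`, one stays in `Ω` for small `t` and hence in
  -- some element, which is not `K` because the coordinate of `v` has become negative. There are
  -- finitely many closed elements, so the limit `z` belongs to one of the others.
  have hzR : z ∈ R := by
    have hcont : ContinuousAt (fun t : ℝ => z + t • (-a)) 0 := by fun_prop
    have htend : Tendsto (fun t : ℝ => z + t • (-a)) (𝓝[>] 0) (𝓝 z) := by
      have := hcont.tendsto
      simp only [zero_smul, add_zero] at this
      exact this.mono_left nhdsWithin_le_nhds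
    refine hRc.mem_of_tendsto htend ?_
    filter_upwards [htend.eventually (isOpen_interior.mem_nhds hs), self_mem_nhdsWithin]
      with t ht ht0
    obtain ⟨K', hK'⟩ := exists_elem_of_mem (T := T) (subset_closure (interior_subset ht))
    refine mem_iUnion₂.2 ⟨K', ?_, hK'⟩
    rintro rfl
    have h1 := hK' v
    rw [coord_add_smul, hzv, inner_neg_right] at h1
    have h2 := mul_pos (show (0 : ℝ) < t from ht0) haa
    linarith
  obtain ⟨K', hne, hzK'⟩ := mem_iUnion₂.1 hzR
  refine ⟨K', hne, Elem.mem_bd.2 fun w hw => ?_⟩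
  have hwK : w ∈ K.1 := Finset.mem_of_mem_erase hw
  have hwv : (⟨w, hwK⟩ : K.1) ≠ v := fun h => (Finset.mem_erase.1 hw).1 (congrArg Subtype.val h)
  -- The point `z` lies in the hull of the vertices common to `K` and `K'`. If `w` were not among
  -- them, the coordinate of `w` at `z` would vanish, but it is positive.
  by_contra hwK'
  rw [← Elem.convexHull_eq] at hzK hzK'
  have h3 := T.inter_subset_convexHull K.2.1 K'.2.1 ⟨hzK, hzK'⟩
  have hsub : (K.1 : Set (Euc d)) ∩ K'.1 ⊆ ((K.face ⟨w, hwK⟩).1 : Set (Euc d)) := by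
    rintro u ⟨hu, hu'⟩
    exact Finset.mem_coe.2 (Finset.mem_erase.2 ⟨fun h => hwK' (by rwa [show u = w from h] at hu'), hu⟩)
  have h4 : z ∈ (K.face ⟨w, hwK⟩).set := convexHull_mono hsub h3
  rw [K.set_face] at h4
  exact (hzj _ hwv).ne' h4.2

open Classical in
/-- The normals on the two sides of an interior face cancel. -/
lemma Face.sum_normal_eq_zero {F : T.Face} (hb : ¬ F.IsBoundary) :
    ∑ K : T.Elem with F ∈ K.bd, normal K.1 F.1 = 0 := by
  obtain ⟨K, hK⟩ := F.exists_elem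
  obtain ⟨K', hne, hK'⟩ := Elem.exists_ne_of_not_isBoundary hK hb
  have hset : (Finset.univ.filter fun J : T.Elem => F ∈ J.bd) = {K, K'} := by
    ext J
    simp only [Finset.mem_filter, Finset.mem_univ, true_and, Finset.mem_insert,
      Finset.mem_singleton]
    constructor
    · intro hJ
      by_contra! h
      -- The normal of a third element would be opposite both to that of `K` and to that of `K'`,
      -- which are opposite to each other; it would have to vanish.
      have h1 := Elem.normal_eq_neg_normal hJ hK h.1
      have h2 := Elem.normal_eq_neg_normal hJ hK' h.2
      have h3 := Elem.normal_eq_neg_normal hK' hK hne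
      rw [h3, neg_neg, h1] at h2
      have h4 := Elem.norm_normal hK
      have h5 : (2 : ℝ) • normal K.1 F.1 = 0 := by
        rw [two_smul]; nth_rewrite 1 [← h2]; exact neg_add_cancel _
      rw [(smul_eq_zero.1 h5).resolve_left two_ne_zero] at h4
      simp at h4
    · rintro (rfl | rfl) <;> assumption
  rw [hset, Finset.sum_pair hne.symm, Elem.normal_eq_neg_normal hK hK' hne.symm, neg_add_cancel]

/-- Single-valued fluxes cancel on the interior faces. -/
theorem bds_inner_normal_eq_zero (c : T.Face → Euc d → Euc d)
    (hc : ∀ F, Integrable (c F) (faceMeasure F.1))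
    (hb : ∀ F, F.IsBoundary → ∫ x, c F x ∂(faceMeasure F.1) = 0) :
    T.bds (fun K F x => inner ℝ (c F x) (normal K.1 F.1)) = 0 := by
  classical
  have h1 : ∀ (K : T.Elem) (F : T.Face), ∫ x, inner ℝ (c F x) (normal K.1 F.1) ∂(faceMeasure F.1) =
      inner ℝ (normal K.1 F.1) (∫ x, c F x ∂(faceMeasure F.1)) := by
    intro K F
    rw [← integral_inner (hc F)]
    simp only [real_inner_comm]
  simp only [bds, bdInt, h1]
  have h2 : ∀ K : T.Elem, K.bd = Finset.univ.filter fun F => F ∈ K.bd := fun K => by simp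
  rw [Finset.sum_congr rfl fun K _ => by rw [h2 K, Finset.sum_filter], Finset.sum_comm]
  refine Finset.sum_eq_zero fun F _ => ?_
  rw [← Finset.sum_filter, ← sum_inner]
  by_cases hF : F.IsBoundary
  · rw [hb F hF, inner_zero_right]
  · rw [Face.sum_normal_eq_zero hF, inner_zero_left]

end Triangulation

end HDG

namespace HDG

open Module Filter Topology
open scoped ENNReal

variable {d k : ℕ}

/-! ### Polynomial functions -/

/-- The polynomial function associated to a polynomial. -/
def polyEval (d : ℕ) : MvPolynomial (Fin d) ℝ →ₗ[ℝ] (Euc d → ℝ) where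
  toFun p x := MvPolynomial.eval (fun i => x i) p
  map_add' p q := by ext x; simp
  map_smul' c p := by ext x; simp

lemma Poly_eq_map (d k : ℕ) :
    Poly d k = (MvPolynomial.restrictTotalDegree (Fin d) ℝ k).map (polyEval d) := by
  ext f
  constructor
  · rintro ⟨p, hp, hf⟩
    exact ⟨p, (MvPolynomial.mem_restrictTotalDegree _ _ _).2 hp, (funext hf).symm⟩
  · rintro ⟨p, hp, rfl⟩
    exact ⟨p, (MvPolynomial.mem_restrictTotalDegree _ _ _).1 hp, fun _ => rfl⟩

instance (d k : ℕ) : FiniteDimensional ℝ (Poly d k) := by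
  rw [Poly_eq_map]; infer_instance

instance (d k : ℕ) : FiniteDimensional ℝ (VPoly d k) := by
  let L : VPoly d k →ₗ[ℝ] (Fin d → Poly d k) :=
    { toFun := fun v i => ⟨fun x => v.1 x i, v.2 i⟩
      map_add' := fun v w => rfl
      map_smul' := fun c v => rfl }
  refine FiniteDimensional.of_injective L fun v w h => ?_
  ext x i
  exact congrFun (congrArg Subtype.val (congrFun h i)) x

lemma Poly.const_mem (c : ℝ) : (fun _ => c) ∈ Poly d k :=
  ⟨MvPolynomial.C c, by simp, fun x => by simp⟩

lemma Poly.inner_add_const_mem (a : Euc d) (c : ℝ) : (fun x => inner ℝ a x + c) ∈ Poly d 1 := by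
  refine (Poly d 1).add_mem ?_ (Poly.const_mem c)
  refine ⟨∑ i, a i • MvPolynomial.X i, ?_, fun x => ?_⟩
  · refine MvPolynomial.totalDegree_finsetSum_le fun i _ => ?_
    exact (MvPolynomial.totalDegree_smul_le _ _).trans (by simp)
  · simp [PiLp.inner_apply, mul_comm]

lemma Poly.analyticOnNhd {f : Euc d → ℝ} (hf : f ∈ Poly d k) : AnalyticOnNhd ℝ f univ := by
  obtain ⟨p, -, hp⟩ := hf
  rw [funext hp]
  exact AnalyticOnNhd.eval_linearMap' (fun i => (EuclideanSpace.proj i : Euc d →L[ℝ] ℝ).toLinearMap) p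

lemma Poly.contDiff {f : Euc d → ℝ} (hf : f ∈ Poly d k) : ContDiff ℝ 1 f :=
  contDiffOn_univ.1 ((Poly.analyticOnNhd hf).contDiffOn uniqueDiffOn_univ)

lemma VPoly.contDiff {v : Euc d → Euc d} (hv : v ∈ VPoly d k) : ContDiff ℝ 1 v :=
  contDiff_euclidean.2 fun i => Poly.contDiff (hv i)

lemma VPoly.smul_const_mem {f : Euc d → ℝ} (hf : f ∈ Poly d k) (e : Euc d) :
    (fun x => f x • e) ∈ VPoly d k := fun i => by
  have := (Poly d k).smul_mem (e i) hf
  convert this using 1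
  ext x
  simp [mul_comm]

/-- A polynomial function vanishing almost everywhere on a nonempty open set vanishes. -/
lemma Poly.eq_zero_of_ae {f : Euc d → ℝ} (hf : f ∈ Poly d k) {U : Set (Euc d)} (hU : IsOpen U)
    (hne : U.Nonempty) (h : f =ᵐ[volume.restrict U] 0) : f = 0 := by
  obtain ⟨x, hx⟩ := hne
  have h1 : EqOn f 0 U := Measure.eqOn_open_of_ae_eq h hU
    (Poly.contDiff hf).continuous.continuousOn continuousOn_const
  have h2 := (Poly.analyticOnNhd hf).eqOn_zero_of_preconnected_of_eventuallyEq_zero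
    isPreconnected_univ (mem_univ x) (eventually_of_mem (hU.mem_nhds hx) h1)
  exact funext fun y => h2 (mem_univ y)

lemma VPoly.eq_zero_of_ae {v : Euc d → Euc d} (hv : v ∈ VPoly d k) {U : Set (Euc d)}
    (hU : IsOpen U) (hne : U.Nonempty) (h : v =ᵐ[volume.restrict U] 0) : v = 0 := by
  ext x i
  have := Poly.eq_zero_of_ae (hv i) hU hne (by filter_upwards [h] with x hx; simp [hx])
  exact congrFun this x

/-- The analytic derivative is expressed through formal partial derivatives, for which degrees can
be tracked. -/
lemma hasFDerivAt_polyEval (p : MvPolynomial (Fin d) ℝ) (x : Euc d) :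
    HasFDerivAt (polyEval d p)
      (∑ i, polyEval d (MvPolynomial.pderiv i p) x • (EuclideanSpace.proj i : Euc d →L[ℝ] ℝ)) x := by
  classical
  induction p using MvPolynomial.induction_on with
  | C a =>
    have : polyEval d (MvPolynomial.C a) = fun _ => a := by ext x; simp [polyEval]
    rw [this]
    refine (hasFDerivAt_const a x).congr_fderiv ?_
    simp
  | add p q hp hq =>
    rw [map_add]
    refine (hp.add hq).congr_fderiv ?_
    simp [add_smul, Finset.sum_add_distrib]
  | mul_X p j hp =>
    have h1 : polyEval d (p * MvPolynomial.X j) = fun x => polyEval d p x * x j := by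
      ext x; simp [polyEval]
    rw [h1]
    refine (hp.mul (EuclideanSpace.proj j : Euc d →L[ℝ] ℝ).hasFDerivAt).congr_fderiv ?_
    have h2 : ∀ i, polyEval d ((MvPolynomial.pderiv i) (p * MvPolynomial.X j)) x =
        polyEval d (MvPolynomial.pderiv i p) x * x j +
          polyEval d p x * (if j = i then 1 else 0) := by
      intro i
      rw [MvPolynomial.pderiv_mul, MvPolynomial.pderiv_X, Pi.single_apply]
      split_ifs <;> simp [polyEval]
    ext y
    simp only [h2, add_smul, Finset.sum_add_distrib, add_apply,
      sum_apply, smul_apply, Finset.smul_sum, smul_eq_mul]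
    simp only [mul_ite, mul_one, mul_zero, ite_mul, zero_mul, Finset.sum_ite_eq, Finset.mem_univ,
      if_true]
    rw [add_comm]
    congr 1
    exact Finset.sum_congr rfl fun i _ => by
      change x j * _ = _
      ring

/-- Differentiation lowers the degree by at least one, which makes room for the affine factor. In
the natural numbers `k - 1 + 1` may exceed `k` when `k = 0`, but a nonzero derivative forces `1 ≤
k`. -/
lemma totalDegree_mul_pderiv_le {L p : MvPolynomial (Fin d) ℝ} (hL : L.totalDegree ≤ 1)
    (hp : p.totalDegree ≤ k) (i : Fin d) :
    (L * MvPolynomial.pderiv i p).totalDegree ≤ k := by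
  have key : ∀ m ∈ (MvPolynomial.pderiv i p).support, (m.sum fun _ e => e) + 1 ≤ k := by
    intro m hm
    have h1 : m + Finsupp.single i 1 ∈ p.support := by
      rw [MvPolynomial.mem_support_iff] at hm ⊢
      rw [MvPolynomial.coeff_pderiv] at hm
      exact left_ne_zero_of_mul hm
    have h2 := (MvPolynomial.le_totalDegree h1).trans hp
    rw [Finsupp.sum_add_index' (by simp) (by simp)] at h2
    simpa using h2
  by_cases h0 : MvPolynomial.pderiv i p = 0
  · simp [h0]
  · obtain ⟨m, hm⟩ := MvPolynomial.ne_zero_iff.1 h0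
    have h1 := key m (MvPolynomial.mem_support_iff.2 hm)
    have h2 : (MvPolynomial.pderiv i p).totalDegree ≤ k - 1 :=
      Finset.sup_le fun m hm => by have := key m hm; omega
    refine (MvPolynomial.totalDegree_mul _ _).trans ?_
    omega

/-- The product of an affine function and a derivative of a polynomial of degree at most `k`
is a polynomial of degree at most `k`. -/
lemma Poly.mul_fderiv_mem {f l : Euc d → ℝ} (hf : f ∈ Poly d k) (hl : l ∈ Poly d 1) (e : Euc d) :
    (fun x => l x * fderiv ℝ f x e) ∈ Poly d k := by
  obtain ⟨p, hp, hf⟩ := hf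
  obtain ⟨L, hL, hl⟩ := hl
  have hf' : f = polyEval d p := funext hf
  refine ⟨∑ i, e i • (L * MvPolynomial.pderiv i p), ?_, fun x => ?_⟩
  · refine MvPolynomial.totalDegree_finsetSum_le fun i _ => ?_
    exact (MvPolynomial.totalDegree_smul_le _ _).trans (totalDegree_mul_pderiv_le hL hp i)
  · beta_reduce
    rw [hf', (hasFDerivAt_polyEval p x).fderiv, hl]
    simp only [sum_apply, smul_apply,
      smul_eq_mul, map_sum, MvPolynomial.smul_eval, map_mul,
      Finset.mul_sum]
    refine Finset.sum_congr rfl fun i _ => ?_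
    change _ * (MvPolynomial.eval (fun i => x i) (MvPolynomial.pderiv i p) * e i) = _
    ring

/-! ### Divergence and gradient -/

lemma inner_gradient (w : Euc d → ℝ) (x y : Euc d) :
    inner ℝ y (gradient w x) = fderiv ℝ w x y := by
  rw [inner_gradient_right]; simp

lemma divergence_smul {w : Euc d → ℝ} {v : Euc d → Euc d} {x : Euc d}
    (hw : DifferentiableAt ℝ w x) (hv : DifferentiableAt ℝ v x) :
    divergence (fun y => w y • v y) x = w x * divergence v x + inner ℝ (v x) (gradient w x) := by
  have h := (hw.hasFDerivAt.smul hv.hasFDerivAt).fderiv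
  have h' : fderiv ℝ (fun y => w y • v y) x =
    w x • fderiv ℝ v x + (fderiv ℝ w x).smulRight (v x) := h
  rw [inner_gradient]
  simp only [divergence, h', add_apply, smul_apply,
    ContinuousLinearMap.smulRight_apply, PiLp.add_apply, PiLp.smul_apply, smul_eq_mul,
    Finset.sum_add_distrib, ← Finset.mul_sum]
  congr 1
  conv_rhs => rw [← (EuclideanSpace.basisFun (Fin d) ℝ).sum_repr (v x)]
  simp [map_sum, mul_comm]

lemma divergence_add {v w : Euc d → Euc d} {x : Euc d} (hv : DifferentiableAt ℝ v x)
    (hw : DifferentiableAt ℝ w x) :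
    divergence (v + w) x = divergence v x + divergence w x := by
  simp [divergence, fderiv_add hv hw, Finset.sum_add_distrib]

lemma divergence_const_smul (c : ℝ) (v : Euc d → Euc d) (x : Euc d) :
    divergence (c • v) x = c * divergence v x := by
  simp [divergence, fderiv_const_smul_field, Finset.mul_sum]

lemma divergence_zero (x : Euc d) : divergence (0 : Euc d → Euc d) x = 0 := by
  simp [divergence]

lemma divergence_id (x : Euc d) : divergence (fun y : Euc d => y) x = d := by
  simp [divergence, show (fun y : Euc d => y) = id from rfl]

lemma continuous_divergence {v : Euc d → Euc d} (hv : ContDiff ℝ 1 v) :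
    Continuous (divergence v) := by
  have := hv.continuous_fderiv (by norm_num)
  unfold divergence
  fun_prop

lemma continuous_gradient {w : Euc d → ℝ} (hw : ContDiff ℝ 1 w) : Continuous (gradient w) := by
  have := hw.continuous_fderiv (by norm_num)
  unfold gradient
  fun_prop

lemma measurable_divergence (v : Euc d → Euc d) : Measurable (divergence v) := by
  unfold divergence
  refine Finset.measurable_sum _ fun i _ => ?_
  exact (EuclideanSpace.proj i : Euc d →L[ℝ] ℝ).measurable.comp
    (measurable_fderiv_apply_const ℝ v _)

lemma abs_divergence_le (v : Euc d → Euc d) (x : Euc d) :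
    |divergence v x| ≤ d * ‖fderiv ℝ v x‖ := by
  unfold divergence
  refine (Finset.abs_sum_le_sum_abs _ _).trans ?_
  refine (Finset.sum_le_card_nsmul _ _ ‖fderiv ℝ v x‖ fun i _ => ?_).trans_eq (by simp)
  refine (PiLp.norm_apply_le (fderiv ℝ v x (EuclideanSpace.single i 1)) i).trans ?_
  exact (ContinuousLinearMap.le_opNorm _ _).trans_eq (by simp)

end HDG

namespace HDG

open Module Filter Topology
open scoped ENNReal

namespace Triangulation

variable {d k : ℕ} {Ω : Set (Euc d)} {T : Triangulation Ω} [NeZero d]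

/-! ### Integrability -/

omit [NeZero d] in
lemma Elem.integrable_mul (K : T.Elem) {φ g : Euc d → ℝ} (hφ : ContinuousOn φ K.closedDom)
    (hg : IntegrableOn g K.dom) : IntegrableOn (fun x => φ x * g x) K.dom := by
  rw [IntegrableOn, K.restrict_dom] at hg ⊢
  obtain ⟨C, hC⟩ := K.isCompact_closedDom.exists_bound_of_continuousOn hφ
  refine hg.bdd_mul (c := C) (hφ.aestronglyMeasurable K.isCompact_closedDom.measurableSet) ?_
  exact (ae_restrict_iff' K.isCompact_closedDom.measurableSet).2 (Eventually.of_forall hC)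

omit [NeZero d] in
lemma Elem.integrableOn (K : T.Elem) {φ : Euc d → ℝ} (hφ : ContinuousOn φ K.closedDom) :
    IntegrableOn φ K.dom := by
  have h : IntegrableOn (fun _ : Euc d => (1 : ℝ)) K.dom := by
    rw [IntegrableOn]; exact integrable_const _
  simpa using K.integrable_mul hφ h

omit [NeZero d] in
lemma Face.integrable_mul (F : T.Face) {φ g : Euc d → ℝ} (hφ : ContinuousOn φ F.set)
    (hg : Integrable g (faceMeasure F.1)) :
    Integrable (fun x => φ x * g x) (faceMeasure F.1) := by
  obtain ⟨C, hC⟩ := F.isCompact_set.exists_bound_of_continuousOn hφ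
  refine hg.bdd_mul (c := C) (hφ.aestronglyMeasurable F.isCompact_set.measurableSet) ?_
  exact (ae_restrict_iff' F.isCompact_set.measurableSet).2 (Eventually.of_forall hC)

lemma Face.integrable (F : T.Face) {φ : Euc d → ℝ} (hφ : ContinuousOn φ F.set) :
    Integrable φ (faceMeasure F.1) := by
  simpa using F.integrable_mul hφ (integrable_const (1 : ℝ))

lemma Skel.integrable (lam : T.Skel) (F : T.Face) : Integrable (lam F) (faceMeasure F.1) :=
  (Lp.memLp (lam F)).integrable (by norm_num)

omit [NeZero d] in
lemma Skel.integrable_mul (lam μ : T.Skel) (F : T.Face) :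
    Integrable (fun x => lam F x * μ F x) (faceMeasure F.1) :=
  (Lp.memLp (lam F)).integrable_mul (Lp.memLp (μ F))

omit [NeZero d] in
lemma Elem.integrableOn_L2 (K : T.Elem) (f : L2 Ω) : IntegrableOn f K.dom := by
  have h : MemLp f 2 (volume.restrict K.dom) :=
    (Lp.memLp f).mono_measure (Measure.restrict_mono K.dom_subset le_rfl)
  exact h.integrable (by norm_num)

/-! ### Boundary integrals -/

/-- Integrability on all faces of an element. -/
def BdIntegrable (K : T.Elem) (φ : T.Face → Euc d → ℝ) : Prop :=
  ∀ F ∈ K.bd, Integrable (φ F) (faceMeasure F.1)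

omit [NeZero d]

lemma BdIntegrable.add {K : T.Elem} {φ ψ : T.Face → Euc d → ℝ} (hφ : BdIntegrable K φ)
    (hψ : BdIntegrable K ψ) : BdIntegrable K fun F x => φ F x + ψ F x :=
  fun F hF => (hφ F hF).add (hψ F hF)

lemma BdIntegrable.sub {K : T.Elem} {φ ψ : T.Face → Euc d → ℝ} (hφ : BdIntegrable K φ)
    (hψ : BdIntegrable K ψ) : BdIntegrable K fun F x => φ F x - ψ F x :=
  fun F hF => (hφ F hF).sub (hψ F hF)

lemma BdIntegrable.const_mul {K : T.Elem} {φ : T.Face → Euc d → ℝ} (hφ : BdIntegrable K φ)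
    (c : T.Face → ℝ) : BdIntegrable K fun F x => c F * φ F x :=
  fun F hF => (hφ F hF).const_mul (c F)

lemma BdIntegrable.congr {K : T.Elem} {φ ψ : T.Face → Euc d → ℝ} (hφ : BdIntegrable K φ)
    (h : ∀ F x, φ F x = ψ F x) : BdIntegrable K ψ := by
  rwa [show ψ = φ from funext fun F => funext fun x => (h F x).symm]

lemma bdInt_add {K : T.Elem} {φ ψ : T.Face → Euc d → ℝ} (hφ : BdIntegrable K φ)
    (hψ : BdIntegrable K ψ) :
    T.bdInt K (fun F x => φ F x + ψ F x) = T.bdInt K φ + T.bdInt K ψ := by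
  rw [bdInt, bdInt, bdInt, ← Finset.sum_add_distrib]
  exact Finset.sum_congr rfl fun F hF => integral_add (hφ F hF) (hψ F hF)

lemma bdInt_sub {K : T.Elem} {φ ψ : T.Face → Euc d → ℝ} (hφ : BdIntegrable K φ)
    (hψ : BdIntegrable K ψ) :
    T.bdInt K (fun F x => φ F x - ψ F x) = T.bdInt K φ - T.bdInt K ψ := by
  rw [bdInt, bdInt, bdInt, ← Finset.sum_sub_distrib]
  exact Finset.sum_congr rfl fun F hF => integral_sub (hφ F hF) (hψ F hF)

lemma bdInt_const_mul (K : T.Elem) (c : ℝ) (φ : T.Face → Euc d → ℝ) :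
    T.bdInt K (fun F x => c * φ F x) = c * T.bdInt K φ := by
  simp only [bdInt, integral_const_mul, Finset.mul_sum]

lemma bdInt_congr (K : T.Elem) {φ ψ : T.Face → Euc d → ℝ} (h : ∀ F x, φ F x = ψ F x) :
    T.bdInt K φ = T.bdInt K ψ := by
  rw [show φ = ψ from funext fun F => funext fun x => h F x]

lemma bdInt_congr_ae (K : T.Elem) {φ ψ : T.Face → Euc d → ℝ}
    (h : ∀ F ∈ K.bd, φ F =ᵐ[faceMeasure F.1] ψ F) : T.bdInt K φ = T.bdInt K ψ :=
  Finset.sum_congr rfl fun F hF => integral_congr_ae (h F hF)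

/-! ### Convection fields -/

/-- An open element is convex and contained in `Ω`, so the bound along segments applies to every
pair of its points; continuity extends it to the closed element. The maximum with `0` is there
because the given constant may have any sign. -/
lemma _root_.HDG.IsW1Infty.exists_lipschitzOnWith {β : Euc d → Euc d} (hβ : IsW1Infty Ω β)
    (K : T.Elem) : ∃ C, LipschitzOnWith C β K.closedDom := by
  obtain ⟨hcont, L, hL⟩ := hβ
  refine ⟨(max L 0).toNNReal, ?_⟩
  rw [← K.closure_dom]
  refine LipschitzOnWith.closure (hcont.mono (closure_mono K.dom_subset)) ?_
  refine LipschitzOnWith.of_dist_le_mul fun x hx y hy => ?_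
  have hconv : Convex ℝ K.dom := (convex_convexHull ℝ _).interior
  have h := hL x y ((hconv.segment_subset hx hy).trans K.dom_subset)
  rw [dist_eq_norm, dist_eq_norm, Real.coe_toNNReal _ (le_max_right _ _)]
  exact h.trans (by gcongr; exact le_max_left _ _)

lemma Elem.exists_lipschitzOnWith_of_contDiff (K : T.Elem) {E : Type*} [NormedAddCommGroup E]
    [NormedSpace ℝ E] {φ : Euc d → E} (hφ : ContDiff ℝ 1 φ) :
    ∃ C, LipschitzOnWith C φ K.closedDom :=
  hφ.locallyLipschitz.locallyLipschitzOn.exists_lipschitzOnWith_of_compact K.isCompact_closedDom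

lemma _root_.LipschitzOnWith.exists_smul {X E : Type*} [PseudoMetricSpace X]
    [NormedAddCommGroup E] [NormedSpace ℝ E] {s : Set X} {φ : X → ℝ} {v : X → E} {C C' : ℝ≥0}
    (hs : IsCompact s) (hφ : LipschitzOnWith C φ s) (hv : LipschitzOnWith C' v s) :
    ∃ C'', LipschitzOnWith C'' (fun x => φ x • v x) s := by
  obtain ⟨A, hA⟩ := hs.exists_bound_of_continuousOn hφ.continuousOn
  obtain ⟨B, hB⟩ := hs.exists_bound_of_continuousOn hv.continuousOn
  refine ⟨(max A 0 * C' + C * max B 0).toNNReal, LipschitzOnWith.of_dist_le_mul fun x hx y hy => ?_⟩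
  rw [Real.coe_toNNReal _ (by positivity)]
  have h1 := hφ.dist_le_mul x hx y hy
  have h2 := hv.dist_le_mul x hx y hy
  rw [dist_eq_norm] at h1 h2 ⊢
  have h3 : φ x • v x - φ y • v y = φ x • (v x - v y) + (φ x - φ y) • v y := by
    rw [smul_sub, sub_smul]; abel
  rw [h3]
  refine (norm_add_le _ _).trans ?_
  rw [norm_smul, norm_smul, add_mul]
  have h4 : ‖φ x‖ ≤ max A 0 := (hA x hx).trans (le_max_left _ _)
  have h5 : ‖v y‖ ≤ max B 0 := (hB y hy).trans (le_max_left _ _)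
  have h6 : (0 : ℝ) ≤ max A 0 := le_max_right _ _
  have h7 : ‖φ x‖ * ‖v x - v y‖ ≤ max A 0 * (C' * dist x y) := by gcongr
  have h8 : ‖φ x - φ y‖ * ‖v y‖ ≤ (C * dist x y) * max B 0 := by gcongr
  nlinarith

variable {β : Euc d → Euc d} {C : ℝ≥0} {K : T.Elem}

lemma Elem.ae_differentiableAt (hβ : LipschitzOnWith C β K.closedDom) :
    ∀ᵐ x ∂(volume.restrict K.dom), DifferentiableAt ℝ β x := by
  rw [K.restrict_dom, ae_restrict_iff' K.isCompact_closedDom.measurableSet]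
  exact ae_differentiableAt_of_lipschitzOnWith_simplexSet K.basis hβ

lemma Elem.integrableOn_divergence (hβ : LipschitzOnWith C β K.closedDom) :
    IntegrableOn (divergence β) K.dom := by
  have : IsFiniteMeasure ((volume : Measure (Euc d)).restrict K.dom) := by
    rw [K.restrict_dom]; exact isFiniteMeasure_restrict_simplexSet _
  refine Integrable.of_bound (C := d * C) (measurable_divergence β).aestronglyMeasurable ?_
  have h := ae_norm_fderiv_le_of_lipschitzOnWith_simplexSet K.basis hβ
  rw [K.restrict_dom]
  filter_upwards [h] with x hx
  exact (abs_divergence_le β x).trans (by gcongr)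

/-- The product rule for the divergence of a polynomial times the convection field. -/
lemma Elem.ae_divergence_smul (hβ : LipschitzOnWith C β K.closedDom) {w : Euc d → ℝ}
    (hw : ContDiff ℝ 1 w) :
    ∀ᵐ x ∂(volume.restrict K.dom), divergence (fun y => w y • β y) x =
      w x * divergence β x + inner ℝ (β x) (gradient w x) := by
  filter_upwards [Elem.ae_differentiableAt hβ] with x hx
  exact divergence_smul (hw.differentiable (by norm_num) x) hx

end Triangulation

end HDG

namespace HDG

open Module Filter Topology
open scoped ENNReal

/-! ### The local problems as linear systems -/

lemma VPoly.continuous {d k : ℕ} (v : VPoly d k) : Continuous v.1 := (VPoly.contDiff v.2).continuous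

lemma Poly.continuous {d k : ℕ} (u : Poly d k) : Continuous u.1 := (Poly.contDiff u.2).continuous

lemma VPoly.continuous_divergence {d k : ℕ} (v : VPoly d k) : Continuous (divergence v.1) :=
  HDG.continuous_divergence (VPoly.contDiff v.2)

lemma Poly.continuous_gradient {d k : ℕ} (u : Poly d k) : Continuous (gradient u.1) :=
  HDG.continuous_gradient (Poly.contDiff u.2)

lemma VPoly.divergence_add {d k : ℕ} (v w : VPoly d k) (x : Euc d) :
    divergence (v.1 + w.1) x = divergence v.1 x + divergence w.1 x :=
  HDG.divergence_add ((VPoly.contDiff v.2).differentiable (by norm_num) x)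
    ((VPoly.contDiff w.2).differentiable (by norm_num) x)

lemma VPoly.divergence_smul {d k : ℕ} (c : ℝ) (v : VPoly d k) (x : Euc d) :
    divergence (c • v.1) x = c * divergence v.1 x := divergence_const_smul c v.1 x

lemma Poly.inner_gradient_add {d k : ℕ} (v w : Poly d k) (x y : Euc d) :
    inner ℝ y (gradient (v.1 + w.1) x) = inner ℝ y (gradient v.1 x) + inner ℝ y (gradient w.1 x) := by
  simp only [inner_gradient]
  rw [fderiv_add ((Poly.contDiff v.2).differentiable (by norm_num) x)
    ((Poly.contDiff w.2).differentiable (by norm_num) x)]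
  rfl

lemma Poly.inner_gradient_smul {d k : ℕ} (c : ℝ) (v : Poly d k) (x y : Euc d) :
    inner ℝ y (gradient (c • v.1) x) = c * inner ℝ y (gradient v.1 x) := by
  simp only [inner_gradient]
  rw [fderiv_const_smul_field]
  rfl

namespace Triangulation

variable {d k : ℕ} {Ω : Set (Euc d)} {T : Triangulation Ω}

/-- The integrand of the volume terms of the local problem. -/
def localIntegrand (ε : ℝ) (β : Euc d → Euc d) (s t : VPoly d k × Poly d k) (x : Euc d) : ℝ :=
  ε⁻¹ * inner ℝ (s.1.1 x) (t.1.1 x) - s.2.1 x * divergence t.1.1 x + divergence s.1.1 x * t.2.1 x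
    - s.2.1 x * (t.2.1 x * divergence β x + inner ℝ (β x) (gradient t.2.1 x))

/-- The bilinear form of the local problem. -/
def localForm (ε : ℝ) (β : Euc d → Euc d) (τ : T.Elem → T.Face → ℝ) (K : T.Elem)
    (s t : VPoly d k × Poly d k) : ℝ :=
  (∫ x in K.dom, localIntegrand ε β s t x) + T.bdInt K (fun F x => τ K F * (s.2.1 x * t.2.1 x))

/-- The integrand of the face terms of the data of the local problem. -/
def localBdIntegrand (β : Euc d → Euc d) (τ : T.Elem → T.Face → ℝ) (lam : T.Skel) (K : T.Elem)
    (t : VPoly d k × Poly d k) (F : T.Face) (x : Euc d) : ℝ :=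
  ((τ K F - inner ℝ (β x) (normal K.1 F.1)) * t.2.1 x - inner ℝ (t.1.1 x) (normal K.1 F.1)) *
    lam F x

/-- The linear form of the local problem. -/
def localRhs (β : Euc d → Euc d) (τ : T.Elem → T.Face → ℝ) (lam : T.Skel) (f : L2 Ω) (K : T.Elem)
    (t : VPoly d k × Poly d k) : ℝ :=
  (∫ x in K.dom, t.2.1 x * f x) + T.bdInt K (localBdIntegrand β τ lam K t)

lemma localIntegrand_add_left (ε : ℝ) (β : Euc d → Euc d) (s s' t : VPoly d k × Poly d k)
    (x : Euc d) : localIntegrand ε β (s + s') t x =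
      localIntegrand ε β s t x + localIntegrand ε β s' t x := by
  simp only [localIntegrand, Prod.fst_add, Prod.snd_add, VPoly.divergence_add, Submodule.coe_add,
    Pi.add_apply, inner_add_left]
  ring

lemma localIntegrand_smul_left (ε : ℝ) (β : Euc d → Euc d) (c : ℝ) (s t : VPoly d k × Poly d k)
    (x : Euc d) : localIntegrand ε β (c • s) t x = c * localIntegrand ε β s t x := by
  simp only [localIntegrand, Prod.smul_fst, Prod.smul_snd, VPoly.divergence_smul,
    Submodule.coe_smul, Pi.smul_apply, real_inner_smul_left, smul_eq_mul]
  ring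

lemma localIntegrand_add_right (ε : ℝ) (β : Euc d → Euc d) (s t t' : VPoly d k × Poly d k)
    (x : Euc d) : localIntegrand ε β s (t + t') x =
      localIntegrand ε β s t x + localIntegrand ε β s t' x := by
  simp only [localIntegrand, Prod.fst_add, Prod.snd_add, VPoly.divergence_add,
    Poly.inner_gradient_add, Submodule.coe_add, Pi.add_apply, inner_add_right]
  ring

lemma localIntegrand_smul_right (ε : ℝ) (β : Euc d → Euc d) (c : ℝ) (s t : VPoly d k × Poly d k)
    (x : Euc d) : localIntegrand ε β s (c • t) x = c * localIntegrand ε β s t x := by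
  simp only [localIntegrand, Prod.smul_fst, Prod.smul_snd, VPoly.divergence_smul,
    Poly.inner_gradient_smul, Submodule.coe_smul, Pi.smul_apply, real_inner_smul_right, smul_eq_mul]
  ring

variable [NeZero d] {β : Euc d → Euc d} {C : ℝ≥0} {K : T.Elem}

omit [NeZero d] in
lemma Elem.integrableOn_mul_convection (hβ : LipschitzOnWith C β K.closedDom) (u w : Poly d k) :
    IntegrableOn (fun x => u.1 x * (w.1 x * divergence β x + inner ℝ (β x) (gradient w.1 x)))
      K.dom := by
  refine K.integrable_mul (Poly.continuous u).continuousOn ?_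
  refine Integrable.add (K.integrable_mul (Poly.continuous w).continuousOn
    (Elem.integrableOn_divergence hβ)) (K.integrableOn ?_)
  exact hβ.continuousOn.inner (Poly.continuous_gradient w).continuousOn

omit [NeZero d] in
lemma integrableOn_localIntegrand (ε : ℝ) (hβ : LipschitzOnWith C β K.closedDom)
    (s t : VPoly d k × Poly d k) : IntegrableOn (localIntegrand ε β s t) K.dom := by
  have h1 := (VPoly.continuous s.1)
  have h2 := (VPoly.continuous t.1)
  have h3 := (Poly.continuous s.2)
  have h4 := (Poly.continuous t.2)
  have h5 := (VPoly.continuous_divergence s.1)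
  have h6 := (VPoly.continuous_divergence t.1)
  refine Integrable.sub (K.integrableOn (Continuous.continuousOn ?_))
    (Elem.integrableOn_mul_convection hβ s.2 t.2)
  fun_prop

lemma bdIntegrable_mul_poly (τ : T.Elem → T.Face → ℝ) (u w : Poly d k) :
    BdIntegrable K (fun F x => τ K F * (u.1 x * w.1 x)) := fun F _ =>
  (F.integrable ((Poly.continuous u).mul (Poly.continuous w)).continuousOn).const_mul _

lemma bdIntegrable_localBdIntegrand (τ : T.Elem → T.Face → ℝ)
    (hβ : LipschitzOnWith C β K.closedDom) (lam : T.Skel) (t : VPoly d k × Poly d k) :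
    BdIntegrable K (localBdIntegrand β τ lam K t) := fun F hF => by
  refine F.integrable_mul ?_ (lam.integrable F)
  have h1 := (VPoly.continuous t.1).continuousOn (s := F.set)
  have h2 := (Poly.continuous t.2).continuousOn (s := F.set)
  have h3 := hβ.continuousOn.mono (Elem.set_subset_closedDom hF)
  fun_prop

/-- The bilinear form of the local problem as a bilinear map. -/
def localBilin (ε : ℝ) (τ : T.Elem → T.Face → ℝ) (hβ : LipschitzOnWith C β K.closedDom) :
    (VPoly d k × Poly d k) →ₗ[ℝ] (VPoly d k × Poly d k) →ₗ[ℝ] ℝ :=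
  LinearMap.mk₂ ℝ (localForm ε β τ K)
    (fun s s' t => by
      simp only [localForm, localIntegrand_add_left]
      rw [integral_add (integrableOn_localIntegrand ε hβ s t)
        (integrableOn_localIntegrand ε hβ s' t),
        bdInt_congr K (ψ := fun F x => τ K F * (s.2.1 x * t.2.1 x) + τ K F * (s'.2.1 x * t.2.1 x))
          (fun F x => by
            simp only [Prod.snd_add, Submodule.coe_add, Pi.add_apply]; ring),
        bdInt_add (bdIntegrable_mul_poly τ s.2 t.2) (bdIntegrable_mul_poly τ s'.2 t.2)]
      ring)
    (fun c s t => by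
      simp only [localForm, localIntegrand_smul_left]
      rw [integral_const_mul, bdInt_congr K (ψ := fun F x => c * (τ K F * (s.2.1 x * t.2.1 x)))
          (fun F x => by
            simp only [Prod.smul_snd, Submodule.coe_smul, Pi.smul_apply, smul_eq_mul]; ring),
        bdInt_const_mul, smul_eq_mul]
      ring)
    (fun s t t' => by
      simp only [localForm, localIntegrand_add_right]
      rw [integral_add (integrableOn_localIntegrand ε hβ s t)
        (integrableOn_localIntegrand ε hβ s t'),
        bdInt_congr K (ψ := fun F x => τ K F * (s.2.1 x * t.2.1 x) + τ K F * (s.2.1 x * t'.2.1 x))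
          (fun F x => by
            simp only [Prod.snd_add, Submodule.coe_add, Pi.add_apply]; ring),
        bdInt_add (bdIntegrable_mul_poly τ s.2 t.2) (bdIntegrable_mul_poly τ s.2 t'.2)]
      ring)
    (fun c s t => by
      simp only [localForm, localIntegrand_smul_right]
      rw [integral_const_mul, bdInt_congr K (ψ := fun F x => c * (τ K F * (s.2.1 x * t.2.1 x)))
          (fun F x => by
            simp only [Prod.smul_snd, Submodule.coe_smul, Pi.smul_apply, smul_eq_mul]; ring),
        bdInt_const_mul, smul_eq_mul]
      ring)

/-- The linear form of the local problem as a linear map. -/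
def localLin (τ : T.Elem → T.Face → ℝ) (hβ : LipschitzOnWith C β K.closedDom) (lam : T.Skel)
    (f : L2 Ω) : (VPoly d k × Poly d k) →ₗ[ℝ] ℝ where
  toFun := localRhs β τ lam f K
  map_add' t t' := by
    simp only [localRhs]
    have hf := fun t : VPoly d k × Poly d k =>
      K.integrable_mul (Poly.continuous t.2).continuousOn (K.integrableOn_L2 f)
    rw [bdInt_congr K (ψ := fun F x => localBdIntegrand β τ lam K t F x +
        localBdIntegrand β τ lam K t' F x) (fun F x => by
          simp only [localBdIntegrand, Prod.fst_add, Prod.snd_add, Submodule.coe_add,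
            Pi.add_apply, inner_add_left]; ring),
      bdInt_add (bdIntegrable_localBdIntegrand τ hβ lam t)
        (bdIntegrable_localBdIntegrand τ hβ lam t')]
    have : ∀ x, (t + t').2.1 x * f x = t.2.1 x * f x + t'.2.1 x * f x := fun x => by
      simp only [Prod.snd_add, Submodule.coe_add, Pi.add_apply]; ring
    simp only [this]
    rw [integral_add (hf t) (hf t')]
    ring
  map_smul' c t := by
    simp only [localRhs, RingHom.id_apply, smul_eq_mul]
    rw [bdInt_congr K (ψ := fun F x => c * localBdIntegrand β τ lam K t F x) (fun F x => by
          simp only [localBdIntegrand, Prod.smul_fst, Prod.smul_snd, Submodule.coe_smul,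
            Pi.smul_apply, real_inner_smul_left, smul_eq_mul]; ring), bdInt_const_mul]
    have : ∀ x, (c • t).2.1 x * f x = c * (t.2.1 x * f x) := fun x => by
      simp only [Prod.smul_snd, Submodule.coe_smul, Pi.smul_apply, smul_eq_mul]; ring
    simp only [this]
    rw [integral_const_mul]
    ring

/-- The two local equations, for all pairs of test functions. -/
lemma isLocalSolution_iff (ε : ℝ) (τ : T.Elem → T.Face → ℝ)
    (hβ : LipschitzOnWith C β K.closedDom) (lam : T.Skel) (f : L2 Ω)
    (s : VPoly d k × Poly d k) :
    T.IsLocalSolution k ε β τ lam f K s ↔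
      ∀ t : VPoly d k × Poly d k, localForm ε β τ K s t = localRhs β τ lam f K t := by
  have hq := (VPoly.continuous s.1)
  have hu := (Poly.continuous s.2)
  have hdq := (VPoly.continuous_divergence s.1)
  -- the two equations in terms of the bilinear form
  have h1 : ∀ r : VPoly d k, localForm ε β τ K s (r, 0) =
      (∫ x in K.dom, ε⁻¹ * inner ℝ (s.1.1 x) (r.1 x)) -
        ∫ x in K.dom, s.2.1 x * divergence r.1 x := by
    intro r
    have hr := (VPoly.continuous r)
    have hdr := (VPoly.continuous_divergence r)
    rw [← integral_sub (K.integrableOn (Continuous.continuousOn (by fun_prop)))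
      (K.integrableOn (Continuous.continuousOn (by fun_prop)))]
    have hg : gradient (0 : Euc d → ℝ) = 0 := by ext1 x; exact gradient_fun_const x 0
    simp [localForm, localIntegrand, bdInt, hg]
  have h2 : ∀ r : VPoly d k, localRhs β τ lam f K (r, 0) =
      - T.bdInt K (fun F x => lam F x * inner ℝ (r.1 x) (normal K.1 F.1)) := by
    intro r
    rw [neg_eq_neg_one_mul, ← bdInt_const_mul]
    simp only [localRhs, ZeroMemClass.coe_zero, Pi.zero_apply, zero_mul, integral_zero, zero_add]
    refine bdInt_congr K fun F x => ?_
    simp only [localBdIntegrand, ZeroMemClass.coe_zero, Pi.zero_apply]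
    ring
  have h3 : ∀ w : Poly d k, localForm ε β τ K s (0, w) =
      (∫ x in K.dom, divergence s.1.1 x * w.1 x)
      - (∫ x in K.dom, s.2.1 x * divergence (fun y => w.1 y • β y) x)
      + T.bdInt K (fun F x => τ K F * s.2.1 x * w.1 x) := by
    intro w
    have hw := (Poly.continuous w)
    -- The product rule holds only where `β` is differentiable. `localIntegrand` contains the
    -- expanded side, which is linear in the test function at every point; the two agree almost
    -- everywhere.
    have h : ∀ᵐ x ∂(volume.restrict K.dom), s.2.1 x * divergence (fun y => w.1 y • β y) x =
        s.2.1 x * (w.1 x * divergence β x + inner ℝ (β x) (gradient w.1 x)) := by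
      filter_upwards [Elem.ae_divergence_smul hβ (Poly.contDiff w.2)] with x hx
      rw [hx]
    rw [integral_congr_ae h, ← integral_sub (K.integrableOn (Continuous.continuousOn (by fun_prop)))
      (Elem.integrableOn_mul_convection hβ s.2 w)]
    simp only [localForm, localIntegrand, ZeroMemClass.coe_zero, Pi.zero_apply, inner_zero_right,
      divergence_zero, mul_zero, sub_zero, zero_add, mul_assoc]
  have h4 : ∀ w : Poly d k, localRhs β τ lam f K (0, w) =
      T.bdInt K (fun F x => (τ K F - inner ℝ (β x) (normal K.1 F.1)) * lam F x * w.1 x)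
        + ∫ x in K.dom, f x * w.1 x := by
    intro w
    simp only [localRhs, mul_comm (w.1 _) (f _)]
    rw [add_comm]
    congr 1
    refine bdInt_congr K fun F x => ?_
    simp only [localBdIntegrand, ZeroMemClass.coe_zero, Pi.zero_apply, inner_zero_left]
    ring
  constructor
  · rintro ⟨e1, e2⟩ ⟨r, w⟩
    have ht : ((r, w) : VPoly d k × Poly d k) = (r, 0) + (0, w) := by simp
    have hb := (localBilin ε τ hβ s).map_add (r, 0) (0, w)
    have hl := (localLin τ hβ lam f).map_add (r, 0) (0, w)
    change localForm ε β τ K s _ = localForm ε β τ K s _ + localForm ε β τ K s _ at hb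
    change localRhs β τ lam f K _ = localRhs β τ lam f K _ + localRhs β τ lam f K _ at hl
    rw [ht, hb, hl, h1, h2, h3, h4, e1, e2]
  · intro h
    refine ⟨fun r => ?_, fun w => ?_⟩
    · rw [← h1, ← h2, h]
    · rw [← h3, ← h4, h]

end Triangulation

end HDG

namespace HDG

open Module Filter Topology
open scoped ENNReal

/-! ### Elementwise identities -/

namespace Triangulation

variable {d k : ℕ} {Ω : Set (Euc d)} {T : Triangulation Ω} [NeZero d]
variable {β : Euc d → Euc d} {C : ℝ≥0} {K : T.Elem} {ε : ℝ} {τ : T.Elem → T.Face → ℝ}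

omit [NeZero d] in
lemma Elem.setIntegral_zero_mul (K : T.Elem) (w : Euc d → ℝ) :
    ∫ x in K.dom, (0 : L2 Ω) x * w x = 0 := by
  have h : ∀ᵐ x ∂(volume.restrict K.dom), (0 : L2 Ω) x = 0 :=
    ae_mono (Measure.restrict_mono K.dom_subset le_rfl) (Lp.coeFn_zero ℝ 2 (volume.restrict Ω))
  rw [integral_eq_zero_of_ae]
  filter_upwards [h] with x hx
  rw [hx, zero_mul, Pi.zero_apply]

omit [NeZero d] in
lemma Skel.zero_ae (T : Triangulation Ω) (F : T.Face) :
    ((0 : T.Skel) F : Euc d → ℝ) =ᵐ[faceMeasure F.1] 0 := Lp.coeFn_zero ℝ 2 (faceMeasure F.1)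

omit [NeZero d] in
lemma bdInt_eq_zero_of_ae {φ : T.Face → Euc d → ℝ}
    (h : ∀ F ∈ K.bd, φ F =ᵐ[faceMeasure F.1] 0) : T.bdInt K φ = 0 := by
  rw [bdInt_congr_ae K h]; simp [bdInt]

lemma Face.memLp_poly_sub (F : T.Face) (u : Poly d k) (lam : T.Skel) :
    MemLp (fun x => u.1 x - lam F x) 2 (faceMeasure F.1) := by
  refine MemLp.sub ?_ (Lp.memLp (lam F))
  obtain ⟨C, hC⟩ := F.isCompact_set.exists_bound_of_continuousOn (Poly.continuous u).continuousOn
  exact MemLp.of_bound (Poly.continuous u).aestronglyMeasurable C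
    ((ae_restrict_iff' F.isCompact_set.measurableSet).2 (Eventually.of_forall hC))

lemma bdIntegrable_normal_mul (hβ : LipschitzOnWith C β K.closedDom) (t : Poly d k)
    (lam : T.Skel) :
    BdIntegrable K fun F x => inner ℝ (β x) (normal K.1 F.1) * lam F x * t.1 x := fun F hF => by
  have h1 := (Poly.continuous t).continuousOn (s := F.set)
  have h2 := hβ.continuousOn.mono (Elem.set_subset_closedDom hF)
  have h3 := F.integrable_mul (φ := fun x => inner ℝ (β x) (normal K.1 F.1) * t.1 x)
    (by fun_prop) (lam.integrable F)
  exact h3.congr (Eventually.of_forall fun x => by ring)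

lemma bdIntegrable_jump_mul (s : Poly d k) (lam μ : T.Skel) :
    BdIntegrable K fun F x => τ K F * (s.1 x - lam F x) * μ F x := fun F hF =>
  (((F.memLp_poly_sub s lam).integrable_mul (Lp.memLp (μ F))).const_mul (τ K F)).congr
    (Eventually.of_forall fun x => by simp only [Pi.mul_apply]; ring)

lemma bdIntegrable_jump_mul_jump (s t : Poly d k) (lam μ : T.Skel) :
    BdIntegrable K fun F x => τ K F * (s.1 x - lam F x) * (t.1 x - μ F x) := fun F hF =>
  (((F.memLp_poly_sub s lam).integrable_mul (F.memLp_poly_sub t μ)).const_mul (τ K F)).congr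
    (Eventually.of_forall fun x => by simp only [Pi.mul_apply]; ring)

lemma bdIntegrable_localData (hβ : LipschitzOnWith C β K.closedDom) (t : Poly d k)
    (lam : T.Skel) : BdIntegrable K fun F x =>
      (τ K F - inner ℝ (β x) (normal K.1 F.1)) * lam F x * t.1 x := fun F hF => by
  have h1 := (Poly.continuous t).continuousOn (s := F.set)
  have h2 := hβ.continuousOn.mono (Elem.set_subset_closedDom hF)
  have h3 := F.integrable_mul (φ := fun x => (τ K F - inner ℝ (β x) (normal K.1 F.1)) * t.1 x)
    (by fun_prop) (lam.integrable F)
  exact h3.congr (Eventually.of_forall fun x => by ring)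

/-- The contribution of an element to the form `a_h`. -/
lemma elem_aForm_eq (hβ : LipschitzOnWith C β K.closedDom) {lam μ : T.Skel}
    {s t : VPoly d k × Poly d k} (hs : T.IsLocalSolution k ε β τ lam 0 K s)
    (ht : T.IsLocalSolution k ε β τ μ 0 K t) :
    - T.bdInt K (fun F x => inner ℝ (s.1.1 x) (normal K.1 F.1) * μ F x)
      - T.bdInt K (fun F x => τ K F * (s.2.1 x - lam F x) * μ F x) =
    (∫ x in K.dom, ε⁻¹ * inner ℝ (s.1.1 x) (t.1.1 x))
      - (∫ x in K.dom, s.2.1 x * divergence (fun y => t.2.1 y • β y) x)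
      + T.bdInt K (fun F x => inner ℝ (β x) (normal K.1 F.1) * lam F x * t.2.1 x)
      + T.bdInt K (fun F x => τ K F * (s.2.1 x - lam F x) * (t.2.1 x - μ F x)) := by
  -- The flux equation for `μ` is tested with `q^λ` and the scalar equation for `λ` with `u^μ`; the
  -- term `(∇·q^λ, u^μ)` occurs in both and is eliminated.
  have e1 := ht.1 s.1
  have e2 := hs.2 t.2
  rw [K.setIntegral_zero_mul, add_zero] at e2
  have c1 : ∫ x in K.dom, t.2.1 x * divergence s.1.1 x =
      ∫ x in K.dom, divergence s.1.1 x * t.2.1 x := by simp only [mul_comm]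
  have c2 : T.bdInt K (fun F x => μ F x * inner ℝ (s.1.1 x) (normal K.1 F.1)) =
      T.bdInt K (fun F x => inner ℝ (s.1.1 x) (normal K.1 F.1) * μ F x) := by simp only [mul_comm]
  have c3 : ∫ x in K.dom, ε⁻¹ * inner ℝ (t.1.1 x) (s.1.1 x) =
      ∫ x in K.dom, ε⁻¹ * inner ℝ (s.1.1 x) (t.1.1 x) := by simp only [real_inner_comm]
  have hst : BdIntegrable K fun F x => τ K F * s.2.1 x * t.2.1 x :=
    (bdIntegrable_mul_poly τ s.2 t.2).congr fun F x => by ring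
  have c4 : T.bdInt K (fun F x => inner ℝ (β x) (normal K.1 F.1) * lam F x * t.2.1 x)
      + T.bdInt K (fun F x => τ K F * (s.2.1 x - lam F x) * (t.2.1 x - μ F x)) =
      T.bdInt K (fun F x => τ K F * s.2.1 x * t.2.1 x)
      - T.bdInt K (fun F x => (τ K F - inner ℝ (β x) (normal K.1 F.1)) * lam F x * t.2.1 x)
      - T.bdInt K (fun F x => τ K F * (s.2.1 x - lam F x) * μ F x) := by
    rw [← bdInt_add (bdIntegrable_normal_mul hβ t.2 lam)
        (bdIntegrable_jump_mul_jump s.2 t.2 lam μ),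
      ← bdInt_sub hst (bdIntegrable_localData hβ t.2 lam),
      ← bdInt_sub (hst.sub (bdIntegrable_localData hβ t.2 lam))
        (bdIntegrable_jump_mul s.2 lam μ)]
    exact bdInt_congr K fun F x => by ring
  rw [c1, c2, c3] at e1
  linarith

/-- The contribution of an element to the form `b_h`. -/
lemma elem_bForm_eq (hβ : LipschitzOnWith C β K.closedDom) {μ : T.Skel} {f : L2 Ω}
    {s t : VPoly d k × Poly d k} (hs : T.IsLocalSolution k ε β τ 0 f K s)
    (ht : T.IsLocalSolution k ε β τ μ 0 K t) :
    T.bdInt K (fun F x => inner ℝ (s.1.1 x) (normal K.1 F.1) * μ F x)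
      + T.bdInt K (fun F x => τ K F * s.2.1 x * μ F x) =
    (∫ x in K.dom, f x * t.2.1 x)
      + T.bdInt K (fun F x => inner ℝ (β x) (normal K.1 F.1) * s.2.1 x * μ F x)
      + (∫ x in K.dom, s.2.1 x * inner ℝ (β x) (gradient t.2.1 x))
      - ∫ x in K.dom, inner ℝ (gradient s.2.1 x) (t.2.1 x • β x) := by
  -- The four local equations are tested against each other: the terms in `q^f·q^μ`, `(∇·q) u` and
  -- `τ u^f u^μ` each occur twice and cancel, leaving the data and the skew part of the convection.
  have e1 := ht.1 s.1
  have e2 := hs.1 t.1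
  have e3 := hs.2 t.2
  have e4 := ht.2 s.2
  rw [K.setIntegral_zero_mul, add_zero] at e4
  have z1 : T.bdInt K (fun F x => (0 : T.Skel) F x * inner ℝ (t.1.1 x) (normal K.1 F.1)) = 0 :=
    bdInt_eq_zero_of_ae fun F _ => by
      filter_upwards [Skel.zero_ae T F] with x hx; rw [hx]; simp
  have z2 : T.bdInt K (fun F x =>
      (τ K F - inner ℝ (β x) (normal K.1 F.1)) * (0 : T.Skel) F x * t.2.1 x) = 0 :=
    bdInt_eq_zero_of_ae fun F _ => by
      filter_upwards [Skel.zero_ae T F] with x hx; rw [hx]; simp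
  rw [z1] at e2
  rw [z2] at e3
  have c1 : ∫ x in K.dom, t.2.1 x * divergence s.1.1 x =
      ∫ x in K.dom, divergence s.1.1 x * t.2.1 x := by simp only [mul_comm]
  have c2 : T.bdInt K (fun F x => μ F x * inner ℝ (s.1.1 x) (normal K.1 F.1)) =
      T.bdInt K (fun F x => inner ℝ (s.1.1 x) (normal K.1 F.1) * μ F x) := by simp only [mul_comm]
  have c3 : ∫ x in K.dom, ε⁻¹ * inner ℝ (t.1.1 x) (s.1.1 x) =
      ∫ x in K.dom, ε⁻¹ * inner ℝ (s.1.1 x) (t.1.1 x) := by simp only [real_inner_comm]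
  have c4 : ∫ x in K.dom, s.2.1 x * divergence t.1.1 x =
      ∫ x in K.dom, divergence t.1.1 x * s.2.1 x := by simp only [mul_comm]
  have c5 : T.bdInt K (fun F x => τ K F * s.2.1 x * t.2.1 x) =
      T.bdInt K (fun F x => τ K F * t.2.1 x * s.2.1 x) :=
    bdInt_congr K fun F x => by ring
  have hb1 : BdIntegrable K fun F x => inner ℝ (β x) (normal K.1 F.1) * s.2.1 x * μ F x :=
    (bdIntegrable_normal_mul hβ s.2 μ).congr fun F x => by ring
  have hb2 : BdIntegrable K fun F x => τ K F * s.2.1 x * μ F x := fun F hF => by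
    have h1 := (Poly.continuous s.2).continuousOn (s := F.set)
    exact F.integrable_mul (φ := fun x => τ K F * s.2.1 x) (by fun_prop) (μ.integrable F)
  have c6 : T.bdInt K (fun F x => (τ K F - inner ℝ (β x) (normal K.1 F.1)) * μ F x * s.2.1 x) =
      T.bdInt K (fun F x => τ K F * s.2.1 x * μ F x) -
      T.bdInt K (fun F x => inner ℝ (β x) (normal K.1 F.1) * s.2.1 x * μ F x) := by
    rw [← bdInt_sub hb2 hb1]
    exact bdInt_congr K fun F x => by ring
  -- the product rule
  have hi : ∀ u w : Poly d k, IntegrableOn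
      (fun x => u.1 x * divergence (fun y => w.1 y • β y) x) K.dom := fun u w => by
    refine (Elem.integrableOn_mul_convection hβ u w).congr ?_
    filter_upwards [Elem.ae_divergence_smul hβ (Poly.contDiff w.2)] with x hx
    rw [hx]
  have hj : ∀ u w : Poly d k, IntegrableOn
      (fun x => u.1 x * inner ℝ (β x) (gradient w.1 x)) K.dom := fun u w => by
    have h1 := (Poly.continuous u).continuousOn (s := K.closedDom)
    have h2 := (Poly.continuous_gradient w).continuousOn (s := K.closedDom)
    have h3 := hβ.continuousOn
    exact K.integrableOn (by fun_prop)
  -- After exchanging the roles of `u^f` and `u^μ` and subtracting, the products with `∇·β` cancel.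
  have c7 : (∫ x in K.dom, s.2.1 x * divergence (fun y => t.2.1 y • β y) x) -
      (∫ x in K.dom, t.2.1 x * divergence (fun y => s.2.1 y • β y) x) =
      (∫ x in K.dom, s.2.1 x * inner ℝ (β x) (gradient t.2.1 x)) -
      ∫ x in K.dom, inner ℝ (gradient s.2.1 x) (t.2.1 x • β x) := by
    have c8 : ∫ x in K.dom, inner ℝ (gradient s.2.1 x) (t.2.1 x • β x) =
        ∫ x in K.dom, t.2.1 x * inner ℝ (β x) (gradient s.2.1 x) := by
      simp only [real_inner_smul_right, real_inner_comm]
    rw [c8, ← integral_sub (hi s.2 t.2) (hi t.2 s.2), ← integral_sub (hj s.2 t.2) (hj t.2 s.2)]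
    refine integral_congr_ae ?_
    filter_upwards [Elem.ae_divergence_smul hβ (Poly.contDiff t.2.2),
      Elem.ae_divergence_smul hβ (Poly.contDiff s.2.2)] with x h1 h2
    rw [h1, h2]; ring
  rw [c1, c2, c3] at e1
  rw [c4] at e2
  rw [c5] at e3
  rw [c6] at e4
  linarith

/-- Integration by parts on an element. -/
lemma Elem.integral_by_parts (K : T.Elem) (u : Poly d k) (r : VPoly d k) :
    (∫ x in K.dom, u.1 x * divergence r.1 x) + ∫ x in K.dom, inner ℝ (r.1 x) (gradient u.1 x) =
      T.bdInt K (fun F x => u.1 x * inner ℝ (r.1 x) (normal K.1 F.1)) := by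
  have h1 := Poly.continuous u
  have h2 := VPoly.continuous r
  have h3 := VPoly.continuous_divergence r
  have h4 := Poly.continuous_gradient u
  obtain ⟨C, hC⟩ := K.exists_lipschitzOnWith_of_contDiff
    ((Poly.contDiff u.2).smul (VPoly.contDiff r.2))
  have h := K.setIntegral_divergence hC
  rw [← integral_add (K.integrableOn (Continuous.continuousOn (by fun_prop)))
    (K.integrableOn (Continuous.continuousOn (by fun_prop)))]
  have e : ∀ x, divergence (fun y => u.1 y • r.1 y) x =
      u.1 x * divergence r.1 x + inner ℝ (r.1 x) (gradient u.1 x) := fun x =>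
    divergence_smul ((Poly.contDiff u.2).differentiable (by norm_num) x)
      ((VPoly.contDiff r.2).differentiable (by norm_num) x)
  simp only [← e]
  refine h.trans (bdInt_congr K fun F x => ?_)
  rw [← real_inner_smul_left]
  rfl

/-- The energy identity on an element. -/
lemma elem_energy (hβ : LipschitzOnWith C β K.closedDom) (u : Poly d k) (lam : T.Skel) :
    - (∫ x in K.dom, u.1 x * divergence (fun y => u.1 y • β y) x)
      + T.bdInt K (fun F x => inner ℝ (β x) (normal K.1 F.1) * lam F x * u.1 x)
      + T.bdInt K (fun F x => τ K F * (u.1 x - lam F x) * (u.1 x - lam F x)) =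
    (∫ x in K.dom, (1 / 2) * (u.1 x * u.1 x * -divergence β x))
      + T.bdInt K (fun F x => (τ K F - (1 / 2) * inner ℝ (β x) (normal K.1 F.1)) *
          ((u.1 x - lam F x) * (u.1 x - lam F x)))
      + (1 / 2) * T.bdInt K (fun F x =>
          inner ℝ ((lam F x * lam F x) • β x) (normal K.1 F.1)) := by
  have hu := Poly.contDiff u.2
  have huc := Poly.continuous u
  have hgc := Poly.continuous_gradient u
  obtain ⟨C', hC'⟩ := K.exists_lipschitzOnWith_of_contDiff (hu.mul hu)
  obtain ⟨C'', hC''⟩ := LipschitzOnWith.exists_smul K.isCompact_closedDom hC' hβ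
  -- Half of this identity for `u²β` is combined with the expansion of `u ∇·(uβ)`: the terms `u
  -- β·∇u` cancel, which leaves `-½ (∇·β) u²` in the element and `½ β·n u²` on its boundary.
  have hgauss := K.setIntegral_divergence hC''
  have hi : IntegrableOn (fun x => u.1 x * u.1 x * divergence β x) K.dom :=
    K.integrable_mul (huc.mul huc).continuousOn (Elem.integrableOn_divergence hβ)
  have hj : IntegrableOn (fun x => u.1 x * inner ℝ (β x) (gradient u.1 x)) K.dom := by
    have h1 := huc.continuousOn (s := K.closedDom)
    have h2 := hgc.continuousOn (s := K.closedDom)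
    have h3 := hβ.continuousOn
    exact K.integrableOn (by fun_prop)
  have v1 : ∫ x in K.dom, u.1 x * divergence (fun y => u.1 y • β y) x =
      (∫ x in K.dom, u.1 x * u.1 x * divergence β x) +
        ∫ x in K.dom, u.1 x * inner ℝ (β x) (gradient u.1 x) := by
    rw [← integral_add hi hj]
    refine integral_congr_ae ?_
    filter_upwards [Elem.ae_divergence_smul hβ hu] with x hx
    rw [hx]; ring
  have v2 : ∫ x in K.dom, divergence (fun y => (u.1 y * u.1 y) • β y) x =
      (∫ x in K.dom, u.1 x * u.1 x * divergence β x) +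
        2 * ∫ x in K.dom, u.1 x * inner ℝ (β x) (gradient u.1 x) := by
    rw [← integral_const_mul, ← integral_add hi (hj.const_mul 2)]
    refine integral_congr_ae ?_
    filter_upwards [Elem.ae_divergence_smul hβ (hu.mul hu)] with x hx
    have hd := hu.differentiable (by norm_num) x
    rw [hx, inner_gradient, inner_gradient, fderiv_fun_mul hd hd]
    simp only [add_apply, smul_apply, smul_eq_mul]
    ring
  have v3 : ∫ x in K.dom, (1 / 2) * (u.1 x * u.1 x * -divergence β x) =
      -(1 / 2) * ∫ x in K.dom, u.1 x * u.1 x * divergence β x := by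
    rw [← integral_const_mul]
    exact integral_congr_ae (Eventually.of_forall fun x => by ring)
  have hcβ : ∀ F ∈ K.bd, ContinuousOn β F.set := fun F hF =>
    hβ.continuousOn.mono (Elem.set_subset_closedDom hF)
  have b1 := bdIntegrable_normal_mul hβ u lam
  have b2 : BdIntegrable K fun F x => τ K F * (u.1 x - lam F x) * (u.1 x - lam F x) :=
    bdIntegrable_jump_mul_jump u u lam lam
  have b3 : BdIntegrable K fun F x => (τ K F - (1 / 2) * inner ℝ (β x) (normal K.1 F.1)) *
      ((u.1 x - lam F x) * (u.1 x - lam F x)) := fun F hF => by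
    have := hcβ F hF
    exact F.integrable_mul (by fun_prop)
      ((F.memLp_poly_sub u lam).integrable_mul (F.memLp_poly_sub u lam))
  have b4 : BdIntegrable K fun F x => inner ℝ ((lam F x * lam F x) • β x) (normal K.1 F.1) :=
    fun F hF => by
      have := hcβ F hF
      refine (F.integrable_mul (φ := fun x => inner ℝ (β x) (normal K.1 F.1)) (by fun_prop)
        (lam.integrable_mul lam F)).congr (Eventually.of_forall fun x => ?_)
      simp only [real_inner_smul_left]; ring
  have b5 : BdIntegrable K fun F x => inner ℝ ((u.1 x * u.1 x) • β x) (normal K.1 F.1) :=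
    fun F hF => by
      have := hcβ F hF
      have := huc.continuousOn (s := F.set)
      exact F.integrable (by fun_prop)
  -- Pointwise completion of the square: `β·n λu = -½ β·n (u - λ)² + ½ β·n λ² + ½ β·n u²`.
  have key : T.bdInt K (fun F x => inner ℝ (β x) (normal K.1 F.1) * lam F x * u.1 x)
      + T.bdInt K (fun F x => τ K F * (u.1 x - lam F x) * (u.1 x - lam F x)) =
      T.bdInt K (fun F x => (τ K F - (1 / 2) * inner ℝ (β x) (normal K.1 F.1)) *
          ((u.1 x - lam F x) * (u.1 x - lam F x)))
      + (1 / 2) * T.bdInt K (fun F x => inner ℝ ((lam F x * lam F x) • β x) (normal K.1 F.1))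
      + (1 / 2) * T.bdInt K (fun F x => inner ℝ ((u.1 x * u.1 x) • β x) (normal K.1 F.1)) := by
    rw [← bdInt_const_mul, ← bdInt_const_mul, ← bdInt_add b1 b2,
      ← bdInt_add b3 (b4.const_mul fun _ => 1 / 2),
      ← bdInt_add (b3.add (b4.const_mul fun _ => 1 / 2)) (b5.const_mul fun _ => 1 / 2)]
    refine bdInt_congr K fun F x => ?_
    simp only [real_inner_smul_left]
    ring
  rw [v2] at hgauss
  rw [v1, v3]
  linarith

end Triangulation

end HDG

namespace HDG

open Module Filter Topology
open scoped ENNReal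

/-! ### Unique solvability of the local problems -/

namespace Triangulation

variable {d k : ℕ} {Ω : Set (Euc d)} {T : Triangulation Ω} [NeZero d]
variable {β : Euc d → Euc d} {C : ℝ≥0} {K : T.Elem} {ε : ℝ} {τ : T.Elem → T.Face → ℝ}

/-- If the flux vanishes and the scalar unknown agrees with its trace on one face, then the scalar
unknown is constant and agrees with its trace on all faces. -/
theorem const_and_trace_eq {u : Poly d k} {lam : T.Skel}
    (hpoly : ∀ F ∈ K.bd, ∃ p ∈ Poly d k, lam F =ᵐ[faceMeasure F.1] p)
    (hflux : ∀ r : VPoly d k, ∫ x in K.dom, u.1 x * divergence r.1 x =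
      T.bdInt K (fun F x => lam F x * inner ℝ (r.1 x) (normal K.1 F.1)))
    {F₀ : T.Face} (hF₀ : F₀ ∈ K.bd) (h₀ : ∀ᵐ x ∂(faceMeasure F₀.1), lam F₀ x = u.1 x) :
    (∃ c, u.1 = fun _ => c) ∧ ∀ F ∈ K.bd, ∀ᵐ x ∂(faceMeasure F.1), lam F x = u.1 x := by
  classical
  obtain ⟨v, rfl⟩ := Elem.exists_face_eq hF₀
  set b := K.basis with hb
  have hu := Poly.contDiff u.2
  -- testing with a multiple of an edge of the element
  have key : ∀ i, i ≠ v → ∀ φ : Poly d k, ∫ x in K.dom, φ.1 x * fderiv ℝ u.1 x (b i - b v) =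
      -‖baryGrad b i‖⁻¹ * ∫ x, (u.1 x - lam (K.face i) x) * φ.1 x ∂(faceMeasure (K.face i).1) := by
    intro i hi φ
    set r : VPoly d k := ⟨fun x => φ.1 x • (b i - b v), VPoly.smul_const_mem φ.2 _⟩ with hr
    have h1 := K.integral_by_parts u r
    rw [hflux r] at h1
    have i1 : BdIntegrable K fun F x => lam F x * inner ℝ (r.1 x) (normal K.1 F.1) :=
      fun F _ => by
        have := VPoly.continuous r
        exact (F.integrable_mul (φ := fun x => inner ℝ (r.1 x) (normal K.1 F.1))
          (Continuous.continuousOn (by fun_prop)) (lam.integrable F)).congr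
          (Eventually.of_forall fun x => mul_comm _ _)
    have i2 : BdIntegrable K fun F x => u.1 x * inner ℝ (r.1 x) (normal K.1 F.1) :=
      fun F _ => by
        have := VPoly.continuous r
        have := Poly.continuous u
        exact F.integrable (Continuous.continuousOn (by fun_prop))
    have h2 : ∫ x in K.dom, inner ℝ (r.1 x) (gradient u.1 x) = T.bdInt K (fun F x =>
        u.1 x * inner ℝ (r.1 x) (normal K.1 F.1) - lam F x * inner ℝ (r.1 x) (normal K.1 F.1)) := by
      rw [bdInt_sub i2 i1]; linarith
    have h3 : ∫ x in K.dom, inner ℝ (r.1 x) (gradient u.1 x) =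
        ∫ x in K.dom, φ.1 x * fderiv ℝ u.1 x (b i - b v) := by
      refine integral_congr_ae (Eventually.of_forall fun x => ?_)
      simp only [inner_gradient, hr, map_smul, smul_eq_mul]
    -- The edge `b i - b v` is tangent to all faces except those opposite to `i` and to `v`. On the
    -- latter the trace already agrees with `u`, so only face `i` contributes.
    rw [← h3, h2, bdInt, K.sum_bd, Finset.sum_eq_single i]
    · rw [← integral_const_mul]
      refine integral_congr_ae (Eventually.of_forall fun x => ?_)
      simp only [hr, K.normal_face, real_inner_smul_left, real_inner_smul_right]
      rw [real_inner_comm, inner_baryGrad_edge_left b hi]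
      ring
    · intro j _ hj
      refine integral_eq_zero_of_ae ?_
      by_cases hjv : j = v
      · subst hjv
        filter_upwards [h₀] with x hx
        rw [hx, sub_self]; rfl
      · refine Eventually.of_forall fun x => ?_
        simp only [hr, K.normal_face, real_inner_smul_left, real_inner_smul_right]
        rw [real_inner_comm, inner_baryGrad_edge_of_ne b hj hjv]
        simp
    · exact fun h => absurd (Finset.mem_univ _) h
  -- the derivatives along the edges vanish
  have hedge : ∀ i, i ≠ v → ∀ x, fderiv ℝ u.1 x (b i - b v) = 0 := by
    intro i hi
    set l : Euc d → ℝ := fun x => inner ℝ (baryGrad b i) x + b.coord i 0 with hl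
    have hl1 : l ∈ Poly d 1 := Poly.inner_add_const_mem _ _
    have hle : ∀ x, l x = b.coord i x := fun x => (coord_eq_inner b i x).symm
    have hDc : Continuous fun x => fderiv ℝ u.1 x (b i - b v) :=
      (hu.continuous_fderiv (by norm_num)).clm_apply continuous_const
    -- The test function is the edge derivative of `u` times the coordinate of `i`. This weight is
    -- positive inside the element and zero on face `i`, so the face term disappears and the
    -- weighted square of the derivative integrates to zero. The degree remains at most `k` because
    -- the derivative has lost one.
    have h1 := key i hi ⟨_, Poly.mul_fderiv_mem u.2 hl1 (b i - b v)⟩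
    have h2 : ∫ x, (u.1 x - lam (K.face i) x) * (l x * fderiv ℝ u.1 x (b i - b v))
        ∂(faceMeasure (K.face i).1) = 0 := by
      refine integral_eq_zero_of_ae ?_
      have hmem : ∀ᵐ x ∂(faceMeasure (K.face i).1), x ∈ (K.face i).set :=
        ae_restrict_mem (K.face i).isCompact_set.measurableSet
      filter_upwards [hmem] with x hx
      rw [K.set_face] at hx
      rw [hle, hx.2, zero_mul, mul_zero, Pi.zero_apply]
    rw [h2, mul_zero] at h1
    have hint : IntegrableOn (fun x => l x * fderiv ℝ u.1 x (b i - b v) *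
        fderiv ℝ u.1 x (b i - b v)) K.dom := by
      have := (Poly.contDiff hl1).continuous
      exact K.integrableOn (Continuous.continuousOn (by fun_prop))
    have hpos : ∀ x ∈ K.dom, 0 < l x := by
      intro x hx
      rw [K.dom_eq, Elem.closedDom, interior_simplexSet] at hx
      rw [hle]; exact hx i
    have hnn : 0 ≤ᵐ[volume.restrict K.dom] fun x => l x * fderiv ℝ u.1 x (b i - b v) *
        fderiv ℝ u.1 x (b i - b v) := by
      filter_upwards [ae_restrict_mem K.isOpen_dom.measurableSet] with x hx
      rw [mul_assoc]
      exact mul_nonneg (hpos x hx).le (mul_self_nonneg _)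
    have h3 := (integral_eq_zero_iff_of_nonneg_ae hnn hint).1 h1
    have h4 := Poly.eq_zero_of_ae (f := fun x => l x * fderiv ℝ u.1 x (b i - b v))
      (Poly.mul_fderiv_mem u.2 hl1 (b i - b v)) K.isOpen_dom K.dom_nonempty (by
        filter_upwards [h3, ae_restrict_mem K.isOpen_dom.measurableSet] with x hx hxd
        have h5 := hpos x hxd
        rw [Pi.zero_apply, mul_assoc] at hx
        have h6 := (mul_eq_zero.1 hx).resolve_left h5.ne'
        rw [mul_self_eq_zero.1 h6, mul_zero, Pi.zero_apply])
    -- the derivative vanishes on the element, hence everywhere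
    have h5 : (fun x => fderiv ℝ u.1 x (b i - b v)) ∈ Poly d k := by
      have := Poly.mul_fderiv_mem u.2 (Poly.const_mem (d := d) (k := 1) 1) (b i - b v)
      simpa using this
    have h6 := Poly.eq_zero_of_ae h5 K.isOpen_dom K.dom_nonempty (by
      filter_upwards [ae_restrict_mem K.isOpen_dom.measurableSet] with x hxd
      exact (mul_eq_zero.1 (congrFun h4 x)).resolve_left (hpos x hxd).ne')
    exact fun x => congrFun h6 x
  have hconst : ∃ c, u.1 = fun _ => c := by
    refine ⟨u.1 0, funext fun x => ?_⟩
    refine is_const_of_fderiv_eq_zero (𝕜 := ℝ) (hu.differentiable (by norm_num)) (fun y => ?_) x 0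
    ext e
    rw [← sum_inner_baryGrad_smul b e]
    have h1 : ∑ i, (inner ℝ (baryGrad b i) e : ℝ) • b i =
        ∑ i, (inner ℝ (baryGrad b i) e : ℝ) • (b i - b v) := by
      simp only [smul_sub, Finset.sum_sub_distrib]
      rw [← Finset.sum_smul, ← sum_inner, sum_baryGrad, inner_zero_left, zero_smul, sub_zero]
    rw [h1, map_sum]
    refine Finset.sum_eq_zero fun i _ => ?_
    rw [map_smul]
    by_cases hi : i = v
    · rw [hi, sub_self, map_zero, smul_zero]
    · rw [hedge i hi, smul_zero]
  refine ⟨hconst, fun F hF => ?_⟩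
  obtain ⟨i, rfl⟩ := Elem.exists_face_eq hF
  by_cases hi : i = v
  · rw [hi]; exact h₀
  obtain ⟨p, hp, hlp⟩ := hpoly _ hF
  -- Now that the volume term is zero, the jump itself may serve as test function; this is where the
  -- trace has to be a polynomial on the face.
  have h1 := key i hi (u - ⟨p, hp⟩)
  simp only [hedge i hi, mul_zero, integral_zero] at h1
  have hne : -‖baryGrad b i‖⁻¹ ≠ 0 :=
    neg_ne_zero.2 (inv_ne_zero (norm_ne_zero_iff.2 (baryGrad_ne_zero b i)))
  have h2 := (mul_eq_zero.1 h1.symm).resolve_left hne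
  have h3 : ∫ x, (u.1 x - lam (K.face i) x) * (u - ⟨p, hp⟩ : Poly d k).1 x
      ∂(faceMeasure (K.face i).1) = ∫ x, (u.1 x - lam (K.face i) x) * (u.1 x - lam (K.face i) x)
      ∂(faceMeasure (K.face i).1) := by
    refine integral_congr_ae ?_
    filter_upwards [hlp] with x hx
    rw [hx]; rfl
  rw [h3] at h2
  have hi2 := ((K.face i).memLp_poly_sub u lam).integrable_mul ((K.face i).memLp_poly_sub u lam)
  have h4 := (integral_eq_zero_iff_of_nonneg (fun x => mul_self_nonneg _) hi2).1 h2
  filter_upwards [h4] with x hx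
  linarith [mul_self_eq_zero.1 hx]

/-- The energy of a local solution. -/
def elemEnergy (ε : ℝ) (β : Euc d → Euc d) (τ : T.Elem → T.Face → ℝ) (K : T.Elem)
    (s : VPoly d k × Poly d k) (lam : T.Skel) : ℝ :=
  (∫ x in K.dom, ε⁻¹ * inner ℝ (s.1.1 x) (s.1.1 x))
    + (∫ x in K.dom, (1 / 2) * (s.2.1 x * s.2.1 x * -divergence β x))
    + T.bdInt K (fun F x => (τ K F - (1 / 2) * inner ℝ (β x) (normal K.1 F.1)) *
          ((s.2.1 x - lam F x) * (s.2.1 x - lam F x)))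

/-! ### Positivity of the element energy and unique local solvability -/

section positivity

variable (hε : 0 < ε) (hβ : LipschitzOnWith C β K.closedDom)
  (hdiv : ∀ᵐ x ∂(volume.restrict Ω), 0 ≤ - divergence β x) (hτ : T.IsAdmissible β τ)
include hε hβ hdiv hτ

omit hβ in
omit [NeZero d] in
lemma elemEnergy_terms_nonneg (s : VPoly d k × Poly d k) (lam : T.Skel) :
    0 ≤ ∫ x in K.dom, ε⁻¹ * inner ℝ (s.1.1 x) (s.1.1 x) ∧
    0 ≤ ∫ x in K.dom, (1 / 2) * (s.2.1 x * s.2.1 x * -divergence β x) ∧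
    ∀ F ∈ K.bd, 0 ≤ ∫ x, (τ K F - (1 / 2) * inner ℝ (β x) (normal K.1 F.1)) *
          ((s.2.1 x - lam F x) * (s.2.1 x - lam F x)) ∂(faceMeasure F.1) := by
  refine ⟨integral_nonneg fun x => ?_, integral_nonneg_of_ae ?_, fun F hF => ?_⟩
  · exact mul_nonneg (inv_nonneg.2 hε.le) real_inner_self_nonneg
  · filter_upwards [ae_mono (Measure.restrict_mono K.dom_subset le_rfl) hdiv] with x hx
    exact mul_nonneg (by norm_num) (mul_nonneg (mul_self_nonneg _) hx)
  · exact setIntegral_nonneg F.isCompact_set.measurableSet fun x hx =>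
      mul_nonneg (((hτ K).1 F hF).2 x hx) (mul_self_nonneg _)

omit hβ in
omit [NeZero d] in
lemma elemEnergy_nonneg (s : VPoly d k × Poly d k) (lam : T.Skel) :
    0 ≤ elemEnergy ε β τ K s lam := by
  obtain ⟨h1, h2, h3⟩ := elemEnergy_terms_nonneg hε hdiv hτ s lam
  exact add_nonneg (add_nonneg h1 h2) (Finset.sum_nonneg h3)

/-- All terms are nonnegative, so each one vanishes. The face weight is known to be positive on one
face only, so agreement with the trace is obtained there and nowhere else; `const_and_trace_eq`
takes care of the other faces. -/
lemma eq_of_elemEnergy_eq_zero {s : VPoly d k × Poly d k} {lam : T.Skel}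
    (h : elemEnergy ε β τ K s lam = 0) :
    s.1 = 0 ∧ ∃ F ∈ K.bd, ∀ᵐ x ∂(faceMeasure F.1), lam F x = s.2.1 x := by
  obtain ⟨h1, h2, h3⟩ := elemEnergy_terms_nonneg hε hdiv hτ s lam
  have h4 : 0 ≤ T.bdInt K (fun F x => (τ K F - (1 / 2) * inner ℝ (β x) (normal K.1 F.1)) *
      ((s.2.1 x - lam F x) * (s.2.1 x - lam F x))) := Finset.sum_nonneg h3
  unfold elemEnergy at h
  constructor
  · have h5 : ∫ x in K.dom, ε⁻¹ * inner ℝ (s.1.1 x) (s.1.1 x) = 0 := by linarith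
    have hc := VPoly.continuous s.1
    have h6 := (integral_eq_zero_iff_of_nonneg
      (fun x => mul_nonneg (inv_nonneg.2 hε.le) real_inner_self_nonneg)
      (K.integrableOn (continuous_const.mul (hc.inner hc)).continuousOn)).1 h5
    refine Subtype.ext (VPoly.eq_zero_of_ae s.1.2 K.isOpen_dom K.dom_nonempty ?_)
    filter_upwards [h6] with x hx
    exact inner_self_eq_zero.1 ((mul_eq_zero.1 hx).resolve_left (inv_ne_zero hε.ne'))
  · have h5 : T.bdInt K (fun F x => (τ K F - (1 / 2) * inner ℝ (β x) (normal K.1 F.1)) *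
      ((s.2.1 x - lam F x) * (s.2.1 x - lam F x))) = 0 := by linarith
    obtain ⟨F, hF, hpos⟩ := (hτ K).2
    refine ⟨F, hF, ?_⟩
    have h6 := (Finset.sum_eq_zero_iff_of_nonneg h3).1 h5 F hF
    have hmem : ∀ᵐ x ∂(faceMeasure F.1), x ∈ F.set :=
      ae_restrict_mem F.isCompact_set.measurableSet
    have hcβ := hβ.continuousOn.mono (Elem.set_subset_closedDom hF)
    have h7 := (integral_eq_zero_iff_of_nonneg_ae (by
      filter_upwards [hmem] with x hx
      exact mul_nonneg (hpos x hx).le (mul_self_nonneg _))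
      (F.integrable_mul (by fun_prop)
        ((F.memLp_poly_sub s.2 lam).integrable_mul (F.memLp_poly_sub s.2 lam)))).1 h6
    filter_upwards [h7, hmem] with x hx hxF
    have h8 := (mul_eq_zero.1 hx).resolve_left (hpos x hxF).ne'
    linarith [mul_self_eq_zero.1 h8]

/-- The homogeneous local problem has only the trivial solution. -/
lemma eq_zero_of_isLocalSolution {s : VPoly d k × Poly d k}
    (hs : T.IsLocalSolution k ε β τ 0 0 K s) : s = 0 := by
  -- The solution is tested with itself. All terms containing the zero trace drop out, so that the
  -- energy is zero.
  have h1 := elem_aForm_eq hβ hs hs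
  have h2 := elem_energy (τ := τ) hβ s.2 (0 : T.Skel)
  have z1 : T.bdInt K (fun F x => inner ℝ (s.1.1 x) (normal K.1 F.1) * (0 : T.Skel) F x) = 0 :=
    bdInt_eq_zero_of_ae fun F _ => by
      filter_upwards [Skel.zero_ae T F] with x hx; rw [hx]; simp
  have z2 : T.bdInt K (fun F x => τ K F * (s.2.1 x - (0 : T.Skel) F x) * (0 : T.Skel) F x) = 0 :=
    bdInt_eq_zero_of_ae fun F _ => by
      filter_upwards [Skel.zero_ae T F] with x hx; rw [hx]; simp
  have z3 : T.bdInt K (fun F x =>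
      inner ℝ (((0 : T.Skel) F x * (0 : T.Skel) F x) • β x) (normal K.1 F.1)) = 0 :=
    bdInt_eq_zero_of_ae fun F _ => by
      filter_upwards [Skel.zero_ae T F] with x hx; rw [hx]; simp
  have h3 : elemEnergy ε β τ K s 0 = 0 := by
    unfold elemEnergy
    linarith
  obtain ⟨hq, F, hF, hFu⟩ := eq_of_elemEnergy_eq_zero hε hβ hdiv hτ h3
  have hflux : ∀ r : VPoly d k, ∫ x in K.dom, s.2.1 x * divergence r.1 x =
      T.bdInt K (fun F x => (0 : T.Skel) F x * inner ℝ (r.1 x) (normal K.1 F.1)) := by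
    intro r
    have := hs.1 r
    simp only [hq, ZeroMemClass.coe_zero, Pi.zero_apply (M := fun _ : Euc d => Euc d),
      inner_zero_left, mul_zero, integral_zero] at this
    linarith
  obtain ⟨⟨c, hc⟩, -⟩ := const_and_trace_eq (fun F _ => ⟨0, (Poly d k).zero_mem, Skel.zero_ae T F⟩)
    hflux hF hFu
  have hc0 : c = 0 := by
    have h4 : ∀ᵐ x ∂(faceMeasure F.1), c = 0 := by
      filter_upwards [hFu, Skel.zero_ae T F] with x hx hx0
      rw [hx0, hc] at hx
      exact hx.symm
    have : (ae (faceMeasure F.1)).NeBot := ae_neBot.2 F.faceMeasure_ne_zero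
    exact h4.exists.choose_spec
  refine Prod.ext hq (Subtype.ext ?_)
  rw [hc, hc0]; rfl

/-- Unique solvability of the local problems. -/
theorem existsUnique_isLocalSolution (lam : T.Skel) (f : L2 Ω) :
    ∃! s : VPoly d k × Poly d k, T.IsLocalSolution k ε β τ lam f K s := by
  have hzero : ∀ t : VPoly d k × Poly d k, localRhs β τ (0 : T.Skel) (0 : L2 Ω) K t = 0 := by
    intro t
    have z1 : T.bdInt K (localBdIntegrand β τ (0 : T.Skel) K t) = 0 :=
      bdInt_eq_zero_of_ae fun F _ => by
        filter_upwards [Skel.zero_ae T F] with x hx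
        rw [localBdIntegrand, hx]; simp
    have z2 := K.setIntegral_zero_mul t.2.1
    simp only [localRhs, z1, mul_comm (t.2.1 _), z2, add_zero]
  have hinj : Function.Injective (localBilin (k := k) ε τ hβ) := by
    rw [injective_iff_map_eq_zero]
    intro s hs
    refine eq_zero_of_isLocalSolution hε hβ hdiv hτ ((isLocalSolution_iff ε τ hβ 0 0 s).2 fun t => ?_)
    rw [hzero]
    exact LinearMap.congr_fun hs t
  -- An injective map from a finite-dimensional space to its dual is onto.
  have hsurj : Function.Surjective (localBilin (k := k) ε τ hβ) :=
    (LinearMap.injective_iff_surjective_of_finrank_eq_finrank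
      (Subspace.dual_finrank_eq (K := ℝ) (V := VPoly d k × Poly d k)).symm).1 hinj
  obtain ⟨s, hs⟩ := hsurj (localLin τ hβ lam f)
  refine ⟨s, (isLocalSolution_iff ε τ hβ lam f s).2 fun t => LinearMap.congr_fun hs t,
    fun s' hs' => hinj ?_⟩
  rw [hs]
  exact LinearMap.ext fun t => (isLocalSolution_iff ε τ hβ lam f s').1 hs' t

end positivity

end Triangulation

end HDG

namespace HDG

open Module Filter Topology
open scoped ENNReal

/-! ### Linearity of the local solvers -/

namespace Triangulation

variable {d k : ℕ} {Ω : Set (Euc d)} {T : Triangulation Ω} [NeZero d]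
variable {β : Euc d → Euc d} {ε : ℝ} {τ : T.Elem → T.Face → ℝ}

section localLinearity

variable {C : ℝ≥0} {K : T.Elem}

lemma localRhs_add (hβ : LipschitzOnWith C β K.closedDom) (lam lam' : T.Skel) (f f' : L2 Ω)
    (t : VPoly d k × Poly d k) : localRhs β τ (lam + lam') (f + f') K t =
      localRhs β τ lam f K t + localRhs β τ lam' f' K t := by
  simp only [localRhs]
  have h1 : ∫ x in K.dom, t.2.1 x * (f + f') x =
      (∫ x in K.dom, t.2.1 x * f x) + ∫ x in K.dom, t.2.1 x * f' x := by
    rw [← integral_add (K.integrable_mul (Poly.continuous t.2).continuousOn (K.integrableOn_L2 f))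
      (K.integrable_mul (Poly.continuous t.2).continuousOn (K.integrableOn_L2 f'))]
    refine integral_congr_ae ?_
    filter_upwards [ae_mono (Measure.restrict_mono K.dom_subset le_rfl) (Lp.coeFn_add f f')]
      with x hx
    rw [hx, Pi.add_apply, mul_add]
  have h2 : T.bdInt K (localBdIntegrand β τ (lam + lam') K t) =
      T.bdInt K (localBdIntegrand β τ lam K t) + T.bdInt K (localBdIntegrand β τ lam' K t) := by
    rw [← bdInt_add (bdIntegrable_localBdIntegrand τ hβ lam t)
      (bdIntegrable_localBdIntegrand τ hβ lam' t)]
    refine bdInt_congr_ae K fun F _ => ?_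
    filter_upwards [Lp.coeFn_add (lam F) (lam' F)] with x hx
    simp only [localBdIntegrand]
    rw [Pi.add_apply lam lam' F, hx, Pi.add_apply, mul_add]
  rw [h1, h2]; ring

omit [NeZero d] in
lemma localRhs_smul (c : ℝ) (lam : T.Skel) (f : L2 Ω)
    (t : VPoly d k × Poly d k) : localRhs β τ (c • lam) (c • f) K t =
      c * localRhs β τ lam f K t := by
  simp only [localRhs]
  have h1 : ∫ x in K.dom, t.2.1 x * (c • f) x = c * ∫ x in K.dom, t.2.1 x * f x := by
    rw [← integral_const_mul]
    refine integral_congr_ae ?_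
    filter_upwards [ae_mono (Measure.restrict_mono K.dom_subset le_rfl) (Lp.coeFn_smul c f)]
      with x hx
    rw [hx, Pi.smul_apply, smul_eq_mul]; ring
  have h2 : T.bdInt K (localBdIntegrand β τ (c • lam) K t) =
      c * T.bdInt K (localBdIntegrand β τ lam K t) := by
    rw [← bdInt_const_mul]
    refine bdInt_congr_ae K fun F _ => ?_
    filter_upwards [Lp.coeFn_smul c (lam F)] with x hx
    simp only [localBdIntegrand]
    rw [Pi.smul_apply c lam F, hx, Pi.smul_apply, smul_eq_mul]; ring
  rw [h1, h2]; ring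

lemma IsLocalSolution.add (hβ : LipschitzOnWith C β K.closedDom) {lam lam' : T.Skel} {f f' : L2 Ω}
    {s s' : VPoly d k × Poly d k} (hs : T.IsLocalSolution k ε β τ lam f K s)
    (hs' : T.IsLocalSolution k ε β τ lam' f' K s') :
    T.IsLocalSolution k ε β τ (lam + lam') (f + f') K (s + s') := by
  rw [isLocalSolution_iff ε τ hβ] at hs hs' ⊢
  intro t
  rw [localRhs_add hβ, ← hs, ← hs']
  exact LinearMap.map_add₂ (localBilin ε τ hβ) s s' t

lemma IsLocalSolution.smul (hβ : LipschitzOnWith C β K.closedDom) {lam : T.Skel} {f : L2 Ω}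
    {s : VPoly d k × Poly d k} (c : ℝ) (hs : T.IsLocalSolution k ε β τ lam f K s) :
    T.IsLocalSolution k ε β τ (c • lam) (c • f) K (c • s) := by
  rw [isLocalSolution_iff ε τ hβ] at hs ⊢
  intro t
  rw [localRhs_smul, ← hs]
  exact LinearMap.map_smul₂ (localBilin ε τ hβ) c s t

end localLinearity

/-! ### The local solvers -/

section solver

variable (hε : 0 < ε) (hβ : IsW1Infty Ω β)
  (hdiv : ∀ᵐ x ∂(volume.restrict Ω), 0 ≤ - divergence β x) (hτ : T.IsAdmissible β τ)
include hε hβ hdiv hτ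

lemma solver_spec (lam : T.Skel) (f : L2 Ω) (K : T.Elem) :
    T.IsLocalSolution k ε β τ lam f K
      ((T.solver k ε β τ lam f).1 K, (T.solver k ε β τ lam f).2 K) := by
  obtain ⟨C, hC⟩ := hβ.exists_lipschitzOnWith K
  exact Classical.epsilon_spec (existsUnique_isLocalSolution hε hC hdiv hτ lam f).exists

lemma eq_solver {lam : T.Skel} {f : L2 Ω} {K : T.Elem} {s : VPoly d k × Poly d k}
    (hs : T.IsLocalSolution k ε β τ lam f K s) :
    s = ((T.solver k ε β τ lam f).1 K, (T.solver k ε β τ lam f).2 K) := by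
  obtain ⟨C, hC⟩ := hβ.exists_lipschitzOnWith K
  exact (existsUnique_isLocalSolution hε hC hdiv hτ lam f).unique hs
    (solver_spec hε hβ hdiv hτ lam f K)

lemma solver_add (lam lam' : T.Skel) (f f' : L2 Ω) :
    T.solver k ε β τ (lam + lam') (f + f') =
      T.solver k ε β τ lam f + T.solver k ε β τ lam' f' := by
  have h : ∀ K, (((T.solver k ε β τ lam f).1 K, (T.solver k ε β τ lam f).2 K) +
      ((T.solver k ε β τ lam' f').1 K, (T.solver k ε β τ lam' f').2 K) : VPoly d k × Poly d k) =
      ((T.solver k ε β τ (lam + lam') (f + f')).1 K,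
        (T.solver k ε β τ (lam + lam') (f + f')).2 K) := fun K => by
    obtain ⟨C, hC⟩ := hβ.exists_lipschitzOnWith K
    exact eq_solver hε hβ hdiv hτ ((solver_spec (k := k) hε hβ hdiv hτ lam f K).add hC
      (solver_spec hε hβ hdiv hτ lam' f' K))
  refine Prod.ext (funext fun K => ?_) (funext fun K => ?_)
  · exact (congrArg Prod.fst (h K)).symm
  · exact (congrArg Prod.snd (h K)).symm

lemma solver_smul (c : ℝ) (lam : T.Skel) (f : L2 Ω) :
    T.solver k ε β τ (c • lam) (c • f) = c • T.solver k ε β τ lam f := by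
  have h : ∀ K, (c • ((T.solver k ε β τ lam f).1 K, (T.solver k ε β τ lam f).2 K) :
      VPoly d k × Poly d k) = ((T.solver k ε β τ (c • lam) (c • f)).1 K,
        (T.solver k ε β τ (c • lam) (c • f)).2 K) := fun K => by
    obtain ⟨C, hC⟩ := hβ.exists_lipschitzOnWith K
    exact eq_solver hε hβ hdiv hτ ((solver_spec (k := k) hε hβ hdiv hτ lam f K).smul hC c)
  refine Prod.ext (funext fun K => ?_) (funext fun K => ?_)
  · exact (congrArg Prod.fst (h K)).symm
  · exact (congrArg Prod.snd (h K)).symm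

end solver

/-! ### The global bilinear form -/

lemma bdIntegrable_normal_flux (K : T.Elem) (q : VPoly d k) (μ : T.Skel) :
    BdIntegrable K fun F x => inner ℝ (q.1 x) (normal K.1 F.1) * μ F x := fun F _ => by
  have := VPoly.continuous q
  exact F.integrable_mul (φ := fun x => inner ℝ (q.1 x) (normal K.1 F.1))
    (Continuous.continuousOn (by fun_prop)) (μ.integrable F)

/-- The flux functional `-⟨q·n, μ⟩ - ⟨τ (u - λ), μ⟩`. -/
def fluxForm (τ : T.Elem → T.Face → ℝ) (q : T.VSpace k) (u : T.WSpace k) (lam μ : T.Skel) : ℝ :=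
  - T.bds (fun K F x => inner ℝ ((q K).1 x) (normal K.1 F.1) * μ F x)
    - T.bds (fun K F x => τ K F * ((u K).1 x - lam F x) * μ F x)

lemma fluxForm_add_left (q q' : T.VSpace k) (u u' : T.WSpace k) (lam lam' μ : T.Skel) :
    fluxForm τ (q + q') (u + u') (lam + lam') μ =
      fluxForm τ q u lam μ + fluxForm τ q' u' lam' μ := by
  have h1 : ∀ K, T.bdInt K (fun F x => inner ℝ (((q + q') K).1 x) (normal K.1 F.1) * μ F x) =
      T.bdInt K (fun F x => inner ℝ ((q K).1 x) (normal K.1 F.1) * μ F x) +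
      T.bdInt K (fun F x => inner ℝ ((q' K).1 x) (normal K.1 F.1) * μ F x) := fun K => by
    rw [← bdInt_add (bdIntegrable_normal_flux K (q K) μ) (bdIntegrable_normal_flux K (q' K) μ)]
    refine bdInt_congr K fun F x => ?_
    simp only [Pi.add_apply, Submodule.coe_add, inner_add_left]
    ring
  have h2 : ∀ K, T.bdInt K (fun F x => τ K F * (((u + u') K).1 x - (lam + lam') F x) * μ F x) =
      T.bdInt K (fun F x => τ K F * ((u K).1 x - lam F x) * μ F x) +
      T.bdInt K (fun F x => τ K F * ((u' K).1 x - lam' F x) * μ F x) := fun K => by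
    rw [← bdInt_add (bdIntegrable_jump_mul (u K) lam μ) (bdIntegrable_jump_mul (u' K) lam' μ)]
    refine bdInt_congr_ae K fun F _ => ?_
    filter_upwards [Lp.coeFn_add (lam F) (lam' F)] with x hx
    rw [Pi.add_apply lam lam' F, hx]
    simp only [Pi.add_apply, Submodule.coe_add]
    ring
  simp only [fluxForm, bds, h1, h2, Finset.sum_add_distrib]
  ring

omit [NeZero d] in
lemma fluxForm_smul_left (c : ℝ) (q : T.VSpace k) (u : T.WSpace k) (lam μ : T.Skel) :
    fluxForm τ (c • q) (c • u) (c • lam) μ = c * fluxForm τ q u lam μ := by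
  have h1 : ∀ K, T.bdInt K (fun F x => inner ℝ (((c • q) K).1 x) (normal K.1 F.1) * μ F x) =
      c * T.bdInt K (fun F x => inner ℝ ((q K).1 x) (normal K.1 F.1) * μ F x) := fun K => by
    rw [← bdInt_const_mul]
    refine bdInt_congr K fun F x => ?_
    simp only [Pi.smul_apply, Submodule.coe_smul, real_inner_smul_left]
    ring
  have h2 : ∀ K, T.bdInt K (fun F x => τ K F * (((c • u) K).1 x - (c • lam) F x) * μ F x) =
      c * T.bdInt K (fun F x => τ K F * ((u K).1 x - lam F x) * μ F x) := fun K => by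
    rw [← bdInt_const_mul]
    refine bdInt_congr_ae K fun F _ => ?_
    filter_upwards [Lp.coeFn_smul c (lam F)] with x hx
    rw [Pi.smul_apply c lam F, hx]
    simp only [Pi.smul_apply, Submodule.coe_smul, smul_eq_mul]
    ring
  simp only [fluxForm, bds, h1, h2, ← Finset.mul_sum]
  ring

lemma fluxForm_add_right (q : T.VSpace k) (u : T.WSpace k) (lam μ μ' : T.Skel) :
    fluxForm τ q u lam (μ + μ') = fluxForm τ q u lam μ + fluxForm τ q u lam μ' := by
  have h1 : ∀ K, T.bdInt K (fun F x => inner ℝ ((q K).1 x) (normal K.1 F.1) * (μ + μ') F x) =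
      T.bdInt K (fun F x => inner ℝ ((q K).1 x) (normal K.1 F.1) * μ F x) +
      T.bdInt K (fun F x => inner ℝ ((q K).1 x) (normal K.1 F.1) * μ' F x) := fun K => by
    rw [← bdInt_add (bdIntegrable_normal_flux K (q K) μ) (bdIntegrable_normal_flux K (q K) μ')]
    refine bdInt_congr_ae K fun F _ => ?_
    filter_upwards [Lp.coeFn_add (μ F) (μ' F)] with x hx
    rw [Pi.add_apply μ μ' F, hx, Pi.add_apply, mul_add]
  have h2 : ∀ K, T.bdInt K (fun F x => τ K F * ((u K).1 x - lam F x) * (μ + μ') F x) =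
      T.bdInt K (fun F x => τ K F * ((u K).1 x - lam F x) * μ F x) +
      T.bdInt K (fun F x => τ K F * ((u K).1 x - lam F x) * μ' F x) := fun K => by
    rw [← bdInt_add (bdIntegrable_jump_mul (u K) lam μ) (bdIntegrable_jump_mul (u K) lam μ')]
    refine bdInt_congr_ae K fun F _ => ?_
    filter_upwards [Lp.coeFn_add (μ F) (μ' F)] with x hx
    rw [Pi.add_apply μ μ' F, hx, Pi.add_apply, mul_add]
  simp only [fluxForm, bds, h1, h2, Finset.sum_add_distrib]
  ring

omit [NeZero d] in
lemma fluxForm_smul_right (c : ℝ) (q : T.VSpace k) (u : T.WSpace k) (lam μ : T.Skel) :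
    fluxForm τ q u lam (c • μ) = c * fluxForm τ q u lam μ := by
  have h1 : ∀ K, T.bdInt K (fun F x => inner ℝ ((q K).1 x) (normal K.1 F.1) * (c • μ) F x) =
      c * T.bdInt K (fun F x => inner ℝ ((q K).1 x) (normal K.1 F.1) * μ F x) := fun K => by
    rw [← bdInt_const_mul]
    refine bdInt_congr_ae K fun F _ => ?_
    filter_upwards [Lp.coeFn_smul c (μ F)] with x hx
    rw [Pi.smul_apply c μ F, hx, Pi.smul_apply, smul_eq_mul]; ring
  have h2 : ∀ K, T.bdInt K (fun F x => τ K F * ((u K).1 x - lam F x) * (c • μ) F x) =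
      c * T.bdInt K (fun F x => τ K F * ((u K).1 x - lam F x) * μ F x) := fun K => by
    rw [← bdInt_const_mul]
    refine bdInt_congr_ae K fun F _ => ?_
    filter_upwards [Lp.coeFn_smul c (μ F)] with x hx
    rw [Pi.smul_apply c μ F, hx, Pi.smul_apply, smul_eq_mul]; ring
  simp only [fluxForm, bds, h1, h2, ← Finset.mul_sum]
  ring

omit [NeZero d] in
lemma aForm_eq_fluxForm (lam μ : T.Skel) : T.aForm k ε β τ lam μ =
    fluxForm τ (T.qLam k ε β τ lam) (T.uLam k ε β τ lam) lam μ := rfl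

-- Both `a_h` and `-b_h` become values of one functional that is linear in `(q, u, λ)` jointly, so
-- the flux of the sum of the two local solutions splits into the two forms. The zero trace is zero
-- only almost everywhere, hence the passage through integrals.
omit [NeZero d] in
lemma bForm_eq_fluxForm (f : L2 Ω) (μ : T.Skel) : T.bForm k ε β τ f μ =
    - fluxForm τ (T.qSrc k ε β τ f) (T.uSrc k ε β τ f) 0 μ := by
  have h : ∀ K, T.bdInt K (fun F x => τ K F * (T.uSrc k ε β τ f K).1 x * μ F x) =
      T.bdInt K (fun F x => τ K F * ((T.uSrc k ε β τ f K).1 x - (0 : T.Skel) F x) * μ F x) :=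
    fun K => bdInt_congr_ae K fun F _ => by
      filter_upwards [Skel.zero_ae T F] with x hx
      rw [hx, Pi.zero_apply, sub_zero]
  simp only [bForm, fluxForm, bds, h]
  ring

section bilinear

variable (hε : 0 < ε) (hβ : IsW1Infty Ω β)
  (hdiv : ∀ᵐ x ∂(volume.restrict Ω), 0 ≤ - divergence β x) (hτ : T.IsAdmissible β τ)

/-- `a_h` as a bilinear map. -/
def aBilin (k : ℕ) : T.Skel →ₗ[ℝ] T.Skel →ₗ[ℝ] ℝ :=
  LinearMap.mk₂ ℝ (T.aForm k ε β τ)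
    (fun lam lam' μ => by
      have h := solver_add (k := k) hε hβ hdiv hτ lam lam' 0 0
      rw [add_zero] at h
      simp only [aForm_eq_fluxForm, qLam, uLam, h]
      exact fluxForm_add_left _ _ _ _ _ _ _)
    (fun c lam μ => by
      have h := solver_smul (k := k) hε hβ hdiv hτ c lam 0
      rw [smul_zero] at h
      simp only [aForm_eq_fluxForm, qLam, uLam, h]
      exact fluxForm_smul_left _ _ _ _ _)
    (fun lam μ μ' => fluxForm_add_right _ _ _ _ _)
    (fun c lam μ => fluxForm_smul_right _ _ _ _ _)

/-- `b_h` as a linear map. -/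
def bLin (k : ℕ) (ε : ℝ) (β : Euc d → Euc d) (τ : T.Elem → T.Face → ℝ) (f : L2 Ω) :
    T.Skel →ₗ[ℝ] ℝ where
  toFun := T.bForm k ε β τ f
  map_add' μ μ' := by
    simp only [bForm_eq_fluxForm, fluxForm_add_right]; ring
  map_smul' c μ := by
    simp only [bForm_eq_fluxForm, fluxForm_smul_right, RingHom.id_apply, smul_eq_mul]; ring

end bilinear

end Triangulation

end HDG

namespace HDG

open Module Filter Topology
open scoped ENNReal

/-! ### The spaces of traces -/

namespace Triangulation

variable {d k : ℕ} {Ω : Set (Euc d)} {T : Triangulation Ω}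

section spaces

variable [NeZero d]

lemma Face.memLp_poly (F : T.Face) (p : Poly d k) : MemLp p.1 2 (faceMeasure F.1) := by
  obtain ⟨C, hC⟩ := F.isCompact_set.exists_bound_of_continuousOn (Poly.continuous p).continuousOn
  exact MemLp.of_bound (Poly.continuous p).aestronglyMeasurable C
    ((ae_restrict_iff' F.isCompact_set.measurableSet).2 (Eventually.of_forall hC))

/-- The restriction of polynomials to the faces. -/
def polyTrace (T : Triangulation Ω) (k : ℕ) : (T.Face → Poly d k) →ₗ[ℝ] T.Skel where
  toFun p F := (F.memLp_poly (p F)).toLp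
  map_add' p q := funext fun F => MemLp.toLp_add (F.memLp_poly (p F)) (F.memLp_poly (q F))
  map_smul' c p := funext fun F => MemLp.toLp_const_smul c (F.memLp_poly (p F))

/-- `M_h` as a subspace of `L²(ℰ_h)`. -/
def mSubmodule (T : Triangulation Ω) (k : ℕ) : Submodule ℝ T.Skel :=
  LinearMap.range (T.polyTrace k)

lemma mem_mSubmodule {μ : T.Skel} : μ ∈ T.mSubmodule k ↔ μ ∈ T.MSpace k := by
  constructor
  · rintro ⟨p, rfl⟩ F
    exact ⟨(p F).1, (p F).2, (F.memLp_poly (p F)).coeFn_toLp⟩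
  · intro h
    choose p hp hμ using h
    refine ⟨fun F => ⟨p F, hp F⟩, funext fun F => Lp.ext ?_⟩
    exact (F.memLp_poly ⟨p F, hp F⟩).coeFn_toLp.trans (hμ F).symm

instance : FiniteDimensional ℝ (T.mSubmodule k) :=
  inferInstanceAs (FiniteDimensional ℝ (LinearMap.range (T.polyTrace k)))

end spaces

/-! ### Interior and boundary parts -/

open Classical in
/-- Setting a function on the skeleton to zero on the boundary faces. -/
def interiorPart (T : Triangulation Ω) : T.Skel →ₗ[ℝ] T.Skel :=
  LinearMap.pi fun F => if F.IsBoundary then 0 else LinearMap.proj F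

lemma interiorPart_of_isBoundary (μ : T.Skel) {F : T.Face} (hF : F.IsBoundary) :
    T.interiorPart μ F = 0 := by
  simp [interiorPart, hF]

lemma interiorPart_of_not_isBoundary (μ : T.Skel) {F : T.Face} (hF : ¬ F.IsBoundary) :
    T.interiorPart μ F = μ F := by
  simp [interiorPart, hF]

lemma interiorPart_eq_self {μ : T.Skel} (h : ∀ F : T.Face, F.IsBoundary → μ F = 0) :
    T.interiorPart μ = μ := funext fun F => by
  by_cases hF : F.IsBoundary
  · rw [interiorPart_of_isBoundary μ hF, h F hF]
  · rw [interiorPart_of_not_isBoundary μ hF]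

lemma interiorPart_mem_MSpace {μ : T.Skel} (h : μ ∈ T.MSpace k) :
    T.interiorPart μ ∈ T.MSpace k := fun F => by
  by_cases hF : F.IsBoundary
  · rw [interiorPart_of_isBoundary μ hF]
    exact ⟨0, (Poly d k).zero_mem, Lp.coeFn_zero ℝ 2 _⟩
  · rw [interiorPart_of_not_isBoundary μ hF]
    exact h F

open Classical in
/-- The inner product `⟨λ, μ⟩_{∂Ω}` on the skeleton. -/
def bdForm (T : Triangulation Ω) : T.Skel →ₗ[ℝ] T.Skel →ₗ[ℝ] ℝ :=
  ∑ F : T.Face with F.IsBoundary, (innerₗ (Lp ℝ 2 (faceMeasure F.1))).compl₁₂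
    (LinearMap.proj F) (LinearMap.proj F)

open Classical in
lemma bdForm_apply (lam μ : T.Skel) :
    T.bdForm lam μ = ∑ F : T.Face with F.IsBoundary, inner ℝ (lam F) (μ F) := by
  simp [bdForm, LinearMap.sum_apply]

lemma bdOmega_eq_bdForm (lam μ : T.Skel) :
    T.bdOmega (fun F x => lam F x * μ F x) = T.bdForm lam μ := by
  rw [bdForm_apply, bdOmega]
  refine Finset.sum_congr rfl fun F _ => ?_
  rw [L2.inner_def]
  simp [mul_comm]

lemma bdForm_interiorPart (lam μ : T.Skel) : T.bdForm lam (T.interiorPart μ) = 0 := by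
  classical
  rw [bdForm_apply]
  refine Finset.sum_eq_zero fun F hF => ?_
  rw [interiorPart_of_isBoundary μ (Finset.mem_filter.1 hF).2, inner_zero_right]

lemma Face.IsBoundary.faceMeasure_le {F : T.Face} (hF : F.IsBoundary) :
    faceMeasure F.1 ≤ (surface d).restrict (frontier Ω) :=
  Measure.restrict_mono hF le_rfl

open Classical in
/-- A function on `∂Ω`, as a function on the skeleton. -/
def bdTrace (T : Triangulation Ω) (g : L2Bd Ω) : T.Skel := fun F =>
  if hF : F.IsBoundary then ((Lp.memLp g).mono_measure hF.faceMeasure_le).toLp else 0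

lemma bdTrace_ae (g : L2Bd Ω) {F : T.Face} (hF : F.IsBoundary) :
    T.bdTrace g F =ᵐ[faceMeasure F.1] g := by
  rw [bdTrace, dif_pos hF]
  exact MemLp.coeFn_toLp _

lemma bdOmega_eq_bdForm_bdTrace (g : L2Bd Ω) (μ : T.Skel) :
    T.bdOmega (fun F x => g x * μ F x) = T.bdForm (T.bdTrace g) μ := by
  classical
  rw [← bdOmega_eq_bdForm]
  refine Finset.sum_congr rfl fun F hF => integral_congr_ae ?_
  filter_upwards [bdTrace_ae g (Finset.mem_filter.1 hF).2] with x hx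
  rw [hx]

lemma bdForm_bdTrace_zero (μ : T.Skel) : T.bdForm (T.bdTrace 0) μ = 0 := by
  classical
  rw [bdForm_apply]
  refine Finset.sum_eq_zero fun F hF => ?_
  have hb := (Finset.mem_filter.1 hF).2
  have h : T.bdTrace 0 F = 0 := by
    refine Lp.ext ?_
    filter_upwards [bdTrace_ae 0 hb, Lp.coeFn_zero ℝ 2 (faceMeasure F.1),
      ae_mono hb.faceMeasure_le (Lp.coeFn_zero ℝ 2 ((surface d).restrict (frontier Ω)))]
      with x h1 h2 h3
    rw [h1, h2, h3]
  rw [h, inner_zero_left]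

lemma mem_MSpaceBC {g : L2Bd Ω} {lam : T.Skel} : lam ∈ T.MSpaceBC k g ↔
    lam ∈ T.MSpace k ∧ ∀ μ ∈ T.MSpace k, T.bdForm lam μ = T.bdForm (T.bdTrace g) μ := by
  simp only [MSpaceBC, mem_ofPred_eq, bdOmega_eq_bdForm, bdOmega_eq_bdForm_bdTrace]

/-- Testing the boundary condition with `λ` itself yields a sum of squared norms over the boundary
faces. -/
lemma mem_MSpaceBC_zero {lam : T.Skel} : lam ∈ T.MSpaceBC k 0 ↔
    lam ∈ T.MSpace k ∧ ∀ F : T.Face, F.IsBoundary → lam F = 0 := by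
  classical
  rw [mem_MSpaceBC]
  simp only [bdForm_bdTrace_zero]
  refine and_congr_right fun h => ⟨fun h0 F hF => ?_, fun h0 μ _ => ?_⟩
  · have h1 := h0 lam h
    rw [bdForm_apply, Finset.sum_eq_zero_iff_of_nonneg fun F _ => real_inner_self_nonneg] at h1
    exact inner_self_eq_zero.1 (h1 F (Finset.mem_filter.2 ⟨Finset.mem_univ _, hF⟩))
  · rw [bdForm_apply]
    refine Finset.sum_eq_zero fun F hF => ?_
    rw [h0 F (Finset.mem_filter.1 hF).2, inner_zero_left]

lemma interiorPart_mem_MSpaceBC {μ : T.Skel} (h : μ ∈ T.MSpace k) :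
    T.interiorPart μ ∈ T.MSpaceBC k 0 :=
  mem_MSpaceBC_zero.2 ⟨interiorPart_mem_MSpace h, fun _ hF => interiorPart_of_isBoundary μ hF⟩

lemma interiorPart_eq_self_of_mem {μ : T.Skel} (h : μ ∈ T.MSpaceBC k 0) : T.interiorPart μ = μ :=
  interiorPart_eq_self (mem_MSpaceBC_zero.1 h).2

/-! ### Solvability of problems on the skeleton -/

/-- The boundary condition sees only the values of a test function on `∂Ω`, the variational equation
only its interior part. The two can therefore be added into a single equation with trial and test
functions in the same space `M_h`, which makes the system square. -/
lemma skeleton_problem_iff (a : T.Skel →ₗ[ℝ] T.Skel →ₗ[ℝ] ℝ) (b : T.Skel →ₗ[ℝ] ℝ) (g : L2Bd Ω)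
    {lam : T.Skel} (hlam : lam ∈ T.MSpace k) :
    (∀ μ ∈ T.MSpace k, a lam (T.interiorPart μ) + T.bdForm lam μ =
        b (T.interiorPart μ) + T.bdForm (T.bdTrace g) μ) ↔
      lam ∈ T.MSpaceBC k g ∧ ∀ μ ∈ T.MSpaceBC k 0, a lam μ = b μ := by
  rw [mem_MSpaceBC]
  constructor
  · intro h
    have h1 : ∀ μ ∈ T.MSpace k, a lam (T.interiorPart μ) = b (T.interiorPart μ) := by
      intro μ hμ
      have := h _ (interiorPart_mem_MSpace hμ)
      rwa [bdForm_interiorPart, bdForm_interiorPart, add_zero, add_zero,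
        interiorPart_eq_self_of_mem (interiorPart_mem_MSpaceBC hμ)] at this
    refine ⟨⟨hlam, fun μ hμ => ?_⟩, fun μ hμ => ?_⟩
    · have := h μ hμ
      rwa [h1 μ hμ, add_right_inj] at this
    · rw [← interiorPart_eq_self_of_mem hμ]
      exact h1 μ hμ.1
  · rintro ⟨⟨_, h1⟩, h2⟩ μ hμ
    rw [h1 μ hμ, h2 _ (interiorPart_mem_MSpaceBC hμ)]

/-- For zero data, `skeleton_problem_iff` places a solution in `M_h(0)` and allows it as its own
test function, so definiteness on `M_h(0)` gives injectivity on all of `M_h`. Finite dimension does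
the rest. -/
theorem existsUnique_skeleton_problem [NeZero d] (a : T.Skel →ₗ[ℝ] T.Skel →ₗ[ℝ] ℝ)
    (b : T.Skel →ₗ[ℝ] ℝ) (g : L2Bd Ω)
    (ha : ∀ lam ∈ T.MSpaceBC k 0, a lam lam = 0 → lam = 0) :
    ∃! lam : T.Skel, lam ∈ T.MSpaceBC k g ∧ ∀ μ ∈ T.MSpaceBC k 0, a lam μ = b μ := by
  set M := T.mSubmodule k
  set B : M →ₗ[ℝ] M →ₗ[ℝ] ℝ := a.compl₁₂ M.subtype (T.interiorPart ∘ₗ M.subtype) +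
    T.bdForm.compl₁₂ M.subtype M.subtype with hB
  have hBa : ∀ lam μ : M, B lam μ = a lam (T.interiorPart μ) + T.bdForm lam μ := fun _ _ => rfl
  have hmem : ∀ μ : M, μ.1 ∈ T.MSpace k := fun μ => mem_mSubmodule.1 μ.2
  have hinj : Function.Injective B := by
    rw [injective_iff_map_eq_zero]
    intro lam hlam
    have h := (skeleton_problem_iff a 0 0 (hmem lam)).1 fun μ hμ => by
      rw [LinearMap.zero_apply, bdForm_bdTrace_zero, add_zero,
        ← hBa lam ⟨μ, mem_mSubmodule.2 hμ⟩, hlam, LinearMap.zero_apply]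
    exact Subtype.ext (ha _ h.1 (h.2 _ h.1))
  have hsurj : Function.Surjective B :=
    (LinearMap.injective_iff_surjective_of_finrank_eq_finrank
      (Subspace.dual_finrank_eq (K := ℝ) (V := M)).symm).1 hinj
  set ℓ : M →ₗ[ℝ] ℝ := b ∘ₗ T.interiorPart ∘ₗ M.subtype + T.bdForm (T.bdTrace g) ∘ₗ M.subtype
    with hℓ
  have key : ∀ lam : M, B lam = ℓ ↔
      lam.1 ∈ T.MSpaceBC k g ∧ ∀ μ ∈ T.MSpaceBC k 0, a lam.1 μ = b μ := by
    intro lam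
    rw [← skeleton_problem_iff a b g (hmem lam)]
    exact ⟨fun h μ hμ => LinearMap.congr_fun h ⟨μ, mem_mSubmodule.2 hμ⟩,
      fun h => LinearMap.ext fun μ => h μ.1 (hmem μ)⟩
  obtain ⟨lam, hlam⟩ := hsurj ℓ
  refine ⟨lam.1, (key lam).1 hlam, fun lam' h' => ?_⟩
  have h1 := (key ⟨lam', mem_mSubmodule.2 h'.1.1⟩).2 h'
  exact congrArg Subtype.val (hinj (h1.trans hlam.symm))

end Triangulation

end HDG

namespace HDG

open Module Filter Topology
open scoped ENNReal

/-! ### The form `a_h` on the skeleton -/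

namespace Triangulation

variable {d k : ℕ} {Ω : Set (Euc d)} {T : Triangulation Ω} [NeZero d]
variable {β : Euc d → Euc d} {ε : ℝ} {τ : T.Elem → T.Face → ℝ}

omit [NeZero d] in
lemma Face.integrable_smul (F : T.Face) {φ : Euc d → ℝ} {v : Euc d → Euc d}
    (hφ : Integrable φ (faceMeasure F.1)) (hv : ContinuousOn v F.set) :
    Integrable (fun x => φ x • v x) (faceMeasure F.1) := by
  obtain ⟨C, hC⟩ := F.isCompact_set.exists_bound_of_continuousOn hv
  refine (hφ.norm.mul_const C).mono'
    (hφ.1.smul (hv.aestronglyMeasurable F.isCompact_set.measurableSet)) ?_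
  refine (ae_restrict_iff' F.isCompact_set.measurableSet).2 (Eventually.of_forall fun x hx => ?_)
  rw [norm_smul]
  exact mul_le_mul_of_nonneg_left (hC x hx) (norm_nonneg _)

/-- Single-valued fluxes vanishing on the boundary faces do not contribute. -/
lemma bds_mul_eq_zero (lam : T.Skel) {μ : T.Skel} (hμ : ∀ F : T.Face, F.IsBoundary → μ F = 0)
    {v : Euc d → Euc d} (hv : ContinuousOn v (closure Ω)) :
    T.bds (fun K F x => inner ℝ ((lam F x * μ F x) • v x) (normal K.1 F.1)) = 0 := by
  refine bds_inner_normal_eq_zero (fun F x => (lam F x * μ F x) • v x) (fun F =>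
    F.integrable_smul (lam.integrable_mul μ F) (hv.mono F.set_subset_closure)) fun F hF => ?_
  refine integral_eq_zero_of_ae ?_
  have h0 := Lp.coeFn_zero ℝ 2 (faceMeasure F.1)
  rw [← hμ F hF] at h0
  filter_upwards [h0] with x hx
  simp [hx]

section forms

variable (hε : 0 < ε) (hβ : IsW1Infty Ω β)
  (hdiv : ∀ᵐ x ∂(volume.restrict Ω), 0 ≤ - divergence β x) (hτ : T.IsAdmissible β τ)
include hε hβ hdiv hτ

/-- The form `a_h` in terms of the local solvers. -/
theorem aForm_eq (lam μ : T.Skel) :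
    T.aForm k ε β τ lam μ =
      T.vol (fun K x => ε⁻¹ *
          inner ℝ ((T.qLam k ε β τ lam K).1 x) ((T.qLam k ε β τ μ K).1 x))
        - T.vol (fun K x => (T.uLam k ε β τ lam K).1 x *
            divergence (fun y => (T.uLam k ε β τ μ K).1 y • β y) x)
        + T.bds (fun K F x => inner ℝ (β x) (normal K.1 F.1) * lam F x *
            (T.uLam k ε β τ μ K).1 x)
        + T.bds (fun K F x => τ K F * ((T.uLam k ε β τ lam K).1 x - lam F x) *
            ((T.uLam k ε β τ μ K).1 x - μ F x)) := by
  simp only [aForm, vol, bds, ← Finset.sum_neg_distrib, ← Finset.sum_sub_distrib,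
    ← Finset.sum_add_distrib]
  refine Finset.sum_congr rfl fun K _ => ?_
  obtain ⟨C, hC⟩ := hβ.exists_lipschitzOnWith K
  exact elem_aForm_eq hC (solver_spec (k := k) hε hβ hdiv hτ lam 0 K)
    (solver_spec (k := k) hε hβ hdiv hτ μ 0 K)

/-- The form `b_h` in terms of the local solvers. -/
theorem bForm_eq (f : L2 Ω) (μ : T.Skel) :
    T.bForm k ε β τ f μ =
      T.vol (fun K x => f x * (T.uLam k ε β τ μ K).1 x)
        + T.bds (fun K F x => inner ℝ (β x) (normal K.1 F.1) *
            (T.uSrc k ε β τ f K).1 x * μ F x)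
        + T.vol (fun K x => (T.uSrc k ε β τ f K).1 x *
            inner ℝ (β x) (gradient (T.uLam k ε β τ μ K).1 x))
        - T.vol (fun K x => inner ℝ (gradient (T.uSrc k ε β τ f K).1 x)
            ((T.uLam k ε β τ μ K).1 x • β x)) := by
  simp only [bForm, vol, bds, ← Finset.sum_sub_distrib, ← Finset.sum_add_distrib]
  refine Finset.sum_congr rfl fun K _ => ?_
  obtain ⟨C, hC⟩ := hβ.exists_lipschitzOnWith K
  exact elem_bForm_eq hC (solver_spec (k := k) hε hβ hdiv hτ 0 f K)
    (solver_spec (k := k) hε hβ hdiv hτ μ 0 K)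

/-- The energy identity for `a_h`. -/
theorem aForm_self_eq {lam : T.Skel} (hlam : ∀ F : T.Face, F.IsBoundary → lam F = 0) :
    T.aForm k ε β τ lam lam =
      ∑ K, elemEnergy ε β τ K (T.qLam k ε β τ lam K, T.uLam k ε β τ lam K) lam := by
  -- This disposes of the only term without a sign, `½ β·n λ²`, which has the same value up to the
  -- sign of the normal on both sides of a face.
  have h := bds_mul_eq_zero lam hlam hβ.1
  have h1 : T.aForm k ε β τ lam lam =
      ∑ K, elemEnergy ε β τ K (T.qLam k ε β τ lam K, T.uLam k ε β τ lam K) lam +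
        (1 / 2) * T.bds (fun K F x =>
          inner ℝ ((lam F x * lam F x) • β x) (normal K.1 F.1)) := by
    rw [aForm_eq hε hβ hdiv hτ]
    simp only [vol, bds, ← Finset.sum_sub_distrib, ← Finset.sum_add_distrib, Finset.mul_sum]
    refine Finset.sum_congr rfl fun K _ => ?_
    obtain ⟨C, hC⟩ := hβ.exists_lipschitzOnWith K
    have h2 := elem_energy (τ := τ) hC (T.uLam k ε β τ lam K) lam
    simp only [elemEnergy]
    linarith
  rw [h1, h, mul_zero, add_zero]

/-- The form `a_h` is definite on `M_h(0)`. -/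
theorem eq_zero_of_aForm_self_eq_zero {lam : T.Skel} (hlam : lam ∈ T.MSpaceBC k 0)
    (h : T.aForm k ε β τ lam lam = 0) : lam = 0 := by
  have hbd := (mem_MSpaceBC_zero.1 hlam).2
  have hpoly := (mem_MSpaceBC_zero.1 hlam).1
  rw [aForm_self_eq hε hβ hdiv hτ hbd, Finset.sum_eq_zero_iff_of_nonneg fun K _ => by
    exact elemEnergy_nonneg hε hdiv hτ _ lam] at h
  have hconst : ∀ K : T.Elem, ∃ c : ℝ, ∀ F ∈ K.bd, ∀ᵐ x ∂(faceMeasure F.1), lam F x = c := by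
    intro K
    obtain ⟨C, hC⟩ := hβ.exists_lipschitzOnWith K
    obtain ⟨hq, F, hF, hFu⟩ := eq_of_elemEnergy_eq_zero hε hC hdiv hτ (h K (Finset.mem_univ _))
    have hs := solver_spec (k := k) hε hβ hdiv hτ lam 0 K
    have hq' : ((T.solver k ε β τ lam 0).1 K : VPoly d k) = 0 := hq
    obtain ⟨⟨c, hc⟩, h2⟩ := const_and_trace_eq (u := T.uLam k ε β τ lam K)
      (fun F _ => hpoly F) (fun r => by
        have := hs.1 r
        simp only [hq', ZeroMemClass.coe_zero, Pi.zero_apply (M := fun _ : Euc d => Euc d),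
          inner_zero_left, mul_zero, integral_zero] at this
        simp only [uLam]
        linarith) hF hFu
    refine ⟨c, fun F hF => ?_⟩
    filter_upwards [h2 F hF] with x hx
    rw [hx, hc]
  choose c hc using hconst
  -- The field `λ² x` is single-valued, so its total flux is zero. On each element `λ` is a constant
  -- `c_K` and `∇·x = d`, so the flux is also `c_K² d |K|`: the nonnegative contributions add up to
  -- zero, and all constants vanish at once.
  have hsum := bds_mul_eq_zero lam hbd continuousOn_id
  have helem : ∀ K : T.Elem, T.bdInt K (fun F x =>
      inner ℝ ((lam F x * lam F x) • id x) (normal K.1 F.1)) =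
        c K * c K * (d * (volume : Measure (Euc d)).real K.dom) := by
    intro K
    have h1 := K.setIntegral_divergence (v := fun y => y) (C := 1)
      (LipschitzWith.id.lipschitzOnWith)
    simp only [divergence_id, integral_const, measureReal_restrict_apply_univ, smul_eq_mul] at h1
    rw [mul_comm (d : ℝ), h1, ← bdInt_const_mul]
    refine bdInt_congr_ae K fun F hF => ?_
    filter_upwards [hc K F hF] with x hx
    rw [hx, real_inner_smul_left, id]
  have hvol : ∀ K : T.Elem, 0 < d * (volume : Measure (Euc d)).real K.dom := by
    intro K
    have h1 : 0 < volume K.dom := K.isOpen_dom.measure_pos _ K.dom_nonempty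
    have h2 : volume K.dom ≠ ⊤ :=
      ((measure_mono K.dom_subset_closedDom).trans_lt K.isCompact_closedDom.measure_lt_top).ne
    have h3 : (0 : ℝ) < d := Nat.cast_pos.2 (Nat.pos_of_ne_zero (NeZero.ne d))
    exact mul_pos h3 (ENNReal.toReal_pos h1.ne' h2)
  simp only [bds, helem] at hsum
  rw [Finset.sum_eq_zero_iff_of_nonneg fun K _ =>
    mul_nonneg (mul_self_nonneg _) (hvol K).le] at hsum
  refine funext fun F => Lp.ext ?_
  obtain ⟨K, hK⟩ := F.exists_elem
  have h1 := mul_self_eq_zero.1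
    ((mul_eq_zero.1 (hsum K (Finset.mem_univ _))).resolve_right (hvol K).ne')
  filter_upwards [hc K F hK, Skel.zero_ae T F] with x hx h0
  rw [hx, h0, h1, Pi.zero_apply]

end forms

end Triangulation

end HDG

namespace HDG

open Module Filter Topology
open scoped ENNReal

/-! ### The HDG method and the global problem -/

namespace Triangulation

variable {d k : ℕ} {Ω : Set (Euc d)} {T : Triangulation Ω}
variable {β : Euc d → Euc d} {ε : ℝ} {τ : T.Elem → T.Face → ℝ}

/-- The global test spaces are products over the elements, so an equation for all global test
functions is a family of independent equations, one for each element. -/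
lemma forall_sum_eq_zero_iff {ι P : Type*} [Fintype ι] [Zero P] {E : ι → P → ℝ}
    (h0 : ∀ i, E i 0 = 0) : (∀ r : ι → P, ∑ i, E i (r i) = 0) ↔ ∀ i p, E i p = 0 := by
  classical
  refine ⟨fun h i p => ?_, fun h r => Finset.sum_eq_zero fun i _ => h i (r i)⟩
  rw [← h (Pi.single i p), Finset.sum_eq_single i, Pi.single_eq_same]
  · intro j _ hj
    rw [Pi.single_eq_of_ne hj, h0]
  · exact fun hi => absurd (Finset.mem_univ i) hi

/-- The numerical flux `σ_h`. -/
def numFlux (β : Euc d → Euc d) (τ : T.Elem → T.Face → ℝ) (q : VPoly d k) (u : Poly d k)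
    (lam : T.Skel) (K : T.Elem) (F : T.Face) (x : Euc d) : ℝ :=
  inner ℝ (q.1 x) (normal K.1 F.1) + inner ℝ (β x) (normal K.1 F.1) * lam F x
    + τ K F * (u.1 x - lam F x)

/-- Omitting the boundary faces amounts to setting the test function to zero there. -/
lemma bdsInterior_mul (φ : T.Elem → T.Face → Euc d → ℝ) (μ : T.Skel) :
    T.bdsInterior (fun K F x => φ K F x * μ F x) =
      T.bds (fun K F x => φ K F x * T.interiorPart μ F x) := by
  classical
  simp only [bdsInterior, bds, bdInt, Finset.sum_filter]
  refine Finset.sum_congr rfl fun K _ => Finset.sum_congr rfl fun F _ => ?_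
  by_cases hF : F.IsBoundary
  · rw [if_neg (not_not.2 hF), interiorPart_of_isBoundary μ hF]
    refine (integral_eq_zero_of_ae ?_).symm
    filter_upwards [Lp.coeFn_zero ℝ 2 (faceMeasure F.1)] with x hx
    rw [hx, Pi.zero_apply, mul_zero]
  · rw [if_pos hF, interiorPart_of_not_isBoundary μ hF]

variable [NeZero d]

omit [NeZero d] in
lemma flux_equation_iff (q : T.VSpace k) (u : T.WSpace k) (lam : T.Skel) :
    (∀ r : T.VSpace k,
      T.vol (fun K x => ε⁻¹ * inner ℝ ((q K).1 x) ((r K).1 x))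
        - T.vol (fun K x => (u K).1 x * divergence (r K).1 x)
        + T.bds (fun K F x => lam F x * inner ℝ ((r K).1 x) (normal K.1 F.1)) = 0) ↔
      ∀ (K : T.Elem) (r : VPoly d k), (∫ x in K.dom, ε⁻¹ * inner ℝ ((q K).1 x) (r.1 x))
        - (∫ x in K.dom, (u K).1 x * divergence r.1 x)
        = - T.bdInt K (fun F x => lam F x * inner ℝ (r.1 x) (normal K.1 F.1)) := by
  have h0 : divergence (0 : Euc d → Euc d) = 0 := by
    funext x; simp [divergence]
  have key := forall_sum_eq_zero_iff (ι := T.Elem) (P := VPoly d k) (E := fun K r =>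
    (∫ x in K.dom, ε⁻¹ * inner ℝ ((q K).1 x) (r.1 x))
        - (∫ x in K.dom, (u K).1 x * divergence r.1 x)
        + T.bdInt K (fun F x => lam F x * inner ℝ (r.1 x) (normal K.1 F.1)))
    (fun K => by
      simp only [ZeroMemClass.coe_zero, Pi.zero_apply (M := fun _ : Euc d => Euc d), h0,
        Pi.zero_apply (M := fun _ : Euc d => ℝ), inner_zero_right, inner_zero_left, mul_zero,
        integral_zero, bdInt, Finset.sum_const_zero, sub_zero, add_zero])
  simp only [vol, bds, ← Finset.sum_sub_distrib, ← Finset.sum_add_distrib, key,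
    add_eq_zero_iff_eq_neg]

/-- Integrating `q·∇w` by parts cancels the term `q·n` of the numerical flux, and the product rule
merges the two convection integrals into `u ∇·(βw)`. This is the passage from the conservative form
of the method to the form of the local problems. -/
lemma elem_scalar_equation_eq {C : ℝ≥0} {K : T.Elem} (hβ : LipschitzOnWith C β K.closedDom)
    (q : VPoly d k) (u w : Poly d k) (lam : T.Skel) :
    - (∫ x in K.dom, inner ℝ (q.1 x + u.1 x • β x) (gradient w.1 x))
      - (∫ x in K.dom, divergence β x * u.1 x * w.1 x)
      + T.bdInt K (fun F x => numFlux β τ q u lam K F x * w.1 x) =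
    (∫ x in K.dom, divergence q.1 x * w.1 x)
      - (∫ x in K.dom, u.1 x * divergence (fun y => w.1 y • β y) x)
      + T.bdInt K (fun F x => τ K F * u.1 x * w.1 x)
      - T.bdInt K (fun F x => (τ K F - inner ℝ (β x) (normal K.1 F.1)) * lam F x * w.1 x) := by
  have hq := VPoly.continuous q
  have hu := Poly.continuous u
  have hw := Poly.continuous w
  have hgw := Poly.continuous_gradient w
  have hβc := hβ.continuousOn
  have ibp := K.integral_by_parts w q
  have i1 : IntegrableOn (fun x => inner ℝ (q.1 x) (gradient w.1 x)) K.dom :=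
    K.integrableOn (Continuous.continuousOn (by fun_prop))
  have i2 : IntegrableOn (fun x => u.1 x * inner ℝ (β x) (gradient w.1 x)) K.dom := by
    have h1 := hu.continuousOn (s := K.closedDom)
    have h2 := hgw.continuousOn (s := K.closedDom)
    exact K.integrableOn (by fun_prop)
  have i3 : IntegrableOn (fun x => divergence β x * u.1 x * w.1 x) K.dom :=
    (K.integrable_mul (hu.mul hw).continuousOn (Elem.integrableOn_divergence hβ)).congr
      (Eventually.of_forall fun x => by simp only [Pi.mul_apply]; ring)
  have v1 : ∫ x in K.dom, inner ℝ (q.1 x + u.1 x • β x) (gradient w.1 x) =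
      (∫ x in K.dom, inner ℝ (q.1 x) (gradient w.1 x)) +
        ∫ x in K.dom, u.1 x * inner ℝ (β x) (gradient w.1 x) := by
    rw [← integral_add i1 i2]
    simp only [inner_add_left, real_inner_smul_left]
  have v2 : ∫ x in K.dom, u.1 x * divergence (fun y => w.1 y • β y) x =
      (∫ x in K.dom, divergence β x * u.1 x * w.1 x) +
        ∫ x in K.dom, u.1 x * inner ℝ (β x) (gradient w.1 x) := by
    rw [← integral_add i3 i2]
    refine integral_congr_ae ?_
    filter_upwards [Elem.ae_divergence_smul hβ (Poly.contDiff w.2)] with x hx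
    rw [hx]; ring
  have v3 : ∫ x in K.dom, w.1 x * divergence q.1 x = ∫ x in K.dom, divergence q.1 x * w.1 x := by
    simp only [mul_comm]
  have b1 : BdIntegrable K fun F x => w.1 x * inner ℝ (q.1 x) (normal K.1 F.1) := fun F _ =>
    F.integrable (Continuous.continuousOn (by fun_prop))
  have b2 : BdIntegrable K fun F x => τ K F * u.1 x * w.1 x :=
    (bdIntegrable_mul_poly τ u w).congr fun F x => by ring
  have b3 := bdIntegrable_localData (τ := τ) hβ w lam
  have c1 : T.bdInt K (fun F x => numFlux β τ q u lam K F x * w.1 x) =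
      T.bdInt K (fun F x => w.1 x * inner ℝ (q.1 x) (normal K.1 F.1))
      + T.bdInt K (fun F x => τ K F * u.1 x * w.1 x)
      - T.bdInt K (fun F x =>
          (τ K F - inner ℝ (β x) (normal K.1 F.1)) * lam F x * w.1 x) := by
    rw [← bdInt_add b1 b2, ← bdInt_sub (b1.add b2) b3]
    exact bdInt_congr K fun F x => by simp only [numFlux]; ring
  rw [v1, v2, c1]
  linarith

lemma scalar_equation_iff (hβ : IsW1Infty Ω β) (f : L2 Ω) (q : T.VSpace k) (u : T.WSpace k)
    (lam : T.Skel) :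
    (∀ w : T.WSpace k,
      - T.vol (fun K x => inner ℝ ((q K).1 x + (u K).1 x • β x) (gradient (w K).1 x))
        - T.vol (fun K x => divergence β x * (u K).1 x * (w K).1 x)
        + T.bds (fun K F x => numFlux β τ (q K) (u K) lam K F x * (w K).1 x)
        = T.vol (fun K x => f x * (w K).1 x)) ↔
      ∀ (K : T.Elem) (w : Poly d k),
        (∫ x in K.dom, divergence (q K).1 x * w.1 x)
          - (∫ x in K.dom, (u K).1 x * divergence (fun y => w.1 y • β y) x)
          + T.bdInt K (fun F x => τ K F * (u K).1 x * w.1 x)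
          = T.bdInt K (fun F x => (τ K F - inner ℝ (β x) (normal K.1 F.1)) * lam F x * w.1 x)
            + ∫ x in K.dom, f x * w.1 x := by
  have key := forall_sum_eq_zero_iff (ι := T.Elem) (P := Poly d k) (E := fun K w =>
    (∫ x in K.dom, divergence (q K).1 x * w.1 x)
      - (∫ x in K.dom, (u K).1 x * divergence (fun y => w.1 y • β y) x)
      + T.bdInt K (fun F x => τ K F * (u K).1 x * w.1 x)
      - T.bdInt K (fun F x => (τ K F - inner ℝ (β x) (normal K.1 F.1)) * lam F x * w.1 x)
      - ∫ x in K.dom, f x * w.1 x)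
    (fun K => by
      have h0 : divergence (fun _ : Euc d => (0 : Euc d)) = fun _ => 0 := by
        funext x; simp [divergence]
      simp only [ZeroMemClass.coe_zero, Pi.zero_apply (M := fun _ : Euc d => ℝ), zero_smul, h0,
        mul_zero, integral_zero, bdInt, Finset.sum_const_zero, sub_zero, add_zero])
  refine Iff.trans (forall_congr' fun w => ?_) (key.trans
    (forall_congr' fun K => forall_congr' fun w => ?_))
  · rw [← sub_eq_zero]
    simp only [vol, bds, ← Finset.sum_neg_distrib, ← Finset.sum_sub_distrib,
      ← Finset.sum_add_distrib]
    refine Eq.congr (Finset.sum_congr rfl fun K _ => ?_) rfl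
    obtain ⟨C, hC⟩ := hβ.exists_lipschitzOnWith K
    rw [elem_scalar_equation_eq hC]
  · rw [sub_sub, sub_eq_zero]

/-- The part `β·n λ` of the numerical flux comes from a single-valued field, so it disappears when
tested with a single-valued function vanishing on `∂Ω`. This is why `β` does not occur explicitly in
the definitions of `a_h` and `b_h`. -/
lemma bds_numFlux_mul (hβ : IsW1Infty Ω β) (q : T.VSpace k) (u : T.WSpace k) (lam : T.Skel)
    {μ : T.Skel} (hμ : ∀ F : T.Face, F.IsBoundary → μ F = 0) :
    T.bds (fun K F x => numFlux β τ (q K) (u K) lam K F x * μ F x) = - fluxForm τ q u lam μ := by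
  have h := bds_mul_eq_zero lam hμ hβ.1
  have h1 : ∀ K : T.Elem, T.bdInt K (fun F x => numFlux β τ (q K) (u K) lam K F x * μ F x) =
      T.bdInt K (fun F x => inner ℝ ((q K).1 x) (normal K.1 F.1) * μ F x) +
      T.bdInt K (fun F x => τ K F * ((u K).1 x - lam F x) * μ F x) +
      T.bdInt K (fun F x => inner ℝ ((lam F x * μ F x) • β x) (normal K.1 F.1)) := by
    intro K
    have b3 : BdIntegrable K fun F x => inner ℝ ((lam F x * μ F x) • β x) (normal K.1 F.1) :=
      fun F _ => (F.integrable_smul (lam.integrable_mul μ F)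
        (hβ.1.mono F.set_subset_closure)).inner_const _
    have b1 := bdIntegrable_normal_flux K (q K) μ
    have b2 := bdIntegrable_jump_mul (K := K) (τ := τ) (u K) lam μ
    rw [← bdInt_add b1 b2, ← bdInt_add (b1.add b2) b3]
    refine bdInt_congr K fun F x => ?_
    simp only [numFlux, real_inner_smul_left]
    ring
  simp only [bds] at h
  simp only [bds, fluxForm, h1, Finset.sum_add_distrib, h]
  ring

section main

variable (hε : 0 < ε) (hβ : IsW1Infty Ω β)
  (hdiv : ∀ᵐ x ∂(volume.restrict Ω), 0 ≤ - divergence β x) (hτ : T.IsAdmissible β τ)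
include hε hβ hdiv hτ

/-- The data `(λ, f)` are the sum of `(λ, 0)` and `(0, f)`; uniqueness and linearity of the local
solver do the rest. -/
lemma forall_isLocalSolution_iff (q : T.VSpace k) (u : T.WSpace k) (lam : T.Skel) (f : L2 Ω) :
    (∀ K, T.IsLocalSolution k ε β τ lam f K (q K, u K)) ↔
      q = T.qLam k ε β τ lam + T.qSrc k ε β τ f ∧ u = T.uLam k ε β τ lam + T.uSrc k ε β τ f := by
  have h := solver_add (k := k) hε hβ hdiv hτ lam 0 0 f
  rw [add_zero, zero_add] at h
  have hq : T.qLam k ε β τ lam + T.qSrc k ε β τ f = (T.solver k ε β τ lam f).1 :=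
    (congrArg Prod.fst h).symm
  have hu : T.uLam k ε β τ lam + T.uSrc k ε β τ f = (T.solver k ε β τ lam f).2 :=
    (congrArg Prod.snd h).symm
  rw [hq, hu]
  constructor
  · intro hs
    exact ⟨funext fun K => congrArg Prod.fst (eq_solver hε hβ hdiv hτ (hs K)),
      funext fun K => congrArg Prod.snd (eq_solver hε hβ hdiv hτ (hs K))⟩
  · rintro ⟨rfl, rfl⟩ K
    exact solver_spec hε hβ hdiv hτ lam f K

/-- The HDG method in terms of the local solvers and of the global problem for the trace. -/
theorem isHDGSolution_iff (f : L2 Ω) (g : L2Bd Ω) (q : T.VSpace k) (u : T.WSpace k)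
    (lam : T.Skel) :
    T.IsHDGSolution k ε β τ f g q u lam ↔
      (q = T.qLam k ε β τ lam + T.qSrc k ε β τ f ∧
        u = T.uLam k ε β τ lam + T.uSrc k ε β τ f) ∧
      lam ∈ T.MSpaceBC k g ∧
      ∀ μ ∈ T.MSpaceBC k 0, T.aForm k ε β τ lam μ = T.bForm k ε β τ f μ := by
  -- Once `(q, u)` is split, the flux tested with an interior function is `b_h - a_h`, so
  -- conservation across faces is the global equation.
  have htrans : q = T.qLam k ε β τ lam + T.qSrc k ε β τ f →
      u = T.uLam k ε β τ lam + T.uSrc k ε β τ f → ∀ μ : T.Skel,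
      (T.bdsInterior (fun K F x => numFlux β τ (q K) (u K) lam K F x * μ F x) = 0 ↔
        T.aForm k ε β τ lam (T.interiorPart μ) = T.bForm k ε β τ f (T.interiorPart μ)) := by
    rintro rfl rfl μ
    have h := fluxForm_add_left (τ := τ) (T.qLam k ε β τ lam) (T.qSrc k ε β τ f)
      (T.uLam k ε β τ lam) (T.uSrc k ε β τ f) lam 0 (T.interiorPart μ)
    rw [add_zero] at h
    rw [bdsInterior_mul, bds_numFlux_mul hβ _ _ _ fun F hF => interiorPart_of_isBoundary μ hF,
      neg_eq_zero, h, aForm_eq_fluxForm, bForm_eq_fluxForm, add_eq_zero_iff_eq_neg]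
  constructor
  · intro h
    have hloc : ∀ K, T.IsLocalSolution k ε β τ lam f K (q K, u K) := fun K =>
      ⟨(flux_equation_iff q u lam).1 h.eq_flux K,
        (scalar_equation_iff hβ f q u lam).1 h.eq_scalar K⟩
    have hqu := (forall_isLocalSolution_iff hε hβ hdiv hτ q u lam f).1 hloc
    refine ⟨hqu, ⟨h.mem, h.eq_boundary⟩, fun μ hμ => ?_⟩
    have h1 := (htrans hqu.1 hqu.2 μ).1 (h.eq_transmission μ hμ.1)
    rwa [interiorPart_eq_self_of_mem hμ] at h1
  · rintro ⟨hqu, hlam, hglob⟩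
    have hloc := (forall_isLocalSolution_iff hε hβ hdiv hτ q u lam f).2 hqu
    exact ⟨hlam.1, (flux_equation_iff q u lam).2 fun K => (hloc K).1,
      (scalar_equation_iff hβ f q u lam).2 fun K => (hloc K).2, hlam.2,
      fun μ hμ => (htrans hqu.1 hqu.2 μ).2 (hglob _ (interiorPart_mem_MSpaceBC hμ))⟩

/-- The global problem for the trace is uniquely solvable. -/
theorem existsUnique_global_problem (f : L2 Ω) (g : L2Bd Ω) :
    ∃! lam : T.Skel, lam ∈ T.MSpaceBC k g ∧
      ∀ μ ∈ T.MSpaceBC k 0, T.aForm k ε β τ lam μ = T.bForm k ε β τ f μ :=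
  existsUnique_skeleton_problem (aBilin hε hβ hdiv hτ k) (bLin k ε β τ f) g
    fun _ hlam h => eq_zero_of_aForm_self_eq_zero hε hβ hdiv hτ hlam h

/-- The HDG method is uniquely solvable. -/
theorem existsUnique_isHDGSolution (f : L2 Ω) (g : L2Bd Ω) :
    ∃! s : T.VSpace k × T.WSpace k × T.Skel, T.IsHDGSolution k ε β τ f g s.1 s.2.1 s.2.2 := by
  simp only [isHDGSolution_iff hε hβ hdiv hτ]
  obtain ⟨lam, hlam, huniq⟩ := existsUnique_global_problem (k := k) hε hβ hdiv hτ f g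
  refine ⟨(T.qLam k ε β τ lam + T.qSrc k ε β τ f, T.uLam k ε β τ lam + T.uSrc k ε β τ f, lam),
    ⟨⟨rfl, rfl⟩, hlam⟩, ?_⟩
  rintro ⟨q, u, lam'⟩ ⟨⟨hq, hu⟩, h⟩
  have hl : lam' = lam := huniq lam' h
  subst hl
  exact Prod.ext hq (Prod.ext hu rfl)

end main

end Triangulation

end HDG

end

/-! ### The characterization theorem -/

theorem theorem3p1 {d : ℕ} (hd : 2 ≤ d) {Ω : Set (HDG.Euc d)} (hΩ : IsOpen Ω)
    (T : HDG.Triangulation Ω) (k : ℕ) (ε : ℝ) (hε : 0 < ε)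
    (β : HDG.Euc d → HDG.Euc d) (hβ : HDG.IsW1Infty Ω β)
    (hdiv : ∀ᵐ x ∂(MeasureTheory.volume.restrict Ω), 0 ≤ - HDG.divergence β x)
    (τ : T.Elem → T.Face → ℝ) (hτ : T.IsAdmissible β τ)
    (f : HDG.L2 Ω) (g : HDG.L2Bd Ω) :
    -- the local problems are uniquely solvable, so that the local solvers are well defined
    (∀ (lam : T.Skel) (f' : HDG.L2 Ω) (K : T.Elem),
      ∃! s : HDG.VPoly d k × HDG.Poly d k, T.IsLocalSolution k ε β τ lam f' K s) ∧
    -- the HDG method has exactly one solution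
    (∃! s : T.VSpace k × T.WSpace k × T.Skel, T.IsHDGSolution k ε β τ f g s.1 s.2.1 s.2.2) ∧
    -- it splits, and its trace is the solution of the global problem
    (∀ (q : T.VSpace k) (u : T.WSpace k) (uhat : T.Skel),
      T.IsHDGSolution k ε β τ f g q u uhat →
        q = T.qLam k ε β τ uhat + T.qSrc k ε β τ f ∧
        u = T.uLam k ε β τ uhat + T.uSrc k ε β τ f ∧
        uhat ∈ T.MSpaceBC k g ∧
        ∀ lam ∈ T.MSpaceBC k g,
          (∀ μ ∈ T.MSpaceBC k 0, T.aForm k ε β τ lam μ = T.bForm k ε β τ f μ) ↔ lam = uhat) ∧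
    -- the formula for `a_h`
    (∀ lam μ : T.Skel,
      T.aForm k ε β τ lam μ =
        T.vol (fun K x => ε⁻¹ *
            inner ℝ ((T.qLam k ε β τ lam K).1 x) ((T.qLam k ε β τ μ K).1 x))
          - T.vol (fun K x => (T.uLam k ε β τ lam K).1 x *
              HDG.divergence (fun y => (T.uLam k ε β τ μ K).1 y • β y) x)
          + T.bds (fun K F x => inner ℝ (β x) (HDG.normal K.1 F.1) * lam F x *
              (T.uLam k ε β τ μ K).1 x)
          + T.bds (fun K F x => τ K F * ((T.uLam k ε β τ lam K).1 x - lam F x) *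
              ((T.uLam k ε β τ μ K).1 x - μ F x))) ∧
    -- the formula for `b_h`
    (∀ μ : T.Skel,
      T.bForm k ε β τ f μ =
        T.vol (fun K x => f x * (T.uLam k ε β τ μ K).1 x)
          + T.bds (fun K F x => inner ℝ (β x) (HDG.normal K.1 F.1) *
              (T.uSrc k ε β τ f K).1 x * μ F x)
          + T.vol (fun K x => (T.uSrc k ε β τ f K).1 x *
              inner ℝ (β x) (gradient (T.uLam k ε β τ μ K).1 x))
          - T.vol (fun K x => inner ℝ (gradient (T.uSrc k ε β τ f K).1 x)
              ((T.uLam k ε β τ μ K).1 x • β x))) := by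
  have : NeZero d := ⟨by omega⟩
  refine ⟨fun lam f' K => ?_,
    HDG.Triangulation.existsUnique_isHDGSolution hε hβ hdiv hτ f g, fun q u uhat h => ?_,
    HDG.Triangulation.aForm_eq hε hβ hdiv hτ, HDG.Triangulation.bForm_eq hε hβ hdiv hτ f⟩
  · obtain ⟨C, hC⟩ := hβ.exists_lipschitzOnWith K
    exact HDG.Triangulation.existsUnique_isLocalSolution hε hC hdiv hτ lam f'
  · obtain ⟨⟨hq, hu⟩, huhat, hglob⟩ :=
      (HDG.Triangulation.isHDGSolution_iff hε hβ hdiv hτ f g q u uhat).1 h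
    refine ⟨hq, hu, huhat, fun lam hlam => ⟨fun h' => ?_, fun h' => h' ▸ hglob⟩⟩
    exact (HDG.Triangulation.existsUnique_global_problem hε hβ hdiv hτ f g).unique
      ⟨hlam, h'⟩ ⟨huhat, hglob⟩
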